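/- Call a finite simple graph a forest if it has no cycle, and a pseudoforest if each of its connected components contains at most one cycle. A partition of a simple graph $G=(V,E)$ into (pseudo)forests is a tuple of pairwise disjoint edge sets, possibly empty, whose union is $E$ and each of which is the edge set of a (pseudo)forest on $V$. There is a linear-time algorithm that converts every partition $(P_A,P_B,P_C)$ of a finite simple graph $G$ into three pseudoforests into a partition $(F_1,F_2,F_3,F_4)$ of $G$ into four forests such that $F_4$ has maximum degree at most three. Precisely: there are a fixed program for the word RAM (words of $\log_2(n+m+1)+O(1)$ bits, unit-cost addition, subtraction, comparison and memory access) and a constant $K$ such that, for all $n,m\ge 0$, for every simple graph $G$ with vertex set $\{0,\dots,n-1\}$ and $m$ edges, and for every partition $(P_A,P_B,P_C)$ of $G$ into pseudoforests, given as $n$, $m$ and a list of the $m$ edges (in any order, each in any orientation) with the index of the part containing each edge, the program halts after at most $K\,(n+m+1)$ steps and outputs, for each edge of the list, the index of the part containing it in such a partition $(F_1,F_2,F_3,F_4)$. -/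

import Mathlib

/-! ### Partitions of the edge set of a simple graph -/

/-- `E(G)` is the disjoint union of the edge sets of `H 0, …, H (k-1)`; parts may be empty. -/
structure IsEdgePartition {V : Type*} {k : ℕ} (G : SimpleGraph V) (H : Fin k → SimpleGraph V) :
    Prop where
  disjoint : ∀ i j, i ≠ j → Disjoint (H i).edgeSet (H j).edgeSet
  union : (⋃ i, (H i).edgeSet) = G.edgeSet

/-- A pseudoforest has at most one cycle per connected component: any two cycles in the same
component are the same cycle, that is, have the same edges. -/
def IsPseudoforest {V : Type*} (H : SimpleGraph V) : Prop :=
  ∀ ⦃u v : V⦄ (p : H.Walk u u) (q : H.Walk v v), p.IsCycle → q.IsCycle → H.Reachable u v →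
    ∀ e, e ∈ p.edges ↔ e ∈ q.edges

def IsPseudoforestPartition {V : Type*} {k : ℕ} (G : SimpleGraph V)
    (P : Fin k → SimpleGraph V) : Prop :=
  IsEdgePartition G P ∧ ∀ i, IsPseudoforest (P i)

def IsForestPartition {V : Type*} {k : ℕ} (G : SimpleGraph V)
    (F : Fin k → SimpleGraph V) : Prop :=
  IsEdgePartition G F ∧ ∀ i, (F i).IsAcyclic

/-- A list of `m` edges on the vertices `0, …, n-1`, each with the number of its part. -/
structure EdgeList (n m k : ℕ) where
  src : Fin m → Fin n
  dst : Fin m → Fin n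
  part : Fin m → Fin k

/-- The list contains every edge of every `H j` exactly once, in one of its two orientations and
with the part number `j`, and contains nothing else. The order of the list is arbitrary. -/
structure EdgeList.Represents {n m k : ℕ} (L : EdgeList n m k)
    (H : Fin k → SimpleGraph (Fin n)) : Prop where
  nodup : Function.Injective fun i => s(L.src i, L.dst i)
  edges : ∀ j, (H j).edgeSet = {e | ∃ i, L.part i = j ∧ e = s(L.src i, L.dst i)}

/-! ### A word RAM with step count

Programs are structured (`while`) programs over registers and arrays, whose names are fixed in the
program text, so that each program has finitely many of them. Every operation on words, every
memory access, every test and every assignment costs one step. The only arithmetic is addition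
and truncated subtraction. -/

namespace RAM

structure State where
  reg : ℕ → ℕ
  arr : ℕ → ℕ → ℕ

inductive Expr where
  | const (k : ℕ)
  | reg (x : ℕ)
  | get (a : ℕ) (i : Expr)
  | add (e f : Expr)
  | sub (e f : Expr)

def Expr.eval (s : State) : Expr → ℕ
  | const k => k
  | reg x => s.reg x
  | get a i => s.arr a (i.eval s)
  | add e f => e.eval s + f.eval s
  | sub e f => e.eval s - f.eval s

def Expr.cost : Expr → ℕ
  | const _ => 1
  | reg _ => 1
  | get _ i => i.cost + 1
  | add e f => e.cost + f.cost + 1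
  | sub e f => e.cost + f.cost + 1

inductive Test where
  | lt (e f : Expr)
  | eq (e f : Expr)
  | not (b : Test)
  | and (b c : Test)

def Test.eval (s : State) : Test → Prop
  | lt e f => e.eval s < f.eval s
  | eq e f => e.eval s = f.eval s
  | not b => ¬ b.eval s
  | and b c => b.eval s ∧ c.eval s

def Test.cost : Test → ℕ
  | lt e f => e.cost + f.cost + 1
  | eq e f => e.cost + f.cost + 1
  | not b => b.cost + 1
  | and b c => b.cost + c.cost + 1

inductive Program where
  | skip
  | set (x : ℕ) (e : Expr)
  | put (a : ℕ) (i e : Expr)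
  | seq (p q : Program)
  | ite (b : Test) (p q : Program)
  | while (b : Test) (p : Program)

def State.setReg (s : State) (x v : ℕ) : State :=
  { s with reg := Function.update s.reg x v }

def State.setArr (s : State) (a i v : ℕ) : State :=
  { s with arr := Function.update s.arr a (Function.update (s.arr a) i v) }

/-- `Exec W p s t s'`: on a machine whose memory words hold the numbers `0, …, W`, the program `p`
started in `s` halts after exactly `t` steps in `s'`. A program that tries to store a number above
`W`, or to access an array at an index above `W` by `put`, is stuck. Inside an expression
intermediate values exceed `W` at most by a factor that depends on the program alone. -/
inductive Exec (W : ℕ) : Program → State → ℕ → State → Prop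
  | skip (s : State) : Exec W .skip s 1 s
  | set {s : State} {x : ℕ} {e : Expr} (h : e.eval s ≤ W) :
      Exec W (.set x e) s (e.cost + 1) (s.setReg x (e.eval s))
  | put {s : State} {a : ℕ} {i e : Expr} (hi : i.eval s ≤ W) (h : e.eval s ≤ W) :
      Exec W (.put a i e) s (i.cost + e.cost + 1) (s.setArr a (i.eval s) (e.eval s))
  | seq {p q : Program} {s s₁ s₂ : State} {t₁ t₂ : ℕ} (h₁ : Exec W p s t₁ s₁)
      (h₂ : Exec W q s₁ t₂ s₂) : Exec W (.seq p q) s (t₁ + t₂) s₂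
  | ite_true {b : Test} {p q : Program} {s s₁ : State} {t : ℕ} (hb : b.eval s)
      (h : Exec W p s t s₁) : Exec W (.ite b p q) s (b.cost + 1 + t) s₁
  | ite_false {b : Test} {p q : Program} {s s₁ : State} {t : ℕ} (hb : ¬ b.eval s)
      (h : Exec W q s t s₁) : Exec W (.ite b p q) s (b.cost + 1 + t) s₁
  | while_false {b : Test} {p : Program} {s : State} (hb : ¬ b.eval s) :
      Exec W (.while b p) s (b.cost + 1) s
  | while_true {b : Test} {p : Program} {s s₁ s₂ : State} {t₁ t₂ : ℕ} (hb : b.eval s)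
      (h₁ : Exec W p s t₁ s₁) (h₂ : Exec W (.while b p) s₁ t₂ s₂) :
      Exec W (.while b p) s (b.cost + 1 + t₁ + t₂) s₂

/-- The machine is deterministic, so final state and running time are functions of the input. -/
theorem Exec.deterministic {W : ℕ} {p : Program} {s s₁ s₂ : State} {t₁ t₂ : ℕ}
    (h₁ : Exec W p s t₁ s₁) (h₂ : Exec W p s t₂ s₂) : t₁ = t₂ ∧ s₁ = s₂ := by
  induction h₁ generalizing t₂ s₂ with
  | skip s => cases h₂; exact ⟨rfl, rfl⟩
  | set h => cases h₂; exact ⟨rfl, rfl⟩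
  | put hi h => cases h₂; exact ⟨rfl, rfl⟩
  | seq _ _ ih₁ ih₂ =>
    cases h₂ with
    | seq k₁ k₂ =>
      obtain ⟨rfl, rfl⟩ := ih₁ k₁
      obtain ⟨rfl, rfl⟩ := ih₂ k₂
      exact ⟨rfl, rfl⟩
  | ite_true hb _ ih =>
    cases h₂ with
    | ite_true _ k => obtain ⟨rfl, rfl⟩ := ih k; exact ⟨rfl, rfl⟩
    | ite_false hb' _ => exact absurd hb hb'
  | ite_false hb _ ih =>
    cases h₂ with
    | ite_true hb' _ => exact absurd hb' hb
    | ite_false _ k => obtain ⟨rfl, rfl⟩ := ih k; exact ⟨rfl, rfl⟩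
  | while_false hb =>
    cases h₂ with
    | while_false _ => exact ⟨rfl, rfl⟩
    | while_true hb' _ _ => exact absurd hb' hb
  | while_true hb _ _ ih₁ ih₂ =>
    cases h₂ with
    | while_false hb' => exact absurd hb hb'
    | while_true _ k₁ k₂ =>
      obtain ⟨rfl, rfl⟩ := ih₁ k₁
      obtain ⟨rfl, rfl⟩ := ih₂ k₂
      exact ⟨rfl, rfl⟩

/-- An array holding the given numbers, followed by zeros. -/
def arrayOf {m k : ℕ} (f : Fin m → Fin k) (i : ℕ) : ℕ :=
  if h : i < m then (f ⟨i, h⟩ : ℕ) else 0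

/-- The input: registers `0` and `1` hold `n` and `m`, arrays `0`, `1` and `2` hold the edge list,
and all other memory is zero. -/
def inputState {n m k : ℕ} (L : EdgeList n m k) : State where
  reg := fun x => if x = 0 then n else if x = 1 then m else 0
  arr := fun a => if a = 0 then arrayOf L.src else if a = 1 then arrayOf L.dst
    else if a = 2 then arrayOf L.part else fun _ => 0

end RAM

/-! In a pseudoforest without leaves every component that has an edge is a cycle. Stripping
all leaves thus reduces the parts `A`, `B`, `C` to disjoint cycles, and choosing one edge of each
cycle turns the rest of a part into a forest. The chosen edges of one part form a matching, so a
graph formed by chosen edges has maximum degree at most three. The chosen edges make up the fourth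
forest, except that a few of them have to move to other forests: an edge may be put into the forest
of another part if its ends are covered by the chosen edges of that part and it closes no cycle with
them, because the rest of that part connects the covered vertices no more than its chosen edges do.

An edge closes a cycle in a union of disjoint paths only if it joins the two ends of one path, and
then the next edge of its cycle does not. Hence the chosen edges of `A` and `B` can be taken to form
paths, and it suffices to remember the other end of each path to test an edge in constant time.

On a cycle of `C`, consider an edge at a vertex `y` that no chosen edge of `A` covers. If no chosen
edge of `B` covers `y`, the edge is pendant in the fourth forest. If one covers `y` but none covers
the other end, the edge or the next one extends the paths. If both ends are covered, the edge moves
to the forest `B`, unless the chosen edge `g` of `B` at `y` has an edge that has been moved so at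
its other end: then `g` moves to the forest `C`, and the edge is pendant in the fourth forest. If
the chosen edges of `A` cover the whole cycle, an edge of it moves to the forest `A`. -/

open SimpleGraph

section Graph

variable {V : Type*} {G H : SimpleGraph V}

theorem reachable_or_of_reachable_sup_edge {x y p q : V} (h : (G ⊔ edge x y).Reachable p q) :
    G.Reachable p q ∨ (G.Reachable p x ∧ G.Reachable y q) ∨
      (G.Reachable p y ∧ G.Reachable x q) := by
  obtain ⟨w⟩ := h
  induction w with
  | nil => exact Or.inl (Reachable.refl _)
  | cons hadj _ ih =>
    rw [sup_adj, edge_adj] at hadj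
    rcases hadj with hadj | ⟨⟨rfl, rfl⟩ | ⟨rfl, rfl⟩, -⟩
    · exact ih.imp hadj.reachable.trans
        (Or.imp (And.imp_left hadj.reachable.trans) (And.imp_left hadj.reachable.trans))
    · rcases ih with h | ⟨-, h⟩ | ⟨-, h⟩
      · exact Or.inr (Or.inl ⟨Reachable.refl _, h⟩)
      · exact Or.inr (Or.inl ⟨Reachable.refl _, h⟩)
      · exact Or.inl h
    · rcases ih with h | ⟨-, h⟩ | ⟨-, h⟩
      · exact Or.inr (Or.inr ⟨Reachable.refl _, h⟩)
      · exact Or.inl h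
      · exact Or.inr (Or.inr ⟨Reachable.refl _, h⟩)

/-! ### Acyclicity -/

theorem isAcyclic_of_forall_adj_or_subsingleton_neighborSet (hG : G.IsAcyclic)
    (h : ∀ u v, H.Adj u v →
      G.Adj u v ∨ (H.neighborSet u).Subsingleton ∨ (H.neighborSet v).Subsingleton) :
    H.IsAcyclic := by
  intro v p hp
  have not_subsingleton : ∀ u ∈ p.support, ¬ (H.neighborSet u).Subsingleton := by
    intro u hu hsub
    obtain ⟨a, b, hab, hnbr⟩ := Set.ncard_eq_two.1 (hp.ncard_neighborSet_toSubgraph_eq_two hu)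
    have hsub' : ({a, b} : Set V) ⊆ H.neighborSet u := hnbr ▸ p.toSubgraph.neighborSet_subset u
    exact hab (hsub (hsub' (Or.inl rfl)) (hsub' (Or.inr rfl)))
  have adj_of_mem_edges : ∀ e ∈ p.edges, e ∈ G.edgeSet := by
    rintro ⟨a, b⟩ he
    rcases h a b (p.adj_of_mem_edges he) with hab | ha | hb
    · exact hab
    · exact absurd ha (not_subsingleton a (p.fst_mem_support_of_mem_edges he))
    · exact absurd hb (not_subsingleton b (p.snd_mem_support_of_mem_edges he))
  exact hG _ (hp.transfer adj_of_mem_edges)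

/-- `X`-steps start and end in `T`, so each maximal `R`-part of a walk joins two vertices of `T`
and can be replaced by a walk in `M`. -/
theorem reachable_sup_of_forall_mem_reachable {R M X : SimpleGraph V} {T : Set V}
    (hT : ∀ u ∈ T, ∀ v ∈ T, R.Reachable u v → M.Reachable u v) (hX : X.support ⊆ T) {u v : V}
    (hu : u ∈ T) (hv : v ∈ T) (h : (R ⊔ X).Reachable u v) : (M ⊔ X).Reachable u v := by
  have reachable_first : ∃ t ∈ T, R.Reachable u t ∧ (M ⊔ X).Reachable t v := by
    clear hu
    obtain ⟨w⟩ := h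
    induction w with
    | nil => exact ⟨_, hv, Reachable.refl _, Reachable.refl _⟩
    | @cons a b _ hadj _ ih =>
      obtain ⟨t, ht, hbt, htv⟩ := ih hv
      rcases hadj with hR | hX'
      · exact ⟨t, ht, hR.reachable.trans hbt, htv⟩
      · have hab : (M ⊔ X).Adj a b := Or.inr hX'
        have hb : b ∈ T := hX (X.mem_support.2 ⟨a, hX'.symm⟩)
        exact ⟨a, hX (X.mem_support.2 ⟨b, hX'⟩), Reachable.refl _,
          hab.reachable.trans (((hT b hb t ht hbt).mono le_sup_left).trans htv)⟩
  obtain ⟨t, ht, hut, htv⟩ := reachable_first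
  exact ((hT u hu t ht hut).mono le_sup_left).trans htv

theorem isAcyclic_sup_of_forall_mem_reachable {R M X : SimpleGraph V} {T : Set V}
    (hR : R.IsAcyclic) (hMX : (M ⊔ X).IsAcyclic) (hdisj : Disjoint M X)
    (hT : ∀ u ∈ T, ∀ v ∈ T, R.Reachable u v → M.Reachable u v) (hX : X.support ⊆ T) :
    (R ⊔ X).IsAcyclic := by
  intro v p hp
  by_cases hpR : ∀ e ∈ p.edges, e ∈ R.edgeSet
  · exact hR _ (hp.transfer hpR)
  push Not at hpR
  obtain ⟨⟨x, y⟩, he, heR⟩ := hpR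
  have hXxy : X.Adj x y := (p.adj_of_mem_edges he).resolve_left heR
  set X' := X.deleteEdges {s(x, y)}
  have hreach : ((R ⊔ X).deleteEdges {s(x, y)}).Reachable x y :=
    (adj_and_reachable_delete_edges_iff_exists_cycle.2 ⟨v, p, hp, he⟩).2
  have hreach' : (R ⊔ X').Reachable x y := hreach.mono fun a b hab => by
    rw [deleteEdges_adj, sup_adj] at hab
    rw [sup_adj, deleteEdges_adj]
    tauto
  have hMX' : (M ⊔ X').Reachable x y :=
    reachable_sup_of_forall_mem_reachable hT ((support_mono (deleteEdges_le _)).trans hX)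
      (hX hXxy.left_mem_support) (hX hXxy.right_mem_support) hreach'
  refine (isBridge_iff.1 ((isAcyclic_iff_forall_isBridge.1 hMX) (e := s(x, y)) (Or.inr hXxy)))
    (hMX'.mono fun a b hab => ?_)
  rw [deleteEdges_adj, sup_adj]
  rcases hab with hM | hX'
  · refine ⟨Or.inl hM, fun heq => ?_⟩
    have hMxy : M.Adj x y := by rwa [← mem_edgeSet, ← Set.mem_singleton_iff.1 heq]
    exact disjoint_left.1 hdisj x y hMxy hXxy
  · rw [deleteEdges_adj] at hX'
    exact ⟨Or.inr hX'.1, hX'.2⟩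

/-! ### Pseudoforests without leaves -/

theorem exists_isCycle_of_forall_ncard_neighborSet_ne_one [Finite V] {v : V}
    (hv : (G.neighborSet v).Nonempty)
    (h : ∀ w, w ≠ v → G.Reachable v w → (G.neighborSet w).ncard ≠ 1) :
    ∃ (u : V) (p : G.Walk u u), p.IsCycle ∧ G.Reachable v u := by
  classical
  have := Fintype.ofFinite V
  set C := G.connectedComponentMk v
  by_cases hC : C.toSimpleGraph.IsAcyclic
  · obtain ⟨x, hx⟩ := hv
    have : Nontrivial C := ⟨⟨v, rfl⟩, ⟨x, (ConnectedComponent.sound (Adj.reachable hx)).symm⟩,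
      fun heq => G.ne_of_adj hx (congrArg Subtype.val heq)⟩
    obtain ⟨a, b, hab, ha, hb⟩ :=
      IsTree.exists_ne_and_degree_eq_one (⟨C.connected_toSimpleGraph, hC⟩ : C.toSimpleGraph.IsTree)
    have no_leaf : ∀ c : C, c.1 ≠ v → C.toSimpleGraph.degree c ≠ 1 := by
      intro c hcv hc
      have hsub : G.neighborSet c ⊆ C.supp := fun w hw =>
        (ConnectedComponent.sound (Adj.reachable hw)).symm.trans c.2
      refine h c hcv (ConnectedComponent.exact c.2).symm ?_
      rw [← coe_neighborFinset, Set.ncard_coe_finset, card_neighborFinset_eq_degree,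
        ← degree_induce_of_neighborSet_subset hsub]
      exact hc
    by_cases hav : a.1 = v
    · exact absurd hb (no_leaf b fun hbv => hab (Subtype.ext (hav.trans hbv.symm)))
    · exact absurd ha (no_leaf a hav)
  · simp only [IsAcyclic, not_forall, not_not] at hC
    obtain ⟨u, p, hp⟩ := hC
    exact ⟨u, p.map C.toSimpleGraph_hom, hp.map Subtype.val_injective,
      (ConnectedComponent.exact u.2).symm⟩

theorem exists_isCycle_deleteEdges_of_isBridge [Finite V]
    (h : ∀ v, (G.neighborSet v).ncard ≠ 1) {x y : V} (hxy : G.Adj x y)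
    (hbridge : G.IsBridge s(x, y)) :
    ∃ (u : V) (p : (G.deleteEdges {s(x, y)}).Walk u u),
      p.IsCycle ∧ (G.deleteEdges {s(x, y)}).Reachable x u := by
  apply exists_isCycle_of_forall_ncard_neighborSet_ne_one
  · have hpos : 0 < (G.neighborSet x).ncard := (Set.ncard_pos (Set.toFinite _)).2 ⟨y, hxy⟩
    have hone := h x
    obtain ⟨z, hz, hzy⟩ := Set.exists_ne_of_one_lt_ncard (by omega : 1 < (G.neighborSet x).ncard) y
    refine ⟨z, ?_⟩
    rw [mem_neighborSet, deleteEdges_adj, Set.mem_singleton_iff, Sym2.congr_right]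
    exact ⟨hz, hzy⟩
  · intro w hwx hw
    have hwy : w ≠ y := fun heq => hbridge (heq ▸ hw)
    have hnbr : (G.deleteEdges {s(x, y)}).neighborSet w = G.neighborSet w := by
      ext z
      rw [mem_neighborSet, mem_neighborSet, deleteEdges_adj, Set.mem_singleton_iff, Sym2.eq_iff]
      tauto
    exact hnbr ▸ h w

end Graph

theorem IsPseudoforest.anti {V : Type*} {G H : SimpleGraph V} (hle : G ≤ H)
    (hH : IsPseudoforest H) : IsPseudoforest G := by
  intro u v p q hp hq hr e
  simpa only [Walk.edges_mapLe_eq_edges] using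
    hH (p.mapLe hle) (q.mapLe hle) (hp.mapLe hle) (hq.mapLe hle) (hr.mono hle) e

section IsPseudoforest

variable {V : Type*} {H : SimpleGraph V} [Finite V]

/-- A bridge would leave a cycle on each of its two sides. -/
theorem IsPseudoforest.not_isBridge (hH : IsPseudoforest H)
    (h : ∀ v, (H.neighborSet v).ncard ≠ 1) {x y : V} (hxy : H.Adj x y) :
    ¬ H.IsBridge s(x, y) := by
  classical
  intro hbridge
  have hle : H.deleteEdges {s(x, y)} ≤ H := deleteEdges_le _
  obtain ⟨u, p, hp, hu⟩ := exists_isCycle_deleteEdges_of_isBridge h hxy hbridge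
  have hbridge' : H.IsBridge s(y, x) := by rwa [Sym2.eq_swap]
  have hside := exists_isCycle_deleteEdges_of_isBridge h hxy.symm hbridge'
  rw [Sym2.eq_swap] at hside
  obtain ⟨v, q, hq, hv⟩ := hside
  have hedges := hH (p.mapLe hle) (q.mapLe hle) (hp.mapLe hle) (hq.mapLe hle)
    ((hu.symm.mono hle).trans (hxy.reachable.trans (hv.mono hle)))
  simp only [Walk.edges_mapLe_eq_edges] at hedges
  have hsnd : p.snd ∈ q.support := q.snd_mem_support_of_mem_edges
    ((hedges _).1 (p.mk_start_snd_mem_edges hp.not_nil))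
  exact hbridge ((hu.trans (p.adj_snd hp.not_nil).reachable).trans
    ((q.takeUntil _ hsnd).reachable.symm.trans hv.symm))

theorem IsPseudoforest.isCycles (hH : IsPseudoforest H)
    (h : ∀ v, (H.neighborSet v).ncard ≠ 1) : H.IsCycles := by
  classical
  rintro v ⟨u, hu⟩
  have exists_cycle : ∀ w, H.Adj v w →
      ∃ (a : V) (p : H.Walk a a), p.IsCycle ∧ s(v, w) ∈ p.edges := by
    intro w hw
    have := hH.not_isBridge h hw
    rw [isBridge_iff_forall_cycle_notMem hw] at this
    push Not at this
    exact this
  obtain ⟨a, p, hp, hup⟩ := exists_cycle u hu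
  have hnbr : H.neighborSet v = p.toSubgraph.neighborSet v := by
    refine Set.Subset.antisymm (fun w hw => ?_) (p.toSubgraph.neighborSet_subset v)
    obtain ⟨b, q, hq, hwq⟩ := exists_cycle w hw
    have hab : H.Reachable a b :=
      (p.takeUntil v (p.fst_mem_support_of_mem_edges hup)).reachable.trans
        (q.takeUntil v (q.fst_mem_support_of_mem_edges hwq)).reachable.symm
    rw [Subgraph.mem_neighborSet, ← Subgraph.mem_edgeSet, Walk.mem_edges_toSubgraph]
    exact (hH p q hp hq hab _).2 hwq
  rw [hnbr]
  exact hp.ncard_neighborSet_toSubgraph_eq_two (p.fst_mem_support_of_mem_edges hup)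

end IsPseudoforest

/-! ### Path ends -/

section PathEnds

variable {V : Type*} {G : SimpleGraph V}

/-- `G` is a forest and `o` maps each vertex `v` of degree at most one to the other vertex of
degree at most one in its component (to `v` itself when `v` is isolated). The values of `o` at
all other vertices are arbitrary. -/
structure PathEnds (G : SimpleGraph V) (o : V → V) : Prop where
  acyclic : G.IsAcyclic
  reachable : ∀ v, (G.neighborSet v).Subsingleton → G.Reachable v (o v)
  eq_of_reachable : ∀ u v, (G.neighborSet u).Subsingleton → (G.neighborSet v).Subsingleton →
    u ≠ v → G.Reachable u v → o u = v

/-- The new path ends after adding an edge between the path ends `x` and `y`. -/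
def mergeEnds [DecidableEq V] (o : V → V) (x y : V) : V → V :=
  Function.update (Function.update o (o x) (o y)) (o y) (o x)

theorem PathEnds.bot : PathEnds (⊥ : SimpleGraph V) id where
  acyclic := isAcyclic_bot
  reachable v _ := Reachable.refl v
  eq_of_reachable _ _ _ _ hne h :=
    absurd h (not_reachable_of_neighborSet_left_eq_empty hne neighborSet_bot)

section Merge

variable {o : V → V} {x y : V}

theorem PathEnds.not_reachable (h : PathEnds G o) (hx : (G.neighborSet x).Subsingleton)
    (hy : (G.neighborSet y).Subsingleton) (hxy : x ≠ y) (ho : o y ≠ x) : ¬ G.Reachable x y :=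
  fun hr => ho (h.eq_of_reachable y x hy hx hxy.symm hr.symm)

/-- Joining `x` to `y` uses up the end `x`, unless `x` was isolated and hence `o x = x`. -/
theorem PathEnds.eq_of_subsingleton_sup_edge (h : PathEnds G o)
    (hx : (G.neighborSet x).Subsingleton) (hn : ¬ G.Reachable x y) {p : V}
    (hp : ((G ⊔ edge x y).neighborSet p).Subsingleton) (hpx : G.Reachable p x) : p = o x := by
  by_cases hpx' : p = x
  · subst hpx'
    have hempty : G.neighborSet p = ∅ := by
      refine Set.eq_empty_iff_forall_notMem.2 fun u hu => hn ?_
      have huy : u = y := hp (Or.inl hu)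
        (Or.inr ((edge_adj _ _ _ _).2 ⟨Or.inl ⟨rfl, rfl⟩, fun heq => hn (heq ▸ Reachable.refl _)⟩))
      exact huy ▸ Adj.reachable hu
    by_contra hne
    exact not_reachable_of_neighborSet_left_eq_empty hne hempty (h.reachable p hx)
  · exact (h.eq_of_reachable x p hx (hp.anti fun _ hu => Or.inl hu) (Ne.symm hpx') hpx.symm).symm

theorem PathEnds.reachable_mergeEnds [DecidableEq V] (h : PathEnds G o)
    (hx : (G.neighborSet x).Subsingleton) (hy : (G.neighborSet y).Subsingleton) (hxy : x ≠ y)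
    {p : V} (hp : (G.neighborSet p).Subsingleton) :
    (G ⊔ edge x y).Reachable p (mergeEnds o x y p) := by
  have hle : G ≤ G ⊔ edge x y := le_sup_left
  have hedge : (G ⊔ edge x y).Adj x y := Or.inr ((edge_adj _ _ _ _).2 ⟨Or.inl ⟨rfl, rfl⟩, hxy⟩)
  have hends : (G ⊔ edge x y).Reachable (o x) (o y) :=
    ((h.reachable x hx).symm.mono hle).trans
      (hedge.reachable.trans ((h.reachable y hy).mono hle))
  rw [mergeEnds]
  rcases eq_or_ne p (o y) with rfl | hpy
  · rw [Function.update_self]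
    exact hends.symm
  rw [Function.update_of_ne hpy]
  rcases eq_or_ne p (o x) with rfl | hpx
  · rw [Function.update_self]
    exact hends
  · rw [Function.update_of_ne hpx]
    exact (h.reachable p hp).mono hle

theorem PathEnds.sup_edge [DecidableEq V] (h : PathEnds G o)
    (hx : (G.neighborSet x).Subsingleton) (hy : (G.neighborSet y).Subsingleton) (hxy : x ≠ y)
    (ho : o y ≠ x) : PathEnds (G ⊔ edge x y) (mergeEnds o x y) := by
  have hn := h.not_reachable hx hy hxy ho
  have anti : ∀ {p}, ((G ⊔ edge x y).neighborSet p).Subsingleton →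
      (G.neighborSet p).Subsingleton := fun hp => hp.anti fun _ hu => Or.inl hu
  have eq_ox : ∀ {p}, ((G ⊔ edge x y).neighborSet p).Subsingleton → G.Reachable p x → p = o x :=
    h.eq_of_subsingleton_sup_edge hx hn
  have eq_oy : ∀ {p}, ((G ⊔ edge x y).neighborSet p).Subsingleton → G.Reachable p y → p = o y :=
    fun hp => h.eq_of_subsingleton_sup_edge hy (fun hr => hn hr.symm) (edge_comm x y ▸ hp)
  have hne : o x ≠ o y := fun heq =>
    hn ((h.reachable x hx).trans (heq ▸ (h.reachable y hy).symm))
  refine ⟨h.acyclic.sup_edge_of_not_reachable hn,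
    fun p hp => h.reachable_mergeEnds hx hy hxy (anti hp), fun p q hp hq hpq hr => ?_⟩
  rw [mergeEnds]
  rcases reachable_or_of_reachable_sup_edge hr with hr | ⟨hpx, hyq⟩ | ⟨hpy, hxq⟩
  · have hpx : p ≠ o x := by
      rintro rfl
      exact hpq (eq_ox hq (hr.symm.trans (h.reachable x hx).symm)).symm
    have hpy : p ≠ o y := by
      rintro rfl
      exact hpq (eq_oy hq (hr.symm.trans (h.reachable y hy).symm)).symm
    rw [Function.update_of_ne hpy, Function.update_of_ne hpx]
    exact h.eq_of_reachable p q (anti hp) (anti hq) hpq hr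
  · rw [eq_ox hp hpx, eq_oy hq hyq.symm, Function.update_of_ne hne, Function.update_self]
  · rw [eq_oy hp hpy, eq_ox hq hxq.symm, Function.update_self]

end Merge

end PathEnds

/-! ### Edge lists and the cycles of their parts -/

namespace EdgeList

variable {n m k : ℕ} (L : EdgeList n m k)

/-- The two ends of a listed edge. -/
def ends (e : Fin m) : Sym2 (Fin n) := s(L.src e, L.dst e)

/-- The list has neither loops nor repeated edges. -/
structure IsSimple : Prop where
  inj : Function.Injective L.ends
  ne : ∀ e, L.src e ≠ L.dst e

/-- The graph formed by the listed edges with index in `S`. -/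
def graph (S : Set (Fin m)) : SimpleGraph (Fin n) := fromEdgeSet (L.ends '' S)

/-- The vertices covered by the edges in `S`. -/
def cover (S : Set (Fin m)) : Set (Fin n) := {v | ∃ e ∈ S, v ∈ L.ends e}

/-- The edges of one part. -/
def partEdges (c : Fin k) : Set (Fin m) := {e | L.part e = c}

/-- Two edges of `core` in the same part with a common vertex. -/
def Touch (core : Set (Fin m)) (e f : Fin m) : Prop :=
  e ∈ core ∧ f ∈ core ∧ L.part e = L.part f ∧ ∃ v ∈ L.ends e, v ∈ L.ends f

/-- `e` and `f` are connected by a sequence of touching edges. When `core` consists of the cycles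
of the parts, this says that `e` and `f` lie on the same cycle. -/
def SameCycle (core : Set (Fin m)) : Fin m → Fin m → Prop := Relation.ReflTransGen (L.Touch core)

variable {L}

theorem mem_ends {e : Fin m} {v : Fin n} : v ∈ L.ends e ↔ v = L.src e ∨ v = L.dst e := Sym2.mem_iff

theorem src_mem_ends (e : Fin m) : L.src e ∈ L.ends e := Sym2.mem_mk_left _ _

theorem cover_mono {S T : Set (Fin m)} (h : S ⊆ T) : L.cover S ⊆ L.cover T :=
  fun _ ⟨e, he, hv⟩ => ⟨e, h he, hv⟩

theorem mem_cover {S : Set (Fin m)} {e : Fin m} (he : e ∈ S) {v : Fin n} (hv : v ∈ L.ends e) :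
    v ∈ L.cover S := ⟨e, he, hv⟩

theorem cover_insert (S : Set (Fin m)) (e : Fin m) :
    L.cover (insert e S) = {v | v ∈ L.ends e} ∪ L.cover S := by
  ext v
  simp only [cover, Set.exists_mem_insert, Set.mem_union, Set.mem_ofPred_eq]

theorem graph_mono {S T : Set (Fin m)} (h : S ⊆ T) : L.graph S ≤ L.graph T :=
  fromEdgeSet_mono (Set.image_mono h)

theorem graph_empty : L.graph ∅ = ⊥ := by rw [graph, Set.image_empty, fromEdgeSet_empty]

theorem graph_union (S T : Set (Fin m)) : L.graph (S ∪ T) = L.graph S ⊔ L.graph T := by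
  rw [graph, Set.image_union, fromEdgeSet_union]; rfl

theorem graph_insert {S : Set (Fin m)} {e : Fin m} {x y : Fin n} (he : L.ends e = s(x, y)) :
    L.graph (insert e S) = L.graph S ⊔ edge x y := by
  rw [graph, Set.image_insert_eq, Set.insert_eq, fromEdgeSet_union, sup_comm, he]; rfl

theorem support_graph_subset (S : Set (Fin m)) : (L.graph S).support ⊆ L.cover S := by
  rintro u ⟨v, huv⟩
  obtain ⟨⟨e, he, hends⟩, -⟩ := (fromEdgeSet_adj _).1 huv
  exact mem_cover he (hends ▸ Sym2.mem_mk_left u v)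

theorem neighborSet_graph_eq_empty {S : Set (Fin m)} {v : Fin n} (hv : v ∉ L.cover S) :
    (L.graph S).neighborSet v = ∅ :=
  Set.eq_empty_iff_forall_notMem.2 fun u hu => hv (support_graph_subset S ⟨u, hu⟩)

section IsSimple

variable (hL : L.IsSimple)
include hL

theorem mem_edgeSet_graph {S : Set (Fin m)} {x : Sym2 (Fin n)} :
    x ∈ (L.graph S).edgeSet ↔ ∃ e ∈ S, L.ends e = x := by
  rw [graph, edgeSet_fromEdgeSet, Set.mem_sdiff, Set.mem_image, and_iff_left_iff_imp]
  rintro ⟨e, -, rfl⟩ hdiag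
  exact hL.ne e hdiag

theorem graph_adj {S : Set (Fin m)} {u v : Fin n} :
    (L.graph S).Adj u v ↔ ∃ e ∈ S, L.ends e = s(u, v) := by
  rw [← mem_edgeSet, mem_edgeSet_graph hL]

theorem ends_mem_edgeSet_graph {S : Set (Fin m)} {e : Fin m} :
    L.ends e ∈ (L.graph S).edgeSet ↔ e ∈ S := by
  rw [mem_edgeSet_graph hL]
  exact ⟨fun ⟨_, hf, h⟩ => hL.inj h ▸ hf, fun h => ⟨e, h, rfl⟩⟩

theorem graph_adj_src_dst {S : Set (Fin m)} {e : Fin m} :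
    (L.graph S).Adj (L.src e) (L.dst e) ↔ e ∈ S := ends_mem_edgeSet_graph hL

theorem reachable_graph_src {S : Set (Fin m)} {e : Fin m} (he : e ∈ S) {v : Fin n}
    (hv : v ∈ L.ends e) : (L.graph S).Reachable v (L.src e) := by
  rcases mem_ends.1 hv with rfl | rfl
  · exact Reachable.refl _
  · exact ((graph_adj_src_dst hL).2 he).reachable.symm

theorem disjoint_graph {S T : Set (Fin m)} (h : Disjoint S T) :
    Disjoint (L.graph S) (L.graph T) := by
  refine SimpleGraph.disjoint_left.2 fun u v hS hT => ?_
  obtain ⟨e, he, hends⟩ := (graph_adj hL).1 hS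
  exact Set.disjoint_left.1 h he
    ((ends_mem_edgeSet_graph hL).1 (hends ▸ (mem_edgeSet _).2 hT))

theorem subsingleton_neighborSet_graph {S : Set (Fin m)} {v : Fin n}
    (h : ∀ e ∈ S, ∀ f ∈ S, v ∈ L.ends e → v ∈ L.ends f → e = f) :
    ((L.graph S).neighborSet v).Subsingleton := by
  intro u hu w hw
  obtain ⟨e, he, heu⟩ := (graph_adj hL).1 hu
  obtain ⟨f, hf, hfw⟩ := (graph_adj hL).1 hw
  have hef := h e he f hf (heu ▸ Sym2.mem_mk_left v u) (hfw ▸ Sym2.mem_mk_left v w)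
  exact Sym2.congr_right.1 (heu.symm.trans (hef ▸ hfw))

end IsSimple

namespace SameCycle

variable {core : Set (Fin m)} {e f g : Fin m}

theorem refl (e : Fin m) : L.SameCycle core e e := Relation.ReflTransGen.refl

theorem symm (h : L.SameCycle core e f) : L.SameCycle core f e := by
  have : Std.Symm (L.Touch core) :=
    ⟨fun _ _ ⟨he, hf, hp, v, hve, hvf⟩ => ⟨hf, he, hp.symm, v, hvf, hve⟩⟩
  exact Relation.ReflTransGen.stdSymm.symm _ _ h

theorem trans (h : L.SameCycle core e f) (h' : L.SameCycle core f g) : L.SameCycle core e g :=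
  Relation.ReflTransGen.trans h h'

theorem part_eq (h : L.SameCycle core e f) : L.part f = L.part e := by
  induction h with
  | refl => rfl
  | tail _ h ih => rw [← ih, h.2.2.1]

theorem mem (h : L.SameCycle core e f) (he : e ∈ core) : f ∈ core := by
  cases h with
  | refl => exact he
  | tail _ h => exact h.2.1

end SameCycle

/-- `core` consists of the edges of the cycles of the parts. This is what remains of the parts when
leaves are removed as long as there are any: `core` contains the edges of all cycles, and every
vertex is on no or on two core edges of each part. -/
structure IsCore (L : EdgeList n m k) (core : Set (Fin m)) : Prop where
  simple : L.IsSimple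
  pseudoforest : ∀ c, IsPseudoforest (L.graph (L.partEdges c))
  two : ∀ e ∈ core, ∀ v ∈ L.ends e, ∃ f ∈ core, f ≠ e ∧ L.part f = L.part e ∧ v ∈ L.ends f ∧
    ∀ g ∈ core, L.part g = L.part e → v ∈ L.ends g → g = e ∨ g = f
  cycle : ∀ c u (p : (L.graph (L.partEdges c)).Walk u u), p.IsCycle →
    ∀ e, L.ends e ∈ p.edges → e ∈ core

theorem exists_ne_mem_edges (hL : L.IsSimple) {S : Set (Fin m)} {u : Fin n}
    {p : (L.graph S).Walk u u} (hp : p.IsCycle) {e : Fin m} (he : L.ends e ∈ p.edges)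
    {v : Fin n} (hv : v ∈ L.ends e) : ∃ f, f ≠ e ∧ L.ends f ∈ p.edges ∧ v ∈ L.ends f := by
  obtain ⟨w, hw⟩ := Sym2.mem_iff_exists.1 hv
  have htwo := hp.ncard_neighborSet_toSubgraph_eq_two (p.fst_mem_support_of_mem_edges (hw ▸ he))
  obtain ⟨w', hw', hne⟩ := Set.exists_ne_of_one_lt_ncard
    (by omega : 1 < (p.toSubgraph.neighborSet v).ncard) w
  rw [Subgraph.mem_neighborSet, ← Subgraph.mem_edgeSet, Walk.mem_edges_toSubgraph] at hw'
  obtain ⟨f, -, hf⟩ := (mem_edgeSet_graph hL).1 (p.edges_subset_edgeSet hw')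
  refine ⟨f, ?_, hf ▸ hw', hf ▸ Sym2.mem_mk_left v w'⟩
  rintro rfl
  exact hne (Sym2.congr_right.1 (hf.symm.trans hw))

theorem exists_ends_mem_edges (hL : L.IsSimple) {S : Set (Fin m)} {u : Fin n}
    {p : (L.graph S).Walk u u} (hp : p.IsCycle) : ∃ e ∈ S, L.ends e ∈ p.edges := by
  have hsnd := p.mk_start_snd_mem_edges hp.not_nil
  obtain ⟨e, he, hends⟩ := (mem_edgeSet_graph hL).1 (p.edges_subset_edgeSet hsnd)
  exact ⟨e, he, hends ▸ hsnd⟩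

namespace IsCore

variable {core : Set (Fin m)} (h : IsCore L core)
include h

theorem touch_mem_edges {c : Fin k} {u : Fin n} {p : (L.graph (L.partEdges c)).Walk u u}
    (hp : p.IsCycle) {e f : Fin m} (he : L.ends e ∈ p.edges) (hef : L.Touch core e f) :
    L.ends f ∈ p.edges := by
  have part_eq : ∀ {g}, L.ends g ∈ p.edges → L.part g = c := fun hg =>
    (ends_mem_edgeSet_graph h.simple).1 (p.edges_subset_edgeSet hg)
  obtain ⟨hec, hfc, hpart, v, hve, hvf⟩ := hef
  obtain ⟨g, hge, hgp, hvg⟩ := exists_ne_mem_edges h.simple hp he hve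
  obtain ⟨k, -, -, -, -, huniq⟩ := h.two e hec v hve
  have hgk : g = k := (huniq g (h.cycle c u p hp g hgp)
    ((part_eq hgp).trans (part_eq he).symm) hvg).resolve_left hge
  rcases huniq f hfc hpart.symm hvf with hfe | hfk
  · exact hfe ▸ he
  · exact (hfk.trans hgk.symm) ▸ hgp

theorem sameCycle_mem_edges {c : Fin k} {u : Fin n} {p : (L.graph (L.partEdges c)).Walk u u}
    (hp : p.IsCycle) {e f : Fin m} (he : L.ends e ∈ p.edges) (hef : L.SameCycle core e f) :
    L.ends f ∈ p.edges := by
  induction hef with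
  | refl => exact he
  | tail _ htouch ih => exact h.touch_mem_edges hp ih htouch

theorem exists_isCycle {e : Fin m} (he : e ∈ core) :
    ∃ (u : Fin n) (p : (L.graph (L.partEdges (L.part e))).Walk u u), p.IsCycle ∧
      (∀ f, L.ends f ∈ p.edges → L.SameCycle core e f) ∧
      (L.graph (L.partEdges (L.part e))).Reachable (L.src e) u := by
  set O : Set (Fin m) := {f | L.SameCycle core e f}
  have hle : L.graph O ≤ L.graph (L.partEdges (L.part e)) :=
    graph_mono fun f (hf : L.SameCycle core e f) => hf.part_eq
  have no_leaf : ∀ v, ((L.graph O).neighborSet v).ncard ≠ 1 := by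
    intro v hv
    obtain ⟨w, hw⟩ := Set.ncard_eq_one.1 hv
    obtain ⟨f, hf, hfw⟩ := (graph_adj h.simple).1 (hw.ge rfl : w ∈ (L.graph O).neighborSet v)
    have hvf : v ∈ L.ends f := hfw ▸ Sym2.mem_mk_left v w
    have hfc : f ∈ core := SameCycle.mem hf he
    obtain ⟨g, hgc, hgf, hgp, hvg, -⟩ := h.two f hfc v hvf
    have hg : g ∈ O := Relation.ReflTransGen.tail hf ⟨hfc, hgc, hgp.symm, v, hvf, hvg⟩
    obtain ⟨w', hgw'⟩ := Sym2.mem_iff_exists.1 hvg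
    have hww : w' = w := hw.le ((graph_adj h.simple).2 ⟨g, hg, hgw'⟩)
    exact hgf (h.simple.inj (hgw'.trans (hww ▸ hfw.symm)))
  obtain ⟨u, p, hp, hu⟩ := exists_isCycle_of_forall_ncard_neighborSet_ne_one
    (⟨L.dst e, (graph_adj_src_dst h.simple).2 (SameCycle.refl e)⟩ :
      ((L.graph O).neighborSet (L.src e)).Nonempty)
    fun w _ _ => no_leaf w
  refine ⟨u, p.mapLe hle, hp.mapLe hle, fun f hf => ?_, hu.mono hle⟩
  rw [Walk.edges_mapLe_eq_edges] at hf
  exact (ends_mem_edgeSet_graph h.simple).1 (p.edges_subset_edgeSet hf)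

theorem sameCycle_of_reachable {e f : Fin m} (he : e ∈ core) (hf : f ∈ core)
    (hpart : L.part f = L.part e) {u v : Fin n} (hu : u ∈ L.ends e) (hv : v ∈ L.ends f)
    (hr : (L.graph (L.partEdges (L.part e))).Reachable u v) : L.SameCycle core e f := by
  obtain ⟨a, p, hp, hpe, hea⟩ := h.exists_isCycle he
  have hfcycle := h.exists_isCycle hf
  rw [hpart] at hfcycle
  obtain ⟨b, q, hq, hqf, hfb⟩ := hfcycle
  have heu := reachable_graph_src h.simple (show e ∈ L.partEdges (L.part e) from rfl) hu
  have hfv := reachable_graph_src h.simple (show f ∈ L.partEdges (L.part e) from hpart) hv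
  have hab : (L.graph (L.partEdges (L.part e))).Reachable a b :=
    hea.symm.trans (heu.symm.trans (hr.trans (hfv.trans hfb)))
  obtain ⟨g, -, hg⟩ := exists_ends_mem_edges h.simple hp
  exact (hpe g hg).trans (hqf g ((h.pseudoforest _ p q hp hq hab _).1 hg)).symm

theorem isAcyclic_graph_sdiff {c : Fin k} {M : Set (Fin m)}
    (hM : ∀ e ∈ core, L.part e = c → ∃ f ∈ M, L.SameCycle core e f) :
    (L.graph (L.partEdges c \ M)).IsAcyclic := by
  intro u p hp
  have hle : L.graph (L.partEdges c \ M) ≤ L.graph (L.partEdges c) := graph_mono Set.sdiff_subset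
  obtain ⟨e, he, hep⟩ := exists_ends_mem_edges h.simple hp
  have hep' : L.ends e ∈ (p.mapLe hle).edges := by rwa [Walk.edges_mapLe_eq_edges]
  obtain ⟨f, hf, hef⟩ := hM e (h.cycle c u _ (hp.mapLe hle) e hep') he.1
  have hfp := h.sameCycle_mem_edges (hp.mapLe hle) hep' hef
  rw [Walk.edges_mapLe_eq_edges] at hfp
  exact ((ends_mem_edgeSet_graph h.simple).1 (p.edges_subset_edgeSet hfp)).2 hf

end IsCore

end EdgeList

/-! ### Choosing one edge of each cycle -/

namespace EdgeList

variable {n m k : ℕ} {L : EdgeList n m k}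

/-- `M` contains exactly one edge of each cycle in `done`, a union of cycles. -/
structure IsTransversal (L : EdgeList n m k) (core done M : Set (Fin m)) : Prop where
  done_subset : done ⊆ core
  closed : ∀ e ∈ done, ∀ f, L.Touch core e f → f ∈ done
  subset_done : M ⊆ done
  exists_sameCycle : ∀ e ∈ done, ∃ f ∈ M, L.SameCycle core e f
  eq_of_sameCycle : ∀ f ∈ M, ∀ g ∈ M, L.SameCycle core f g → f = g

namespace IsTransversal

variable {core done M : Set (Fin m)}

theorem empty (L : EdgeList n m k) (core : Set (Fin m)) : IsTransversal L core ∅ ∅ where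
  done_subset := Set.empty_subset _
  closed _ he := he.elim
  subset_done := subset_rfl
  exists_sameCycle _ he := he.elim
  eq_of_sameCycle _ hf := hf.elim

variable (h : IsTransversal L core done M)
include h

theorem mem_done_of_sameCycle {e f : Fin m} (he : e ∈ done) (hef : L.SameCycle core e f) :
    f ∈ done := by
  induction hef with
  | refl => exact he
  | tail _ htouch ih => exact h.closed _ ih _ htouch

theorem not_sameCycle {e f g : Fin m} (hed : e ∉ done) (hef : L.SameCycle core e f)
    (hg : g ∈ M) : ¬ L.SameCycle core f g :=
  fun hfg => hed (h.mem_done_of_sameCycle (h.subset_done hg) (hef.trans hfg).symm)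

theorem notMem {e f : Fin m} (hed : e ∉ done) (hef : L.SameCycle core e f) : f ∉ M :=
  fun hf => h.not_sameCycle hed hef hf (SameCycle.refl f)

theorem insert {e f : Fin m} (he : e ∈ core) (hed : e ∉ done) (hef : L.SameCycle core e f) :
    IsTransversal L core (done ∪ {g | L.SameCycle core e g}) (insert f M) where
  done_subset := Set.union_subset h.done_subset fun _ hg => SameCycle.mem hg he
  closed := by
    rintro g (hg | hg) k hk
    · exact Or.inl (h.closed g hg k hk)
    · exact Or.inr (Relation.ReflTransGen.tail hg hk)
  subset_done := by
    rintro g (rfl | hg)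
    · exact Or.inr hef
    · exact Or.inl (h.subset_done hg)
  exists_sameCycle := by
    rintro g (hg | hg)
    · obtain ⟨k, hk, hgk⟩ := h.exists_sameCycle g hg
      exact ⟨k, Set.mem_insert_of_mem _ hk, hgk⟩
    · exact ⟨f, Set.mem_insert _ _, (SameCycle.symm hg).trans hef⟩
  eq_of_sameCycle := by
    rintro g (rfl | hg) k (rfl | hk) hgk
    · rfl
    · exact absurd hgk (h.not_sameCycle hed hef hk)
    · exact absurd hgk.symm (h.not_sameCycle hed hef hg)
    · exact h.eq_of_sameCycle g hg k hk hgk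

theorem notMem_cover {e f : Fin m} (he : e ∈ core) (hed : e ∉ done)
    (hef : L.SameCycle core e f) {v : Fin n} (hv : v ∈ L.ends f) :
    v ∉ L.cover (M ∩ L.partEdges (L.part e)) := by
  rintro ⟨g, ⟨hgM, hgp⟩, hvg⟩
  exact h.not_sameCycle hed hef hgM (Relation.ReflTransGen.single
    ⟨hef.mem he, h.done_subset (h.subset_done hgM), hef.part_eq.trans hgp.symm, v, hv, hvg⟩)

theorem eq_of_mem_ends {c : Fin k} {f g : Fin m} (hf : f ∈ M ∩ L.partEdges c)
    (hg : g ∈ M ∩ L.partEdges c) {v : Fin n} (hvf : v ∈ L.ends f) (hvg : v ∈ L.ends g) :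
    f = g :=
  h.eq_of_sameCycle f hf.1 g hg.1 (Relation.ReflTransGen.single
    ⟨h.done_subset (h.subset_done hf.1), h.done_subset (h.subset_done hg.1),
      hf.2.trans hg.2.symm, v, hvf, hvg⟩)

theorem eq_of_reachable (hcore : IsCore L core) {c : Fin k} {f g : Fin m}
    (hf : f ∈ M ∩ L.partEdges c) (hg : g ∈ M ∩ L.partEdges c) {u v : Fin n} (hu : u ∈ L.ends f)
    (hv : v ∈ L.ends g) (hr : (L.graph (L.partEdges c)).Reachable u v) : f = g := by
  obtain ⟨hfM, rfl⟩ := hf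
  exact h.eq_of_sameCycle f hfM g hg.1 (hcore.sameCycle_of_reachable
    (h.done_subset (h.subset_done hfM)) (h.done_subset (h.subset_done hg.1)) hg.2 hu hv hr)

/-- Inside a part, only the ends of the same chosen edge are reachable from each other. So the rest
of the part connects the vertices covered by chosen edges no more than these edges do. -/
theorem isAcyclic_graph_union (hcore : IsCore L core) {c : Fin k}
    (hM : ∀ e ∈ core, L.part e = c → e ∈ done) {X : Set (Fin m)}
    (hX : Disjoint (M ∩ L.partEdges c) X) (hcover : L.cover X ⊆ L.cover (M ∩ L.partEdges c))
    (hacyclic : (L.graph (M ∩ L.partEdges c ∪ X)).IsAcyclic) :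
    (L.graph (L.partEdges c \ M ∪ X)).IsAcyclic := by
  have hR : (L.graph (L.partEdges c \ M)).IsAcyclic :=
    hcore.isAcyclic_graph_sdiff fun e he hec => h.exists_sameCycle e (hM e he hec)
  rw [graph_union] at hacyclic ⊢
  refine isAcyclic_sup_of_forall_mem_reachable hR hacyclic (disjoint_graph hcore.simple hX) ?_
    ((support_graph_subset X).trans hcover)
  rintro u ⟨f, hf, hu⟩ v ⟨g, hg, hv⟩ hr
  obtain rfl := h.eq_of_reachable hcore hf hg hu hv (hr.mono (graph_mono Set.sdiff_subset))
  exact (reachable_graph_src hcore.simple hf hu).trans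
    (reachable_graph_src hcore.simple hf hv).symm

end IsTransversal

theorem IsSimple.ne_of_ends_eq (hL : L.IsSimple) {f : Fin m} {x y : Fin n}
    (hf : L.ends f = s(x, y)) : x ≠ y := by
  rintro rfl
  rcases Sym2.eq_iff.1 hf with ⟨hs, hd⟩ | ⟨hs, hd⟩ <;> exact hL.ne f (hs.trans hd.symm)

theorem IsSimple.pathEnds_insert (hL : L.IsSimple) {S : Set (Fin m)} {o : Fin n → Fin n}
    (h : PathEnds (L.graph S) o) {f : Fin m} {x y : Fin n} (hf : L.ends f = s(x, y))
    (hx : ((L.graph S).neighborSet x).Subsingleton)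
    (hy : ((L.graph S).neighborSet y).Subsingleton) (ho : o y ≠ x) :
    PathEnds (L.graph (insert f S)) (mergeEnds o x y) := by
  rw [graph_insert hf]
  exact h.sup_edge hx hy (hL.ne_of_ends_eq hf) ho

theorem IsSimple.isAcyclic_graph_of_pendant (hL : L.IsSimple) {S T : Set (Fin m)}
    (hS : (L.graph S).IsAcyclic)
    (hT : ∀ f ∈ T, f ∈ S ∨ ∃ v ∈ L.ends f, ∀ g ∈ T, v ∈ L.ends g → g = f) :
    (L.graph T).IsAcyclic := by
  refine isAcyclic_of_forall_adj_or_subsingleton_neighborSet hS fun u v huv => ?_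
  obtain ⟨f, hf, hends⟩ := (graph_adj hL).1 huv
  rcases hT f hf with hfS | ⟨w, hw, hpendant⟩
  · exact Or.inl ((graph_adj hL).2 ⟨f, hfS, hends⟩)
  · have hsub : ((L.graph T).neighborSet w).Subsingleton :=
      subsingleton_neighborSet_graph hL fun g hg g' hg' hwg hwg' =>
        (hpendant g hg hwg).trans (hpendant g' hg' hwg').symm
    rw [hends] at hw
    rcases Sym2.mem_iff.1 hw with rfl | rfl
    · exact Or.inr (Or.inl hsub)
    · exact Or.inr (Or.inr hsub)

theorem IsSimple.isAcyclic_graph_insert (hL : L.IsSimple) {S : Set (Fin m)}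
    (hS : (L.graph S).IsAcyclic) {f : Fin m} {x : Fin n} (hx : x ∈ L.ends f)
    (hxS : x ∉ L.cover S) : (L.graph (insert f S)).IsAcyclic := by
  refine hL.isAcyclic_graph_of_pendant hS ?_
  rintro g (rfl | hg)
  · refine Or.inr ⟨x, hx, ?_⟩
    rintro g' (rfl | hg') hxg
    exacts [rfl, absurd (mem_cover hg' hxg) hxS]
  · exact Or.inl hg

/-- Without `e` the edge `f` is pendant at `y`, and then `e` is pendant at `x`. -/
theorem IsSimple.isAcyclic_graph_insert_of_isolated (hL : L.IsSimple) {S : Set (Fin m)}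
    (hS : (L.graph S).IsAcyclic) {e f : Fin m} (he : e ∈ S) (hef : e ≠ f)
    (hisolated : ∀ v ∈ L.ends e, v ∉ L.cover (S \ {e})) {x y z : Fin n}
    (hends : L.ends e = s(x, y)) (hfends : L.ends f = s(z, y)) :
    (L.graph (insert f S)).IsAcyclic := by
  have hx : x ∈ L.ends e := hends ▸ Sym2.mem_mk_left x y
  have hxf : x ∉ L.ends f := by
    rw [hfends, Sym2.mem_iff]
    rintro (rfl | rfl)
    exacts [hef (hL.inj (hends.trans hfends.symm)), hL.ne_of_ends_eq hends rfl]
  have hacyclic : (L.graph (insert f (S \ {e}))).IsAcyclic :=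
    hL.isAcyclic_graph_insert (hS.anti (graph_mono Set.sdiff_subset))
      (hfends ▸ Sym2.mem_mk_right z y) (hisolated y (hends ▸ Sym2.mem_mk_right x y))
  have hxcover : x ∉ L.cover (insert f (S \ {e})) := by
    rintro ⟨g, rfl | hg, hv⟩
    exacts [hxf hv, hisolated x hx ⟨g, hg, hv⟩]
  have hinsert := hL.isAcyclic_graph_insert hacyclic hx hxcover
  rwa [Set.insert_comm, Set.insert_sdiff_singleton, Set.insert_eq_of_mem he] at hinsert

end EdgeList

/-! ### Distributing the chosen edges -/

/-- A distribution of the chosen edges of the parts `A = 0`, `B = 1`, `C = 2`. The edges that are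
not chosen stay in their part, the edges in `toA` and `toB` (from `C`) and `swapped` (from `B`) move
to the forests `A`, `B` and `C`, and the other chosen edges form the fourth forest. The path ends
`otherFour` belong to the chosen edges of `A` and `B` and the `recorded` edges of `C`, and `otherA`
to the chosen edges of `A` and the edges in `toA`. -/
structure EdgeDistribution (n m : ℕ) where
  chosen : Set (Fin m)
  toA : Set (Fin m)
  toB : Set (Fin m)
  swapped : Set (Fin m)
  recorded : Set (Fin m)
  otherA : Fin n → Fin n
  otherFour : Fin n → Fin n

namespace EdgeList

section Matching

variable {n m k : ℕ} {L : EdgeList n m k} {core done M : Set (Fin m)}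

theorem notMem_cover_union {S T : Set (Fin m)} {v : Fin n} (hS : v ∉ L.cover S)
    (hT : v ∉ L.cover T) : v ∉ L.cover (S ∪ T) := by
  rintro ⟨e, he | he, hv⟩
  exacts [hS ⟨e, he, hv⟩, hT ⟨e, he, hv⟩]

theorem IsSimple.pathEnds_insert_of_notMem_cover (hL : L.IsSimple) {S : Set (Fin m)}
    {o : Fin n → Fin n} (h : PathEnds (L.graph S) o) {f : Fin m} {x y : Fin n}
    (hf : L.ends f = s(x, y)) (hx : x ∉ L.cover S) (hy : y ∉ L.cover S) :
    PathEnds (L.graph (insert f S)) (mergeEnds o x y) := by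
  have hx' : (L.graph S).neighborSet x = ∅ := neighborSet_graph_eq_empty hx
  have hy' : (L.graph S).neighborSet y = ∅ := neighborSet_graph_eq_empty hy
  refine hL.pathEnds_insert h hf (hx' ▸ Set.subsingleton_empty) (hy' ▸ Set.subsingleton_empty) ?_
  intro hyx
  have hreach := h.reachable y (hy' ▸ Set.subsingleton_empty)
  rw [hyx] at hreach
  exact not_reachable_of_neighborSet_left_eq_empty (hL.ne_of_ends_eq hf).symm hy' hreach

theorem IsTransversal.subsingleton_neighborSet_graph_union (h : IsTransversal L core done M)
    (hL : L.IsSimple) {c : Fin k} {T : Set (Fin m)} {v : Fin n} (hv : v ∉ L.cover T) :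
    ((L.graph (M ∩ L.partEdges c ∪ T)).neighborSet v).Subsingleton := by
  refine subsingleton_neighborSet_graph hL ?_
  rintro f (hf | hf) g (hg | hg) hvf hvg
  exacts [h.eq_of_mem_ends hf hg hvf hvg, absurd (mem_cover hg hvg) hv,
    absurd (mem_cover hf hvf) hv, absurd (mem_cover hf hvf) hv]

theorem IsTransversal.notMem_cover_of_subset (h : IsTransversal L core done M) {c : Fin k}
    {S : Set (Fin m)} (hS : S ⊆ M ∩ L.partEdges c) {f : Fin m} (hf : f ∈ M ∩ L.partEdges c)
    (hfS : f ∉ S) {v : Fin n} (hv : v ∈ L.ends f) : v ∉ L.cover S := by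
  rintro ⟨g, hg, hvg⟩
  exact hfS (h.eq_of_mem_ends hf (hS hg) hv hvg ▸ hg)

theorem IsTransversal.notMem_cover_union_sdiff (h : IsTransversal L core done M) {c : Fin k}
    {X : Set (Fin m)} {f : Fin m} (hf : f ∈ M ∩ L.partEdges c) {v : Fin n} (hv : v ∈ L.ends f)
    (hvX : v ∉ L.cover X) : v ∉ L.cover ((M ∩ L.partEdges c ∪ X) \ {f}) := by
  rintro ⟨g, ⟨hg | hg, hgf⟩, hvg⟩
  exacts [hgf (h.eq_of_mem_ends hg hf hvg hv), hvX ⟨g, hg, hvg⟩]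

end Matching

end EdgeList

namespace EdgeDistribution

variable {n m : ℕ}

/-- The distribution without chosen edges. -/
def empty (n m : ℕ) : EdgeDistribution n m := ⟨∅, ∅, ∅, ∅, ∅, id, id⟩

variable (D : EdgeDistribution n m)

open Classical in
/-- The forest that contains an edge of the list. -/
noncomputable def forest (L : EdgeList n m 3) (e : Fin m) : Fin 4 :=
  if e ∈ D.chosen then
    if e ∈ D.toA then 0 else if e ∈ D.toB then 1 else if e ∈ D.swapped then 2 else 3
  else (L.part e).castSucc

/-- The chosen edges of `C` in the fourth forest that are not recorded in its path ends. -/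
def unplaced (L : EdgeList n m 3) : Set (Fin m) :=
  (D.chosen ∩ L.partEdges 2) \ (D.toA ∪ D.toB ∪ D.recorded)

/-- `v` is on no edges of `A` or `B` in the fourth forest. -/
structure IsFree (L : EdgeList n m 3) (v : Fin n) : Prop where
  notMem_cover_zero : v ∉ L.cover (D.chosen ∩ L.partEdges 0)
  notMem_cover_one : v ∉ L.cover ((D.chosen ∩ L.partEdges 1) \ D.swapped)

/-- One edge of each cycle in `done` is chosen, and all forests remain forests, except that the
unplaced edges are not taken into account. -/
structure IsSound (L : EdgeList n m 3) (core done : Set (Fin m)) : Prop where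
  isTransversal : L.IsTransversal core done D.chosen
  toA_subset : D.toA ⊆ D.chosen ∩ L.partEdges 2
  toB_subset : D.toB ⊆ D.chosen ∩ L.partEdges 2
  recorded_subset : D.recorded ⊆ D.chosen ∩ L.partEdges 2
  swapped_subset : D.swapped ⊆ D.chosen ∩ L.partEdges 1
  pathEndsA : PathEnds (L.graph (D.chosen ∩ L.partEdges 0 ∪ D.toA)) D.otherA
  cover_toA : L.cover D.toA ⊆ L.cover (D.chosen ∩ L.partEdges 0)
  acyclicB : (L.graph (D.chosen ∩ L.partEdges 1 ∪ D.toB)).IsAcyclic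
  cover_toB : L.cover D.toB ⊆ L.cover (D.chosen ∩ L.partEdges 1)
  acyclicC : (L.graph (D.chosen ∩ L.partEdges 2 ∪ D.swapped)).IsAcyclic
  cover_swapped : L.cover D.swapped ⊆ L.cover (D.chosen ∩ L.partEdges 2)
  pathEndsFour : PathEnds (L.graph (D.chosen ∩ L.partEdges 0 ∪
    (D.chosen ∩ L.partEdges 1 ∪ D.recorded))) D.otherFour

/-- A sound distribution in which every unplaced edge has a free end, so that it is a pendant edge
of the fourth forest. -/
structure IsValid (L : EdgeList n m 3) (core done : Set (Fin m)) : Prop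
    extends D.IsSound L core done where
  exists_isFree : ∀ f ∈ D.unplaced L, ∃ v ∈ L.ends f, D.IsFree L v

/-- Choose `f`. -/
def choose (f : Fin m) : EdgeDistribution n m := { D with chosen := insert f D.chosen }

/-- Join the paths of the forest `A` that end in `x` and `y`. -/
def joinA (x y : Fin n) : EdgeDistribution n m := { D with otherA := mergeEnds D.otherA x y }

/-- Join the paths of the fourth forest that end in `x` and `y`. -/
def joinFour (x y : Fin n) : EdgeDistribution n m :=
  { D with otherFour := mergeEnds D.otherFour x y }

/-- Move `f` to the forest `A`. -/
def linkA (f : Fin m) : EdgeDistribution n m := { D with toA := insert f D.toA }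

/-- Move `f` to the forest `B`. -/
def linkB (f : Fin m) : EdgeDistribution n m := { D with toB := insert f D.toB }

/-- Move `g` to the forest `C`. -/
def swap (g : Fin m) : EdgeDistribution n m := { D with swapped := insert g D.swapped }

/-- Record `f` in the path ends of the fourth forest. -/
def record (f : Fin m) : EdgeDistribution n m := { D with recorded := insert f D.recorded }

end EdgeDistribution

namespace EdgeDistribution

variable {n m : ℕ} {L : EdgeList n m 3} {core done : Set (Fin m)} {D : EdgeDistribution n m}

namespace IsSound

theorem empty (L : EdgeList n m 3) (core : Set (Fin m)) :
    (EdgeDistribution.empty n m).IsSound L core ∅ where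
  isTransversal := .empty L core
  toA_subset := Set.empty_subset _
  toB_subset := Set.empty_subset _
  recorded_subset := Set.empty_subset _
  swapped_subset := Set.empty_subset _
  pathEndsA := by
    simpa only [EdgeDistribution.empty, Set.empty_inter, Set.empty_union, EdgeList.graph_empty]
      using PathEnds.bot
  cover_toA := EdgeList.cover_mono (Set.empty_subset _)
  acyclicB := by
    simp only [EdgeDistribution.empty, Set.empty_inter, Set.empty_union, EdgeList.graph_empty,
      isAcyclic_bot]
  cover_toB := EdgeList.cover_mono (Set.empty_subset _)
  acyclicC := by
    simp only [EdgeDistribution.empty, Set.empty_inter, Set.empty_union, EdgeList.graph_empty,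
      isAcyclic_bot]
  cover_swapped := EdgeList.cover_mono (Set.empty_subset _)
  pathEndsFour := by
    simpa only [EdgeDistribution.empty, Set.empty_inter, Set.empty_union, EdgeList.graph_empty]
      using PathEnds.bot

section Choose

variable (h : D.IsSound L core done) (hL : L.IsSimple) {e f : Fin m} (he : e ∈ core)
  (hed : e ∉ done) (hef : L.SameCycle core e f)
include h he hed hef

theorem notMem_cover_union {c : Fin 3} (hf : L.part f = c) {X : Set (Fin m)}
    (hX : L.cover X ⊆ L.cover (D.chosen ∩ L.partEdges c)) {v : Fin n} (hv : v ∈ L.ends f) :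
    v ∉ L.cover (D.chosen ∩ L.partEdges c ∪ X) := by
  have hnot := h.isTransversal.notMem_cover he hed hef hv
  rw [← hef.part_eq, hf] at hnot
  exact EdgeList.notMem_cover_union hnot fun hvX => hnot (hX hvX)

include hL

theorem choose_zero (hf : L.part f = 0) (h1 : D.chosen ∩ L.partEdges 1 = ∅)
    (h2 : D.chosen ∩ L.partEdges 2 = ∅) {x y : Fin n} (hends : L.ends f = s(x, y)) :
    (((D.choose f).joinFour x y).joinA x y).IsSound L core
      (done ∪ {g | L.SameCycle core e g}) := by
  have hf0 : f ∈ L.partEdges 0 := hf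
  have hf1 : f ∉ L.partEdges 1 := by simp [EdgeList.partEdges, hf]
  have hf2 : f ∉ L.partEdges 2 := by simp [EdgeList.partEdges, hf]
  have hrec : D.recorded = ∅ := Set.subset_empty_iff.1 (h2 ▸ h.recorded_subset)
  have notMem {X : Set (Fin m)} (hX : L.cover X ⊆ L.cover (D.chosen ∩ L.partEdges 0)) {v : Fin n}
      (hv : v ∈ L.ends f) :
      v ∉ L.cover (D.chosen ∩ L.partEdges 0 ∪ X) := h.notMem_cover_union he hed hef hf hX hv
  have hx : x ∈ L.ends f := hends ▸ Sym2.mem_mk_left x y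
  have hy : y ∈ L.ends f := hends ▸ Sym2.mem_mk_right x y
  constructor
  case isTransversal => exact h.isTransversal.insert he hed hef
  all_goals
    simp only [choose, joinFour, joinA, Set.insert_inter_of_mem hf0, Set.insert_inter_of_notMem hf1,
      Set.insert_inter_of_notMem hf2, Set.insert_union]
  case pathEndsA =>
    exact hL.pathEnds_insert_of_notMem_cover h.pathEndsA hends (notMem h.cover_toA hx)
      (notMem h.cover_toA hy)
  case pathEndsFour =>
    have hcover : L.cover (D.chosen ∩ L.partEdges 1 ∪ D.recorded) ⊆
        L.cover (D.chosen ∩ L.partEdges 0) := by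
      rw [h1, hrec, Set.union_empty]
      exact EdgeList.cover_mono (Set.empty_subset _)
    exact hL.pathEnds_insert_of_notMem_cover h.pathEndsFour hends (notMem hcover hx)
      (notMem hcover hy)
  case cover_toA => exact h.cover_toA.trans (EdgeList.cover_mono (Set.subset_insert _ _))
  all_goals first
    | exact h.toA_subset | exact h.toB_subset | exact h.recorded_subset | exact h.swapped_subset
    | exact h.acyclicB | exact h.cover_toB | exact h.acyclicC | exact h.cover_swapped

theorem choose_one (hf : L.part f = 1) (h2 : D.chosen ∩ L.partEdges 2 = ∅) {x y : Fin n}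
    (hends : L.ends f = s(x, y)) (ho : D.otherFour y ≠ x) :
    ((D.choose f).joinFour x y).IsSound L core (done ∪ {g | L.SameCycle core e g}) := by
  have hf0 : f ∉ L.partEdges 0 := by simp [EdgeList.partEdges, hf]
  have hf1 : f ∈ L.partEdges 1 := hf
  have hf2 : f ∉ L.partEdges 2 := by simp [EdgeList.partEdges, hf]
  have hrec : D.recorded = ∅ := Set.subset_empty_iff.1 (h2 ▸ h.recorded_subset)
  have hsub {v : Fin n} (hv : v ∈ L.ends f) :
      ((L.graph (D.chosen ∩ L.partEdges 0 ∪
        (D.chosen ∩ L.partEdges 1 ∪ D.recorded))).neighborSet v).Subsingleton := by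
    refine h.isTransversal.subsingleton_neighborSet_graph_union hL
      (h.notMem_cover_union he hed hef hf ?_ hv)
    rw [hrec]
    exact EdgeList.cover_mono (Set.empty_subset _)
  constructor
  case isTransversal => exact h.isTransversal.insert he hed hef
  all_goals
    simp only [choose, joinFour, Set.insert_inter_of_mem hf1, Set.insert_inter_of_notMem hf0,
      Set.insert_inter_of_notMem hf2, Set.insert_union, Set.union_insert]
  case pathEndsFour =>
    exact hL.pathEnds_insert h.pathEndsFour hends (hsub (hends ▸ Sym2.mem_mk_left x y))
      (hsub (hends ▸ Sym2.mem_mk_right x y)) ho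
  case acyclicB =>
    exact hL.isAcyclic_graph_insert h.acyclicB (EdgeList.src_mem_ends f)
      (h.notMem_cover_union he hed hef hf h.cover_toB (EdgeList.src_mem_ends f))
  case cover_toB => exact h.cover_toB.trans (EdgeList.cover_mono (Set.subset_insert _ _))
  case swapped_subset => exact h.swapped_subset.trans (Set.subset_insert _ _)
  all_goals first
    | exact h.toA_subset | exact h.toB_subset | exact h.recorded_subset | exact h.pathEndsA
    | exact h.cover_toA | exact h.acyclicC | exact h.cover_swapped

theorem choose_two (hf : L.part f = 2) :
    (D.choose f).IsSound L core (done ∪ {g | L.SameCycle core e g}) := by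
  have hf0 : f ∉ L.partEdges 0 := by simp [EdgeList.partEdges, hf]
  have hf1 : f ∉ L.partEdges 1 := by simp [EdgeList.partEdges, hf]
  have hf2 : f ∈ L.partEdges 2 := hf
  constructor
  case isTransversal => exact h.isTransversal.insert he hed hef
  all_goals
    simp only [choose, Set.insert_inter_of_mem hf2, Set.insert_inter_of_notMem hf0,
      Set.insert_inter_of_notMem hf1, Set.insert_union]
  case toA_subset => exact h.toA_subset.trans (Set.subset_insert _ _)
  case toB_subset => exact h.toB_subset.trans (Set.subset_insert _ _)
  case recorded_subset => exact h.recorded_subset.trans (Set.subset_insert _ _)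
  case acyclicC =>
    exact hL.isAcyclic_graph_insert h.acyclicC (EdgeList.src_mem_ends f)
      (h.notMem_cover_union he hed hef hf h.cover_swapped (EdgeList.src_mem_ends f))
  case cover_swapped => exact h.cover_swapped.trans (EdgeList.cover_mono (Set.subset_insert _ _))
  all_goals first
    | exact h.swapped_subset | exact h.pathEndsA | exact h.cover_toA | exact h.acyclicB
    | exact h.cover_toB | exact h.pathEndsFour

end Choose

section Place

variable (h : D.IsSound L core done) (hL : L.IsSimple) {f : Fin m}
  (hf : f ∈ D.chosen ∩ L.partEdges 2)
include h hL hf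

theorem linkA (hfA : f ∉ D.toA) {x y : Fin n} (hends : L.ends f = s(x, y))
    (hx : x ∈ L.cover (D.chosen ∩ L.partEdges 0)) (hy : y ∈ L.cover (D.chosen ∩ L.partEdges 0))
    (ho : D.otherA y ≠ x) : ((D.linkA f).joinA x y).IsSound L core done where
  __ := h
  toA_subset := Set.insert_subset hf h.toA_subset
  cover_toA := by
    rintro v ⟨g, rfl | hg, hv⟩
    · rw [hends] at hv
      rcases Sym2.mem_iff.1 hv with rfl | rfl
      exacts [hx, hy]
    · exact h.cover_toA ⟨g, hg, hv⟩
  pathEndsA := by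
    have hsub {v : Fin n} (hv : v ∈ L.ends f) :
        ((L.graph (D.chosen ∩ L.partEdges 0 ∪ D.toA)).neighborSet v).Subsingleton :=
      h.isTransversal.subsingleton_neighborSet_graph_union hL
        (h.isTransversal.notMem_cover_of_subset h.toA_subset hf hfA hv)
    simp only [EdgeDistribution.linkA, joinA, Set.union_insert]
    exact hL.pathEnds_insert h.pathEndsA hends (hsub (hends ▸ Sym2.mem_mk_left x y))
      (hsub (hends ▸ Sym2.mem_mk_right x y)) ho

theorem record (hfr : f ∉ D.recorded) {x y : Fin n} (hends : L.ends f = s(x, y))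
    (hx : x ∉ L.cover (D.chosen ∩ L.partEdges 1)) (hy : y ∉ L.cover (D.chosen ∩ L.partEdges 0))
    (ho : D.otherFour y ≠ x) : ((D.record f).joinFour x y).IsSound L core done where
  __ := h
  recorded_subset := Set.insert_subset hf h.recorded_subset
  pathEndsFour := by
    have hxf : x ∈ L.ends f := hends ▸ Sym2.mem_mk_left x y
    have hyf : y ∈ L.ends f := hends ▸ Sym2.mem_mk_right x y
    have hrec {v : Fin n} (hv : v ∈ L.ends f) : v ∉ L.cover D.recorded :=
      h.isTransversal.notMem_cover_of_subset h.recorded_subset hf hfr hv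
    simp only [EdgeDistribution.record, joinFour, Set.union_insert]
    refine hL.pathEnds_insert h.pathEndsFour hends
      (h.isTransversal.subsingleton_neighborSet_graph_union hL
        (EdgeList.notMem_cover_union hx (hrec hxf))) ?_ ho
    rw [Set.union_left_comm]
    exact h.isTransversal.subsingleton_neighborSet_graph_union hL
      (EdgeList.notMem_cover_union hy (hrec hyf))

theorem linkB (hfB : f ∉ D.toB) {g : Fin m} (hg : g ∈ D.chosen ∩ L.partEdges 1) {w y y' : Fin n}
    (hends : L.ends f = s(w, y)) (hgends : L.ends g = s(y', y)) (hy' : y' ∉ L.cover D.toB)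
    (hw : w ∈ L.cover (D.chosen ∩ L.partEdges 1)) : (D.linkB f).IsSound L core done where
  __ := h
  toB_subset := Set.insert_subset hf h.toB_subset
  cover_toB := by
    rintro v ⟨k, rfl | hk, hv⟩
    · rw [hends] at hv
      rcases Sym2.mem_iff.1 hv with rfl | rfl
      exacts [hw, ⟨g, hg, hgends ▸ Sym2.mem_mk_right _ _⟩]
    · exact h.cover_toB ⟨k, hk, hv⟩
  acyclicB := by
    have hgf : g ≠ f := by
      rintro rfl
      exact absurd (hg.2.symm.trans hf.2) (by decide)
    have hyf : y ∈ L.ends f := hends ▸ Sym2.mem_mk_right w y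
    simp only [EdgeDistribution.linkB, Set.union_insert]
    refine hL.isAcyclic_graph_insert_of_isolated h.acyclicB (Or.inl hg) hgf
      (fun v hv => h.isTransversal.notMem_cover_union_sdiff hg hv ?_) hgends hends
    rw [hgends] at hv
    rcases Sym2.mem_iff.1 hv with rfl | rfl
    exacts [hy', h.isTransversal.notMem_cover_of_subset h.toB_subset hf hfB hyf]

theorem swap (hfs : ∀ v ∈ L.ends f, v ∉ L.cover D.swapped) {g k : Fin m}
    (hg : g ∈ D.chosen ∩ L.partEdges 1) {w y y' : Fin n} (hends : L.ends f = s(w, y))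
    (hgends : L.ends g = s(y', y)) (hk : k ∈ D.chosen ∩ L.partEdges 2) (hy' : y' ∈ L.ends k) :
    (D.swap g).IsSound L core done where
  __ := h
  swapped_subset := Set.insert_subset hg h.swapped_subset
  cover_swapped := by
    rintro v ⟨l, rfl | hl, hv⟩
    · rw [hgends] at hv
      rcases Sym2.mem_iff.1 hv with rfl | rfl
      exacts [⟨k, hk, hy'⟩, ⟨f, hf, hends ▸ Sym2.mem_mk_right _ _⟩]
    · exact h.cover_swapped ⟨l, hl, hv⟩
  acyclicC := by
    have hfg : f ≠ g := by
      rintro rfl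
      exact absurd (hg.2.symm.trans hf.2) (by decide)
    simp only [EdgeDistribution.swap, Set.union_insert]
    exact hL.isAcyclic_graph_insert_of_isolated h.acyclicC (Or.inl hf) hfg
      (fun v hv => h.isTransversal.notMem_cover_union_sdiff hf hv (hfs v hv)) hends hgends

end Place

end IsSound

end EdgeDistribution

namespace EdgeDistribution

variable {n m : ℕ} {L : EdgeList n m 3} {core done : Set (Fin m)} {D : EdgeDistribution n m}

theorem choose_chosen_inter {f : Fin m} (hf : L.part f = 2) {c : Fin 3} (hc : c ≠ 2) :
    (D.choose f).chosen ∩ L.partEdges c = D.chosen ∩ L.partEdges c :=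
  Set.insert_inter_of_notMem fun hfc => hc (hfc.symm.trans hf)

namespace IsValid

theorem empty (L : EdgeList n m 3) (core : Set (Fin m)) :
    (EdgeDistribution.empty n m).IsValid L core ∅ where
  toIsSound := .empty L core
  exists_isFree _ hf := hf.1.1.elim

variable (h : D.IsValid L core done) (hL : L.IsSimple) {e f : Fin m} (he : e ∈ core)
  (hed : e ∉ done) (hef : L.SameCycle core e f)
include h

theorem of_isSound {done' : Set (Fin m)} {D' : EdgeDistribution n m}
    (h' : D'.IsSound L core done')
    (hzero : D'.chosen ∩ L.partEdges 0 = D.chosen ∩ L.partEdges 0)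
    (hone : D'.chosen ∩ L.partEdges 1 = D.chosen ∩ L.partEdges 1)
    (hswapped : D.swapped ⊆ D'.swapped)
    (hunplaced : ∀ g ∈ D'.unplaced L, g ∈ D.unplaced L ∨ ∃ v ∈ L.ends g, D'.IsFree L v) :
    D'.IsValid L core done' where
  __ := h'
  exists_isFree g hg := by
    rcases hunplaced g hg with hg | hg
    · obtain ⟨v, hv, hfree⟩ := h.exists_isFree g hg
      refine ⟨v, hv, hzero ▸ hfree.notMem_cover_zero, fun hv' => hfree.notMem_cover_one ?_⟩
      rw [hone] at hv'
      exact EdgeList.cover_mono (Set.sdiff_subset_sdiff_right hswapped) hv'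
    · exact hg

omit h in
theorem of_chosen_inter_eq_empty {done' : Set (Fin m)} (h : D.IsSound L core done')
    (h2 : D.chosen ∩ L.partEdges 2 = ∅) : D.IsValid L core done' where
  __ := h
  exists_isFree f hf := (h2 ▸ hf.1 : f ∈ (∅ : Set (Fin m))).elim

theorem of_isSound_choose (hf : L.part f = 2) {D' : EdgeDistribution n m} {done' : Set (Fin m)}
    (h' : D'.IsSound L core done') (hchosen : D'.chosen = (D.choose f).chosen)
    (hA : D.toA ⊆ D'.toA) (hB : D.toB ⊆ D'.toB) (hrec : D.recorded ⊆ D'.recorded)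
    (hswapped : D.swapped ⊆ D'.swapped)
    (hf' : f ∈ D'.unplaced L → ∃ v ∈ L.ends f, D'.IsFree L v) :
    D'.IsValid L core done' := by
  refine h.of_isSound h' ?_ ?_ hswapped ?_
  · rw [hchosen]
    exact Set.insert_inter_of_notMem (by simp [EdgeList.partEdges, hf])
  · rw [hchosen]
    exact Set.insert_inter_of_notMem (by simp [EdgeList.partEdges, hf])
  · rintro g ⟨⟨hg, hg2⟩, hplaced⟩
    rcases hchosen ▸ hg with rfl | hgD
    · exact Or.inr (hf' ⟨⟨hg, hg2⟩, hplaced⟩)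
    · exact Or.inl ⟨⟨hgD, hg2⟩, fun hg' => hplaced
        (Set.union_subset_union (Set.union_subset_union hA hB) hrec hg')⟩

include hL he hed hef

theorem choose_zero (hf : L.part f = 0) (h1 : D.chosen ∩ L.partEdges 1 = ∅)
    (h2 : D.chosen ∩ L.partEdges 2 = ∅) {x y : Fin n} (hends : L.ends f = s(x, y)) :
    (((D.choose f).joinFour x y).joinA x y).IsValid L core
      (done ∪ {g | L.SameCycle core e g}) := by
  refine of_chosen_inter_eq_empty
    (h.toIsSound.choose_zero hL he hed hef hf h1 h2 hends) ?_
  exact (Set.insert_inter_of_notMem (by simp [EdgeList.partEdges, hf])).trans h2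

theorem choose_one (hf : L.part f = 1) (h2 : D.chosen ∩ L.partEdges 2 = ∅) {x y : Fin n}
    (hends : L.ends f = s(x, y)) (ho : D.otherFour y ≠ x) :
    ((D.choose f).joinFour x y).IsValid L core (done ∪ {g | L.SameCycle core e g}) := by
  refine of_chosen_inter_eq_empty (h.toIsSound.choose_one hL he hed hef hf h2 hends ho) ?_
  exact (Set.insert_inter_of_notMem (by simp [EdgeList.partEdges, hf])).trans h2

section PartTwo

variable (hf : L.part f = 2)
include hf

theorem choose_two {v : Fin n} (hv : v ∈ L.ends f) (h0 : v ∉ L.cover (D.chosen ∩ L.partEdges 0))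
    (h1 : v ∉ L.cover (D.chosen ∩ L.partEdges 1)) :
    (D.choose f).IsValid L core (done ∪ {g | L.SameCycle core e g}) := by
  refine h.of_isSound_choose hf (h.toIsSound.choose_two hL he hed hef hf) rfl subset_rfl subset_rfl
    subset_rfl subset_rfl fun _ => ⟨v, hv, ?_, fun hv1 => h1 ?_⟩
  · rwa [choose_chosen_inter hf (by decide)]
  · rw [choose_chosen_inter hf (by decide)] at hv1
    exact EdgeList.cover_mono Set.sdiff_subset hv1

theorem linkA {x y : Fin n} (hends : L.ends f = s(x, y))
    (hx : x ∈ L.cover (D.chosen ∩ L.partEdges 0)) (hy : y ∈ L.cover (D.chosen ∩ L.partEdges 0))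
    (ho : D.otherA y ≠ x) :
    (((D.choose f).linkA f).joinA x y).IsValid L core (done ∪ {g | L.SameCycle core e g}) := by
  have hfA : f ∉ D.toA := fun hfA => h.isTransversal.notMem hed hef (h.toA_subset hfA).1
  refine h.of_isSound_choose hf ((h.toIsSound.choose_two hL he hed hef hf).linkA hL
    ⟨Set.mem_insert _ _, hf⟩ hfA hends ?_ ?_ ho) rfl (Set.subset_insert _ _) subset_rfl subset_rfl
    subset_rfl fun hfu => (hfu.2 (Or.inl (Or.inl (Set.mem_insert _ _)))).elim
  all_goals rwa [choose_chosen_inter hf (by decide)]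

theorem record {x y : Fin n} (hends : L.ends f = s(x, y))
    (hx : x ∉ L.cover (D.chosen ∩ L.partEdges 1)) (hy : y ∉ L.cover (D.chosen ∩ L.partEdges 0))
    (ho : D.otherFour y ≠ x) :
    (((D.choose f).record f).joinFour x y).IsValid L core
      (done ∪ {g | L.SameCycle core e g}) := by
  have hfr : f ∉ D.recorded := fun hfr => h.isTransversal.notMem hed hef (h.recorded_subset hfr).1
  refine h.of_isSound_choose hf ((h.toIsSound.choose_two hL he hed hef hf).record hL
    ⟨Set.mem_insert _ _, hf⟩ hfr hends ?_ ?_ ho) rfl subset_rfl subset_rfl (Set.subset_insert _ _)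
    subset_rfl fun hfu => (hfu.2 (Or.inr (Set.mem_insert _ _))).elim
  all_goals rwa [choose_chosen_inter hf (by decide)]

variable {g : Fin m} (hg : g ∈ D.chosen ∩ L.partEdges 1) {w y y' : Fin n}
  (hends : L.ends f = s(w, y)) (hgends : L.ends g = s(y', y))
include hg hends hgends

theorem linkB (hy' : y' ∉ L.cover D.toB) (hw : w ∈ L.cover (D.chosen ∩ L.partEdges 1)) :
    ((D.choose f).linkB f).IsValid L core (done ∪ {g | L.SameCycle core e g}) := by
  have hfB : f ∉ D.toB := fun hfB => h.isTransversal.notMem hed hef (h.toB_subset hfB).1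
  refine h.of_isSound_choose hf ((h.toIsSound.choose_two hL he hed hef hf).linkB hL
    ⟨Set.mem_insert _ _, hf⟩ hfB ⟨Or.inr hg.1, hg.2⟩ hends hgends hy' ?_) rfl subset_rfl
    (Set.subset_insert _ _) subset_rfl subset_rfl
    fun hfu => (hfu.2 (Or.inl (Or.inr (Set.mem_insert _ _)))).elim
  rwa [choose_chosen_inter hf (by decide)]

theorem swap (hy : y ∉ L.cover (D.chosen ∩ L.partEdges 0)) {k : Fin m}
    (hk : k ∈ D.chosen ∩ L.partEdges 2) (hy' : y' ∈ L.ends k) :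
    ((D.choose f).swap g).IsValid L core (done ∪ {g | L.SameCycle core e g}) := by
  have hinter {c : Fin 3} (hc : c ≠ 2) : ((D.choose f).swap g).chosen ∩ L.partEdges c =
      D.chosen ∩ L.partEdges c := choose_chosen_inter hf hc
  refine h.of_isSound_choose hf ((h.toIsSound.choose_two hL he hed hef hf).swap hL
    ⟨Set.mem_insert _ _, hf⟩ ?_ ⟨Or.inr hg.1, hg.2⟩ hends hgends ⟨Or.inr hk.1, hk.2⟩ hy') rfl
    subset_rfl subset_rfl subset_rfl (Set.subset_insert _ _) fun _ => ⟨y, ?_, ?_, ?_⟩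
  · intro v hv hvs
    exact h.toIsSound.notMem_cover_union he hed hef hf h.cover_swapped hv
      (EdgeList.cover_mono Set.subset_union_right hvs)
  · exact hends ▸ Sym2.mem_mk_right w y
  · rwa [hinter (by decide)]
  · rw [hinter (by decide)]
    rintro ⟨l, ⟨hl, hls⟩, hyl⟩
    exact hls (Or.inl (h.isTransversal.eq_of_mem_ends hl hg hyl
      (hgends ▸ Sym2.mem_mk_right y' y)))

end PartTwo

end IsValid

end EdgeDistribution

/-! ### The four forests -/

namespace EdgeList

variable {n m k : ℕ} {L : EdgeList n m k}

theorem IsSimple.represents (hL : L.IsSimple) : L.Represents fun c => L.graph (L.partEdges c) where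
  nodup := hL.inj
  edges _ := Set.ext fun _ => (mem_edgeSet_graph hL).trans
    (exists_congr fun _ => and_congr Iff.rfl eq_comm)

namespace Represents

variable {H : Fin k → SimpleGraph (Fin n)}

theorem isSimple (h : L.Represents H) : L.IsSimple where
  inj := h.nodup
  ne e he := by
    have hmem : s(L.src e, L.dst e) ∈ (H (L.part e)).edgeSet := by
      rw [h.edges]
      exact ⟨e, rfl, rfl⟩
    exact (H (L.part e)).ne_of_adj hmem he

theorem graph_partEdges (h : L.Represents H) (c : Fin k) : L.graph (L.partEdges c) = H c :=
  edgeSet_injective ((h.isSimple.represents.edges c).trans (h.edges c).symm)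

theorem iUnion_edgeSet (h : L.Represents H) : ⋃ c, (H c).edgeSet = Set.range L.ends := by
  ext x
  simp only [h.edges, Set.mem_iUnion, Set.mem_range]
  exact ⟨fun ⟨_, e, _, hx⟩ => ⟨e, hx.symm⟩, fun ⟨e, hx⟩ => ⟨L.part e, e, rfl, hx.symm⟩⟩

theorem isEdgePartition (h : L.Represents H) {G : SimpleGraph (Fin n)}
    (hG : Set.range L.ends = G.edgeSet) : IsEdgePartition G H where
  disjoint c d hcd := by
    rw [h.edges, h.edges, Set.disjoint_left]
    rintro _ ⟨e, hec, rfl⟩ ⟨f, hfd, hef⟩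
    exact hcd (hec.symm.trans (h.nodup hef ▸ hfd))
  union := h.iUnion_edgeSet.trans hG

end Represents

end EdgeList

namespace EdgeDistribution

variable {n m : ℕ} {L : EdgeList n m 3} {D : EdgeDistribution n m} {core : Set (Fin m)}

theorem forest_eq_zero_subset :
    {e | D.forest L e = 0} ⊆ (L.partEdges 0 \ D.chosen) ∪ D.toA := by
  intro e he
  rw [Set.mem_ofPred_eq, forest] at he
  split_ifs at he with hchosen
  all_goals first | exact absurd he (by decide) | exact Or.inr ‹_› | skip
  exact Or.inl ⟨Fin.castSucc_injective 3 he, hchosen⟩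

theorem forest_eq_one_subset :
    {e | D.forest L e = 1} ⊆ (L.partEdges 1 \ D.chosen) ∪ D.toB := by
  intro e he
  rw [Set.mem_ofPred_eq, forest] at he
  split_ifs at he with hchosen
  all_goals first | exact absurd he (by decide) | exact Or.inr ‹_› | skip
  exact Or.inl ⟨Fin.castSucc_injective 3 he, hchosen⟩

theorem forest_eq_two_subset :
    {e | D.forest L e = 2} ⊆ (L.partEdges 2 \ D.chosen) ∪ D.swapped := by
  intro e he
  rw [Set.mem_ofPred_eq, forest] at he
  split_ifs at he with hchosen
  all_goals first | exact absurd he (by decide) | exact Or.inr ‹_› | skip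
  exact Or.inl ⟨Fin.castSucc_injective 3 he, hchosen⟩

theorem forest_eq_three_subset :
    {e | D.forest L e = 3} ⊆ D.chosen \ (D.toA ∪ D.toB ∪ D.swapped) := by
  intro e he
  rw [Set.mem_ofPred_eq, forest] at he
  split_ifs at he with hchosen hA hB hswapped
  all_goals first | exact absurd he (by decide) | exact absurd he (Fin.castSucc_ne_last _) | skip
  exact ⟨hchosen, not_or.2 ⟨not_or.2 ⟨hA, hB⟩, hswapped⟩⟩

theorem disjoint_chosen_inter_partEdges {c d : Fin 3} {X : Set (Fin m)} (hcd : c ≠ d)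
    (hX : X ⊆ D.chosen ∩ L.partEdges d) : Disjoint (D.chosen ∩ L.partEdges c) X :=
  Set.disjoint_left.2 fun _ hc hd => hcd (hc.2.symm.trans (hX hd).2)

theorem IsSound.degree_graph_forest_three_le (h : D.IsSound L core core) (hL : L.IsSimple)
    [DecidableRel (L.graph {e | D.forest L e = 3}).Adj] (v : Fin n) :
    (L.graph {e | D.forest L e = 3}).degree v ≤ 3 := by
  have hexists (u) (hu : u ∈ (L.graph {e | D.forest L e = 3}).neighborFinset v) :
      ∃ c, ∃ e ∈ D.chosen ∩ L.partEdges c, L.ends e = s(v, u) := by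
    obtain ⟨e, he, hends⟩ := (EdgeList.graph_adj hL).1 ((mem_neighborFinset _ _ _).1 hu)
    exact ⟨L.part e, e, ⟨(forest_eq_three_subset he).1, rfl⟩, hends⟩
  choose! c hc using hexists
  rw [← card_neighborFinset_eq_degree]
  refine (Finset.card_le_card_of_injOn c (fun _ _ => Finset.mem_univ _) ?_).trans
    (Finset.card_fin 3).le
  intro u hu w hw hcc
  obtain ⟨e, he, heu⟩ := hc u hu
  obtain ⟨f, hf, hfw⟩ := hc w hw
  have hef : e = f := h.isTransversal.eq_of_mem_ends (hcc ▸ he) hf (heu ▸ Sym2.mem_mk_left v u)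
    (hfw ▸ Sym2.mem_mk_left v w)
  exact Sym2.congr_right.1 (heu.symm.trans (hef ▸ hfw))

namespace IsValid

variable (h : D.IsValid L core core)
include h

theorem isAcyclic_graph_forest_three (hL : L.IsSimple) :
    (L.graph {e | D.forest L e = 3}).IsAcyclic := by
  refine (hL.isAcyclic_graph_of_pendant h.pathEndsFour.acyclic (T := D.chosen \
    (D.toA ∪ D.toB ∪ D.swapped)) ?_).anti (EdgeList.graph_mono forest_eq_three_subset)
  rintro f ⟨hf, hf'⟩
  simp only [Set.mem_union, not_or] at hf'
  by_cases hfu : f ∈ D.unplaced L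
  · obtain ⟨v, hv, hfree⟩ := h.exists_isFree f hfu
    refine Or.inr ⟨v, hv, fun g ⟨hg, hg'⟩ hvg => ?_⟩
    match hgp : L.part g with
    | 0 => exact absurd ⟨g, ⟨hg, hgp⟩, hvg⟩ hfree.notMem_cover_zero
    | 1 => exact absurd ⟨g, ⟨⟨hg, hgp⟩, fun hgs => hg' (Or.inr hgs)⟩, hvg⟩ hfree.notMem_cover_one
    | 2 => exact h.isTransversal.eq_of_mem_ends ⟨hg, hgp⟩ hfu.1 hvg hv
  · left
    match hfp : L.part f with
    | 0 => exact Or.inl ⟨hf, hfp⟩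
    | 1 => exact Or.inr (Or.inl ⟨hf, hfp⟩)
    | 2 =>
      refine Or.inr (Or.inr (not_not.1 fun hrec => hfu ⟨⟨hf, hfp⟩, ?_⟩))
      simp only [Set.mem_union, not_or]
      exact ⟨hf'.1, hrec⟩

theorem isAcyclic_graph_forest (hcore : EdgeList.IsCore L core) (i : Fin 4) :
    (L.graph {e | D.forest L e = i}).IsAcyclic := by
  have acyclic {c : Fin 3} {X : Set (Fin m)} :=
    h.isTransversal.isAcyclic_graph_union hcore (fun e he (_ : L.part e = c) => he) (X := X)
  match i with
  | 0 => exact (acyclic (disjoint_chosen_inter_partEdges (by decide) h.toA_subset) h.cover_toA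
      h.pathEndsA.acyclic).anti (EdgeList.graph_mono forest_eq_zero_subset)
  | 1 => exact (acyclic (disjoint_chosen_inter_partEdges (by decide) h.toB_subset) h.cover_toB
      h.acyclicB).anti (EdgeList.graph_mono forest_eq_one_subset)
  | 2 => exact (acyclic (disjoint_chosen_inter_partEdges (by decide) h.swapped_subset)
      h.cover_swapped h.acyclicC).anti (EdgeList.graph_mono forest_eq_two_subset)
  | 3 => exact h.isAcyclic_graph_forest_three hcore.simple

end IsValid

section Update

variable {f g : Fin m}

theorem forest_choose (hA : f ∉ D.toA) (hB : f ∉ D.toB) (hswapped : f ∉ D.swapped) :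
    (D.choose f).forest L = Function.update (D.forest L) f 3 := by
  classical
  ext1 e
  rcases eq_or_ne e f with rfl | hef
  · simp [forest, choose, hA, hB, hswapped]
  · rw [Function.update_of_ne hef]
    exact if_congr (or_iff_right hef) rfl rfl

theorem forest_linkA (hf : f ∈ D.chosen) :
    (D.linkA f).forest L = Function.update (D.forest L) f 0 := by
  classical
  ext1 e
  rcases eq_or_ne e f with rfl | hef
  · simp [forest, linkA, hf]
  · rw [Function.update_of_ne hef]
    exact if_congr Iff.rfl (if_congr (or_iff_right hef) rfl rfl) rfl

theorem forest_linkB (hf : f ∈ D.chosen) (hA : f ∉ D.toA) :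
    (D.linkB f).forest L = Function.update (D.forest L) f 1 := by
  classical
  ext1 e
  rcases eq_or_ne e f with rfl | hef
  · simp [forest, linkB, hf, hA]
  · rw [Function.update_of_ne hef]
    exact if_congr Iff.rfl (if_congr Iff.rfl rfl (if_congr (or_iff_right hef) rfl rfl)) rfl

theorem forest_swap (hg : g ∈ D.chosen) (hA : g ∉ D.toA) (hB : g ∉ D.toB) :
    (D.swap g).forest L = Function.update (D.forest L) g 2 := by
  classical
  ext1 e
  rcases eq_or_ne e g with rfl | heg
  · simp [forest, swap, hg, hA, hB]
  · rw [Function.update_of_ne heg]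
    exact if_congr Iff.rfl (if_congr Iff.rfl rfl (if_congr Iff.rfl rfl
      (if_congr (or_iff_right heg) rfl rfl))) rfl

end Update

end EdgeDistribution

/-! ### Running times of programs -/

namespace RAM

namespace State

variable (s : State)

@[simp] theorem reg_setReg (x v y : ℕ) :
    (s.setReg x v).reg y = if y = x then v else s.reg y := by
  simp only [setReg, Function.update_apply]

@[simp] theorem arr_setReg (x v : ℕ) : (s.setReg x v).arr = s.arr := rfl

@[simp] theorem reg_setArr (a i v : ℕ) : (s.setArr a i v).reg = s.reg := rfl

@[simp] theorem arr_setArr (a i v b : ℕ) :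
    (s.setArr a i v).arr b = if b = a then Function.update (s.arr a) i v else s.arr b := by
  simp only [setArr, Function.update_apply]

theorem setReg_setReg (x v w : ℕ) : (s.setReg x v).setReg x w = s.setReg x w := by
  simp only [setReg, Function.update_idem]

theorem setArr_setArr (a i v w : ℕ) : (s.setArr a i v).setArr a i w = s.setArr a i w := by
  simp only [setArr, Function.update_self, Function.update_idem]

end State

/-- The states differ only in the registers of `R` and the arrays of `A`. -/
structure AgreeOff (R A : List ℕ) (s s' : State) : Prop where
  reg : ∀ x, x ∉ R → s'.reg x = s.reg x
  arr : ∀ a, a ∉ A → s'.arr a = s.arr a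

namespace AgreeOff

variable {R A : List ℕ} {s s' s'' : State}

theorem refl (s : State) : AgreeOff R A s s := ⟨fun _ _ => rfl, fun _ _ => rfl⟩

theorem trans (h : AgreeOff R A s s') (h' : AgreeOff R A s' s'') : AgreeOff R A s s'' :=
  ⟨fun x hx => (h'.reg x hx).trans (h.reg x hx), fun a ha => (h'.arr a ha).trans (h.arr a ha)⟩

theorem setReg (h : AgreeOff R A s s') {x : ℕ} (hx : x ∈ R) (v : ℕ) :
    AgreeOff R A s (s'.setReg x v) := by
  refine ⟨fun y hy => ?_, h.arr⟩
  rw [State.reg_setReg, if_neg (by rintro rfl; exact hy hx), h.reg y hy]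

theorem setArr (h : AgreeOff R A s s') {a : ℕ} (ha : a ∈ A) (i v : ℕ) :
    AgreeOff R A s (s'.setArr a i v) := by
  refine ⟨h.reg, fun b hb => ?_⟩
  rw [State.arr_setArr, if_neg (by rintro rfl; exact hb ha), h.arr b hb]

theorem mono (h : AgreeOff R A s s') {R' A' : List ℕ} (hR : R ⊆ R') (hA : A ⊆ A') :
    AgreeOff R' A' s s' :=
  ⟨fun x hx => h.reg x fun h => hx (hR h), fun a ha => h.arr a fun h => ha (hA h)⟩

end AgreeOff

namespace Program

/-- The weakest precondition of a program without loops. -/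
def pre (W : ℕ) : Program → (State → Prop) → State → Prop
  | skip, Q, s => Q s
  | set x e, Q, s => e.eval s ≤ W ∧ Q (s.setReg x (e.eval s))
  | put a i e, Q, s => i.eval s ≤ W ∧ e.eval s ≤ W ∧ Q (s.setArr a (i.eval s) (e.eval s))
  | seq p q, Q, s => p.pre W (q.pre W Q) s
  | ite b p q, Q, s => (b.eval s → p.pre W Q s) ∧ (¬ b.eval s → q.pre W Q s)
  | .while _ _, _, _ => False

/-- A bound on the running time of a program without loops. -/
def bound : Program → ℕ
  | skip => 1
  | set _ e => e.cost + 1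
  | put _ i e => i.cost + e.cost + 1
  | seq p q => p.bound + q.bound
  | ite b p q => b.cost + 1 + (p.bound + q.bound)
  | .while _ _ => 0

/-- The registers a program may change. -/
def regs : Program → List ℕ
  | skip | put _ _ _ => []
  | set x _ => [x]
  | seq p q | ite _ p q => p.regs ++ q.regs
  | .while _ p => p.regs

/-- The arrays a program may change. -/
def arrs : Program → List ℕ
  | skip | set _ _ => []
  | put a _ _ => [a]
  | seq p q | ite _ p q => p.arrs ++ q.arrs
  | .while _ p => p.arrs

/-- The programs of a list, one after the other. -/
def block : List Program → Program
  | [] => skip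
  | p :: ps => seq p (block ps)

/-- Runs `body` for the values `0, …, e - 1` of register `2`. -/
def forLoop (e : Expr) (body : Program) : Program :=
  seq (set 2 (.const 0))
    (.while (.lt (.reg 2) e) (seq body (set 2 (.add (.reg 2) (.const 1)))))

theorem pre.mono {W : ℕ} {p : Program} {s : State} {Q R : State → Prop} (h : p.pre W Q s)
    (hQ : ∀ s, Q s → R s) : p.pre W R s := by
  induction p generalizing s Q R with
  | skip => exact hQ _ h
  | set x e => exact ⟨h.1, hQ _ h.2⟩
  | put a i e => exact ⟨h.1, h.2.1, hQ _ h.2.2⟩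
  | seq p q ihp ihq => exact ihp h fun s hs => ihq hs hQ
  | ite b p q ihp ihq => exact ⟨fun hb => ihp (h.1 hb) hQ, fun hb => ihq (h.2 hb) hQ⟩
  | _ => exact h.elim

theorem pre.exists_exec {W : ℕ} {p : Program} {s : State} {Q : State → Prop} (h : p.pre W Q s) :
    ∃ t s', Exec W p s t s' ∧ t ≤ p.bound ∧ Q s' := by
  induction p generalizing s Q with
  | skip => exact ⟨_, _, .skip s, le_rfl, h⟩
  | set x e => exact ⟨_, _, .set h.1, le_rfl, h.2⟩
  | put a i e => exact ⟨_, _, .put h.1 h.2.1, le_rfl, h.2.2⟩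
  | seq p q ihp ihq =>
    obtain ⟨t, s', hp, ht, hs'⟩ := ihp h
    obtain ⟨t', s'', hq, ht', hs''⟩ := ihq hs'
    exact ⟨_, _, .seq hp hq, Nat.add_le_add ht ht', hs''⟩
  | ite b p q ihp ihq =>
    by_cases hb : b.eval s
    · obtain ⟨t, s', hp, ht, hs'⟩ := ihp (h.1 hb)
      exact ⟨_, _, .ite_true hb hp, by simp only [bound]; omega, hs'⟩
    · obtain ⟨t, s', hq, ht, hs'⟩ := ihq (h.2 hb)
      exact ⟨_, _, .ite_false hb hq, by simp only [bound]; omega, hs'⟩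
  | _ => exact h.elim

theorem pre.of_agreeOff {W : ℕ} {p : Program} {s : State} {Q : State → Prop}
    (h : p.pre W (fun s' => AgreeOff p.regs p.arrs s s' → Q s') s) : p.pre W Q s := by
  induction p generalizing s Q with
  | skip => exact h (.refl s)
  | set x e => exact ⟨h.1, h.2 ((AgreeOff.refl s).setReg (List.mem_singleton_self x) _)⟩
  | put a i e =>
    exact ⟨h.1, h.2.1, h.2.2 ((AgreeOff.refl s).setArr (List.mem_singleton_self a) _ _)⟩
  | seq p q ihp ihq =>
    refine ihp (pre.mono (p := p) h fun s₁ hs₁ hagree =>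
      ihq (hs₁.mono fun s₂ hs₂ hagree' => hs₂ ?_))
    exact (hagree.mono (List.subset_append_left _ _) (List.subset_append_left _ _)).trans
      (hagree'.mono (List.subset_append_right _ _) (List.subset_append_right _ _))
  | ite b p q ihp ihq =>
    refine ⟨fun hb => ihp ((h.1 hb).mono fun _ hs' hagree => hs' ?_),
      fun hb => ihq ((h.2 hb).mono fun _ hs' hagree => hs' ?_)⟩
    · exact hagree.mono (List.subset_append_left _ _) (List.subset_append_left _ _)
    · exact hagree.mono (List.subset_append_right _ _) (List.subset_append_right _ _)
  | _ => exact h.elim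

end Program

theorem Exec.agreeOff {W t : ℕ} {p : Program} {s s' : State} (h : Exec W p s t s') :
    AgreeOff p.regs p.arrs s s' := by
  induction h with
  | skip s => exact .refl s
  | set _ => exact (AgreeOff.refl _).setReg (List.mem_singleton_self _) _
  | put _ _ => exact (AgreeOff.refl _).setArr (List.mem_singleton_self _) _ _
  | seq _ _ ih₁ ih₂ =>
    exact (ih₁.mono (List.subset_append_left _ _) (List.subset_append_left _ _)).trans
      (ih₂.mono (List.subset_append_right _ _) (List.subset_append_right _ _))
  | ite_true _ _ ih => exact ih.mono (List.subset_append_left _ _) (List.subset_append_left _ _)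
  | ite_false _ _ ih => exact ih.mono (List.subset_append_right _ _) (List.subset_append_right _ _)
  | while_false _ => exact .refl _
  | while_true _ _ _ ih₁ ih₂ => exact ih₁.trans ih₂

/-- Started in `s`, the program halts, and it leaves some part `ψ` of `φ` units of time unused such
that `Q ψ s'` holds in the final state `s'`. The unused time can pay for later steps, so that the
running time of nested loops is accounted for by a potential. -/
def Halts (W : ℕ) (p : Program) (s : State) (φ : ℕ) (Q : ℕ → State → Prop) : Prop :=
  ∃ t s' ψ, Exec W p s t s' ∧ t + ψ ≤ φ ∧ Q ψ s'

theorem Program.pre.halts {W : ℕ} {p : Program} {s : State} {Q : State → Prop}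
    (h : p.pre W Q s) (φ : ℕ) : Halts W p s (φ + p.bound) fun ψ s' => ψ = φ ∧ Q s' := by
  obtain ⟨t, s', hexec, ht, hs'⟩ := h.exists_exec
  exact ⟨t, s', φ, hexec, by omega, rfl, hs'⟩

namespace Halts

variable {W φ ψ : ℕ} {p q : Program} {s : State} {Q R : ℕ → State → Prop}

theorem mono (h : Halts W p s φ Q) (hφ : φ ≤ ψ) (hQ : ∀ φ s, Q φ s → R φ s) :
    Halts W p s ψ R := by
  obtain ⟨t, s', φ', hexec, ht, hs'⟩ := h
  exact ⟨t, s', φ', hexec, ht.trans hφ, hQ _ _ hs'⟩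

theorem agreeOff (h : Halts W p s φ Q) :
    Halts W p s φ fun ψ s' => Q ψ s' ∧ AgreeOff p.regs p.arrs s s' := by
  obtain ⟨t, s', φ', hexec, ht, hs'⟩ := h
  exact ⟨t, s', φ', hexec, ht, hs', hexec.agreeOff⟩

theorem relax (h : Halts W p s φ Q) (hQ : ∀ φ s, Q φ s → ∃ ψ ≤ φ, R ψ s) : Halts W p s φ R := by
  obtain ⟨t, s', φ', hexec, ht, hs'⟩ := h
  obtain ⟨ψ, hψ, hR⟩ := hQ _ _ hs'
  exact ⟨t, s', ψ, hexec, by omega, hR⟩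

theorem skip (h : Q φ s) : Halts W .skip s (φ + 1) Q :=
  ⟨1, s, φ, .skip s, (Nat.add_comm 1 φ).le, h⟩

theorem set {x : ℕ} {e : Expr} (he : e.eval s ≤ W) (h : Q φ (s.setReg x (e.eval s))) :
    Halts W (.set x e) s (φ + (e.cost + 1)) Q :=
  ⟨_, _, φ, .set he, (Nat.add_comm _ φ).le, h⟩

theorem seq (h : Halts W p s φ fun ψ s' => Halts W q s' ψ Q) : Halts W (.seq p q) s φ Q := by
  obtain ⟨t, s', φ', hp, ht, t', s'', φ'', hq, ht', hs''⟩ := h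
  exact ⟨t + t', s'', φ'', .seq hp hq, by omega, hs''⟩

theorem ite {b : Test} (hp : b.eval s → Halts W p s φ Q) (hq : ¬ b.eval s → Halts W q s φ Q) :
    Halts W (.ite b p q) s (φ + (b.cost + 1)) Q := by
  by_cases hb : b.eval s
  · obtain ⟨t, s', ψ, hexec, ht, hs'⟩ := hp hb
    exact ⟨_, s', ψ, .ite_true hb hexec, by omega, hs'⟩
  · obtain ⟨t, s', ψ, hexec, ht, hs'⟩ := hq hb
    exact ⟨_, s', ψ, .ite_false hb hexec, by omega, hs'⟩

theorem while_loop {b : Test} (I : ℕ → State → Prop)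
    (hstep : ∀ φ s, I φ s → b.eval s → ∃ ψ, φ = ψ + (b.cost + 1) ∧ Halts W p s ψ I)
    (hend : ∀ φ s, I φ s → ¬ b.eval s → ∃ ψ, φ = ψ + (b.cost + 1) ∧ Q ψ s)
    (h : I φ s) : Halts W (.while b p) s φ Q := by
  induction φ using Nat.strong_induction_on generalizing s with
  | _ φ ih =>
    by_cases hb : b.eval s
    · obtain ⟨ψ, rfl, t, s', φ', hbody, ht, hs'⟩ := hstep φ s h hb
      obtain ⟨t', s'', φ'', hloop, ht', hs''⟩ := ih φ' (by omega) hs'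
      exact ⟨_, s'', φ'', .while_true hb hbody hloop, by omega, hs''⟩
    · obtain ⟨ψ, rfl, hQ⟩ := hend φ s h hb
      exact ⟨_, s, ψ, .while_false hb, (Nat.add_comm _ ψ).le, hQ⟩

theorem forLoop {N c : ℕ} {e : Expr} {body : Program} (I : ℕ → ℕ → State → Prop) (hN : N ≤ W)
    (hreg : 2 ∉ body.regs) (hI : ∀ i φ s, I i φ s → e.eval s = N)
    (hbody : ∀ i φ s, i < N → s.reg 2 = i → I i φ s →
      Halts W body s (φ + c) fun ψ s' => I (i + 1) ψ (s'.setReg 2 (i + 1)))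
    (h : I 0 φ (s.setReg 2 0)) :
    Halts W (.forLoop e body) s (φ + (N + 1) * (c + e.cost + 8)) (I N) := by
  have succ_mul (k : ℕ) : (k + 1) * (c + e.cost + 8) = k * (c + e.cost + 8) + (c + e.cost + 8) :=
    Nat.succ_mul k _
  refine seq ((set (φ := φ + N * (c + e.cost + 8) + (e.cost + 3)) (Nat.zero_le W) ?_).mono
    (by simp only [succ_mul, Expr.cost]; omega) fun _ _ => id)
  refine while_loop (fun ψ s => ∃ i φ, i ≤ N ∧ s.reg 2 = i ∧ I i φ s ∧
    ψ = φ + (N - i) * (c + e.cost + 8) + (e.cost + 3)) ?_ ?_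
    ⟨0, φ, N.zero_le, State.reg_setReg s 2 0 2, h, by rw [Nat.sub_zero]⟩
  · rintro _ s ⟨i, φ, -, hi, hs, rfl⟩ hlt
    simp only [Test.eval, Expr.eval, hi, hI i φ s hs] at hlt
    obtain ⟨k, hk⟩ : ∃ k, N - i = k + 1 := ⟨N - i - 1, by omega⟩
    refine ⟨φ + c + (k * (c + e.cost + 8) + (e.cost + 8)), by
      simp only [hk, succ_mul, Test.cost, Expr.cost]; omega, seq ?_⟩
    obtain ⟨t, s', ψ, hexec, ht, hs'⟩ := hbody i φ s hlt hi hs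
    refine ⟨t, s', ψ + k * (c + e.cost + 8) + (e.cost + 3) + 4, hexec, by omega, ?_⟩
    have heval : (Expr.add (.reg 2) (.const 1)).eval s' = i + 1 := by
      simp only [Expr.eval, hexec.agreeOff.reg 2 hreg, hi]
    refine set (heval ▸ by omega) ⟨i + 1, ψ, hlt, ?_, heval ▸ hs', ?_⟩
    · rw [heval, State.reg_setReg, if_pos rfl]
    · rw [show N - (i + 1) = k by omega]
  · rintro _ s ⟨i, φ, hle, hi, hs, rfl⟩ hlt
    simp only [Test.eval, Expr.eval, hi, hI i φ s hs] at hlt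
    obtain rfl : i = N := by omega
    exact ⟨φ, by simp only [Nat.sub_self, Nat.zero_mul, Test.cost, Expr.cost]; omega, hs⟩

theorem forLoop_of_pre {N : ℕ} {e : Expr} {body : Program} (I : ℕ → State → Prop) (hN : N ≤ W)
    (hreg : 2 ∉ body.regs) (hI : ∀ i s, I i s → e.eval s = N)
    (hbody : ∀ i s, i < N → s.reg 2 = i → I i s →
      body.pre W (fun s' => I (i + 1) (s'.setReg 2 (i + 1))) s)
    (h : I 0 (s.setReg 2 0)) :
    Halts W (.forLoop e body) s (φ + (N + 1) * (body.bound + e.cost + 8)) fun ψ s' =>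
      ψ = φ ∧ I N s' :=
  forLoop (fun i ψ s => ψ = φ ∧ I i s) hN hreg (fun i _ s hs => hI i s hs.2)
    (fun i ψ s hi h2 ⟨hψ, hs⟩ => ((hbody i s hi h2 hs).halts ψ).mono le_rfl
      fun _ _ ⟨hψ', hs'⟩ => ⟨hψ'.trans hψ, hs'⟩) ⟨rfl, h⟩

end Halts

end RAM

/-! ### Stripping leaves and following cycles -/

namespace EdgeList

variable {n m k : ℕ}

/-- The number of the copy of the vertex `v` in part `c`. With one copy of each vertex for each
part, the parts become disjoint and can be processed as a single graph. -/
def node (v : Fin n) (c : Fin k) : ℕ := v + n * c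

theorem node_inj {v w : Fin n} {c d : Fin k} : node v c = node w d ↔ v = w ∧ c = d := by
  refine ⟨fun h => ?_, fun ⟨hv, hc⟩ => hv ▸ hc ▸ rfl⟩
  have hmod := congrArg (· % n) h
  simp only [node, Nat.add_mul_mod_self_left, Nat.mod_eq_of_lt (Fin.isLt _)] at hmod
  obtain rfl := Fin.ext hmod
  exact ⟨rfl, Fin.ext (Nat.eq_of_mul_eq_mul_left v.pos (Nat.add_left_cancel h))⟩

theorem node_lt (v : Fin n) (c : Fin k) : node v c < n * k :=
  calc node v c < n + n * c := Nat.add_lt_add_right v.isLt _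
    _ = n * (c + 1) := by ring
    _ ≤ n * k := Nat.mul_le_mul_left n c.isLt

variable (L : EdgeList n m k)

/-- The copy of the source of an edge in the part of the edge. -/
def nodeSrc (e : Fin m) : ℕ := node (L.src e) (L.part e)

/-- The copy of the target of an edge in the part of the edge. -/
def nodeDst (e : Fin m) : ℕ := node (L.dst e) (L.part e)

/-- The two nodes of an edge. -/
def nodeEnds (e : Fin m) : Sym2 ℕ := s(L.nodeSrc e, L.nodeDst e)

/-- The node of `e` other than its node `j`. -/
def oppositeNode (e : Fin m) (j : ℕ) : ℕ := L.nodeSrc e + L.nodeDst e - j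

/-- The edges of `S` at node `j`. -/
def incident (S : Finset (Fin m)) (j : ℕ) : Finset (Fin m) := {e ∈ S | j ∈ L.nodeEnds e}

variable {L} {S : Finset (Fin m)} {e f : Fin m} {j : ℕ}

theorem mem_nodeEnds : j ∈ L.nodeEnds e ↔ ∃ v ∈ L.ends e, node v (L.part e) = j := by
  simp only [nodeEnds, ends, Sym2.mem_iff, exists_eq_or_imp, exists_eq_left, nodeSrc, nodeDst,
    eq_comm]

theorem node_mem_nodeEnds {v : Fin n} {c : Fin k} :
    node v c ∈ L.nodeEnds e ↔ v ∈ L.ends e ∧ L.part e = c := by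
  rw [mem_nodeEnds]
  constructor
  · rintro ⟨w, hw, h⟩
    exact ⟨(node_inj.1 h).1 ▸ hw, (node_inj.1 h).2⟩
  · rintro ⟨hv, rfl⟩
    exact ⟨v, hv, rfl⟩

theorem lt_of_mem_nodeEnds (h : j ∈ L.nodeEnds e) : j < n * k := by
  obtain ⟨v, -, rfl⟩ := mem_nodeEnds.1 h
  exact node_lt _ _

theorem nodeSrc_ne_nodeDst (hL : L.IsSimple) (e : Fin m) : L.nodeSrc e ≠ L.nodeDst e :=
  fun h => hL.ne e (node_inj.1 h).1

theorem oppositeNode_ne (hL : L.IsSimple) (h : j ∈ L.nodeEnds e) : L.oppositeNode e j ≠ j := by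
  have hne := nodeSrc_ne_nodeDst hL e
  rcases Sym2.mem_iff.1 h with rfl | rfl <;> simp only [oppositeNode] <;> omega

theorem nodeEnds_eq (h : j ∈ L.nodeEnds e) : L.nodeEnds e = s(j, L.oppositeNode e j) := by
  rcases Sym2.mem_iff.1 h with rfl | rfl
  · rw [oppositeNode, Nat.add_sub_cancel_left, nodeEnds]
  · rw [oppositeNode, Nat.add_sub_cancel_right, nodeEnds, Sym2.eq_swap]

theorem mem_incident : e ∈ L.incident S j ↔ e ∈ S ∧ j ∈ L.nodeEnds e := Finset.mem_filter

theorem incident_insert : L.incident (insert e S) j =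
    if j ∈ L.nodeEnds e then insert e (L.incident S j) else L.incident S j :=
  Finset.filter_insert _ _ _

theorem incident_erase : L.incident (S.erase e) j = (L.incident S j).erase e :=
  Finset.filter_erase _ _ _

theorem incident_mono {T : Finset (Fin m)} (h : S ⊆ T) : L.incident S j ⊆ L.incident T j :=
  Finset.filter_subset_filter _ h

theorem card_incident (hL : L.IsSimple) (S : Finset (Fin m)) (v : Fin n) (c : Fin k) :
    (L.incident S (node v c)).card =
      ((L.graph (↑S ∩ L.partEdges c)).neighborSet v).ncard := by
  rw [← Set.ncard_coe_finset, ← Set.ncard_image_of_injective _ hL.inj,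
    ← Set.ncard_image_of_injective (f := fun u => s(v, u)) _ fun _ _ => Sym2.congr_right.1]
  congr 1
  ext x
  simp only [Set.mem_image, Finset.mem_coe, mem_incident, node_mem_nodeEnds, mem_neighborSet,
    graph_adj hL]
  constructor
  · rintro ⟨e, ⟨he, hv, hc⟩, rfl⟩
    obtain ⟨u, hu⟩ := Sym2.mem_iff_exists.1 hv
    exact ⟨u, ⟨e, ⟨he, hc⟩, hu⟩, hu.symm⟩
  · rintro ⟨u, ⟨e, ⟨he, hc⟩, hu⟩, rfl⟩
    exact ⟨e, ⟨he, hu ▸ Sym2.mem_mk_left v u, hc⟩, hu⟩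

/-- Every set of edges without leaves is contained in `S`: this remains true when leaves are
stripped from `S`. -/
def ContainsLeafless (L : EdgeList n m k) (S : Finset (Fin m)) : Prop :=
  ∀ T : Finset (Fin m), (∀ j, (L.incident T j).card ≠ 1) → T ⊆ S

namespace ContainsLeafless

theorem erase (h : L.ContainsLeafless S) (hj : L.incident S j = {e}) :
    L.ContainsLeafless (S.erase e) := by
  intro T hT f hf
  refine Finset.mem_erase.2 ⟨?_, h T hT hf⟩
  rintro rfl
  have hfj : j ∈ L.nodeEnds f :=
    (mem_incident.1 (hj.symm ▸ Finset.mem_singleton_self f : f ∈ L.incident S j)).2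
  refine hT j (Finset.card_eq_one.2 ⟨f, Finset.Subset.antisymm ?_ ?_⟩)
  · exact hj ▸ incident_mono (h T hT)
  · exact Finset.singleton_subset_iff.2 (mem_incident.2 ⟨hf, hfj⟩)

theorem mem_of_mem_edges (h : L.ContainsLeafless S) (hL : L.IsSimple) {c : Fin k} {u : Fin n}
    {p : (L.graph (L.partEdges c)).Walk u u} (hp : p.IsCycle) (he : L.ends e ∈ p.edges) :
    e ∈ S := by
  classical
  have part_eq : ∀ {f}, L.ends f ∈ p.edges → L.part f = c := fun hf =>
    (ends_mem_edgeSet_graph hL).1 (p.edges_subset_edgeSet hf)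
  refine h {f | L.ends f ∈ p.edges} (fun j hj => ?_) (Finset.mem_filter.2 ⟨Finset.mem_univ e, he⟩)
  obtain ⟨f, hf⟩ := Finset.card_eq_one.1 hj
  simp only [Finset.ext_iff, mem_incident, Finset.mem_filter, Finset.mem_univ, true_and,
    Finset.mem_singleton] at hf
  obtain ⟨hfp, hfj⟩ := (hf f).2 rfl
  obtain ⟨v, hv, rfl⟩ := mem_nodeEnds.1 hfj
  obtain ⟨g, hgf, hgp, hvg⟩ := exists_ne_mem_edges hL hp hfp hv
  exact hgf ((hf g).1 ⟨hgp, node_mem_nodeEnds.2 ⟨hvg, (part_eq hgp).trans (part_eq hfp).symm⟩⟩)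

theorem isCore (h : L.ContainsLeafless S) (hL : L.IsSimple)
    (hP : ∀ c, IsPseudoforest (L.graph (L.partEdges c)))
    (hS : ∀ j, (L.incident S j).card ≠ 1) : L.IsCore S where
  simple := hL
  pseudoforest := hP
  two := by
    intro e he v hv
    have hcycles := ((hP (L.part e)).anti
      (graph_mono (Set.inter_subset_right (s := (S : Set (Fin m)))))).isCycles
      fun v => card_incident hL S v _ ▸ hS _
    obtain ⟨w, hw⟩ := Sym2.mem_iff_exists.1 hv
    have hcard := hcycles ⟨w, (graph_adj hL).2 ⟨e, ⟨he, rfl⟩, hw⟩⟩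
    rw [← card_incident hL] at hcard
    have hmem : e ∈ L.incident S (node v (L.part e)) :=
      mem_incident.2 ⟨he, node_mem_nodeEnds.2 ⟨hv, rfl⟩⟩
    obtain ⟨f, hf⟩ := Finset.card_eq_one.1
      ((Finset.card_erase_of_mem hmem).trans (by rw [hcard]))
    simp only [Finset.ext_iff, Finset.mem_erase, mem_incident, node_mem_nodeEnds,
      Finset.mem_singleton] at hf
    obtain ⟨hfe, hfS, hvf, hfp⟩ := (hf f).2 rfl
    exact ⟨f, hfS, hfe, hfp, hvf, fun g hg hgp hvg =>
      or_iff_not_imp_left.2 fun hge => (hf g).1 ⟨hge, hg, hvg, hgp⟩⟩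
  cycle := fun _ _ _ hp _ he => h.mem_of_mem_edges hL hp he

end ContainsLeafless

theorem IsCore.exists_incident_eq_pair (h : L.IsCore S) (he : e ∈ S) (hj : j ∈ L.nodeEnds e) :
    ∃ f, f ≠ e ∧ L.incident S j = {e, f} := by
  obtain ⟨v, hv, rfl⟩ := mem_nodeEnds.1 hj
  obtain ⟨f, hf, hfe, hfp, hvf, huniq⟩ := h.two e he v hv
  refine ⟨f, hfe, ?_⟩
  ext g
  rw [mem_incident, node_mem_nodeEnds, Finset.mem_insert, Finset.mem_singleton]
  constructor
  · exact fun ⟨hg, hvg, hgp⟩ => huniq g hg hgp hvg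
  · rintro (rfl | rfl)
    exacts [⟨he, hv, rfl⟩, ⟨hf, hvf, hfp⟩]

/-- Addition of residues modulo `m`, without division. -/
def addMod (m a b : ℕ) : ℕ := if a + b < m then a + b else a + b - m

theorem addMod_eq {a b : ℕ} (ha : a < m) (hb : b ≤ m) : addMod m a b = (a + b) % m := by
  unfold addMod
  split_ifs with h
  · rw [Nat.mod_eq_of_lt h]
  · rw [Nat.mod_eq_sub_mod (by omega), Nat.mod_eq_of_lt (by omega)]

theorem addMod_add {e x : ℕ} (he : e < m) : addMod m (x % m) e = (e + x) % m := by
  rw [addMod_eq (Nat.mod_lt _ (by omega)) he.le, Nat.mod_add_mod, add_comm]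

theorem addMod_sub {e x : ℕ} (he : e < m) : addMod m ((e + x) % m) (m - e) = x % m := by
  rw [addMod_eq (Nat.mod_lt _ (by omega)) (by omega), Nat.mod_add_mod,
    show e + x + (m - e) = x + m by omega, Nat.add_mod_right]

/-- `d j` is the number and `σ j` the sum modulo `m` of the edges of `S` at node `j`. The sum makes
adjacency lists unnecessary: it is the only edge if there is only one, and if there are two, it
yields each of them from the other. -/
structure Counts (L : EdgeList n m k) (S : Finset (Fin m)) (d σ : ℕ → ℕ) : Prop where
  degree : ∀ j, d j = (L.incident S j).card
  sum : ∀ j, σ j = (∑ e ∈ L.incident S j, (e : ℕ)) % m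

namespace Counts

theorem empty (L : EdgeList n m k) : L.Counts ∅ (fun _ => 0) (fun _ => 0) :=
  ⟨fun _ => rfl, fun _ => (Nat.zero_mod m).symm⟩

variable {d σ : ℕ → ℕ} (h : L.Counts S d σ)
include h

theorem sum_lt (hm : 0 < m) (j : ℕ) : σ j < m := h.sum j ▸ Nat.mod_lt _ hm

theorem degree_le (j : ℕ) : d j ≤ m :=
  h.degree j ▸ (Finset.card_le_univ _).trans_eq (Fintype.card_fin m)

theorem insert (he : e ∉ S) :
    L.Counts (insert e S) (fun j => if j ∈ L.nodeEnds e then d j + 1 else d j)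
      (fun j => if j ∈ L.nodeEnds e then addMod m (σ j) e else σ j) := by
  have hne (j : ℕ) : e ∉ L.incident S j := fun h => he (mem_incident.1 h).1
  constructor <;> intro j <;> simp only [incident_insert] <;> split_ifs
  · rw [h.degree, Finset.card_insert_of_notMem (hne j)]
  · exact h.degree j
  · rw [h.sum, Finset.sum_insert (hne j), addMod_add e.isLt]
  · exact h.sum j

theorem erase (he : e ∈ S) :
    L.Counts (S.erase e) (fun j => if j ∈ L.nodeEnds e then d j - 1 else d j)
      (fun j => if j ∈ L.nodeEnds e then addMod m (σ j) (m - e) else σ j) := by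
  have herase {j : ℕ} (hj : j ∉ L.nodeEnds e) : (L.incident S j).erase e = L.incident S j :=
    Finset.erase_eq_of_notMem fun h => hj (mem_incident.1 h).2
  constructor <;> intro j <;> simp only [incident_erase] <;> split_ifs with hj
  · rw [h.degree, Finset.card_erase_of_mem (mem_incident.2 ⟨he, hj⟩)]
  · rw [h.degree, herase hj]
  · rw [h.sum, ← Finset.add_sum_erase _ _ (mem_incident.2 ⟨he, hj⟩), addMod_sub e.isLt]
  · rw [h.sum, herase hj]

theorem exists_incident_eq_singleton (hj : d j = 1) :
    ∃ e : Fin m, L.incident S j = {e} ∧ σ j = e := by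
  rw [h.degree, Finset.card_eq_one] at hj
  obtain ⟨e, he⟩ := hj
  exact ⟨e, he, by rw [h.sum, he, Finset.sum_singleton, Nat.mod_eq_of_lt e.isLt]⟩

theorem exists_incident_eq_pair (hcore : L.IsCore S) (he : e ∈ S) (hj : j ∈ L.nodeEnds e) :
    ∃ f : Fin m, addMod m (σ j) (m - e) = f ∧ L.incident S j = {e, f} := by
  obtain ⟨f, hfe, hf⟩ := hcore.exists_incident_eq_pair he hj
  refine ⟨f, ?_, hf⟩
  rw [h.sum, hf, Finset.sum_pair hfe.symm, addMod_sub e.isLt, Nat.mod_eq_of_lt f.isLt]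

end Counts

theorem touch_of_incident_eq_pair (hj : L.incident S j = {e, f}) : L.Touch S e f := by
  obtain ⟨he, hej⟩ := mem_incident.1 (hj.symm ▸ Finset.mem_insert_self e {f})
  obtain ⟨hf, hfj⟩ := mem_incident.1
    (hj.symm ▸ Finset.mem_insert_of_mem (Finset.mem_singleton_self f))
  obtain ⟨v, hv, rfl⟩ := mem_nodeEnds.1 hej
  obtain ⟨hvf, hpart⟩ := node_mem_nodeEnds.1 hfj
  exact ⟨he, hf, hpart.symm, v, hv, hvf⟩

/-- `D` consists of the edges passed while following a cycle of the core `S` from node `j₀` of `e₀`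
to node `j`, where the walk continues with the edge `e`. Except at `j₀` and `j`, an even number of
these edges is incident to every node. -/
structure Trail (L : EdgeList n m k) (S D : Finset (Fin m)) (e₀ : Fin m) (j₀ : ℕ) (e : Fin m)
    (j : ℕ) : Prop where
  sameCycle : ∀ f ∈ D, L.SameCycle S e₀ f
  sameCycle_next : L.SameCycle S e₀ e
  mem_ends : j ∈ L.nodeEnds e
  closed : e ∈ D → L.incident S j ⊆ D
  even : ∀ i, Even ((L.incident D i).card + (if i = j₀ then 1 else 0) + if i = j then 1 else 0)

namespace Trail

variable {D : Finset (Fin m)} {e₀ : Fin m} {j₀ : ℕ}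

theorem start (S : Finset (Fin m)) (e : Fin m) :
    L.Trail S ∅ e (L.nodeSrc e) e (L.nodeSrc e) where
  sameCycle := fun _ hf => absurd hf (Finset.notMem_empty _)
  sameCycle_next := .refl e
  mem_ends := Sym2.mem_mk_left _ _
  closed := fun he => absurd he (Finset.notMem_empty _)
  even := fun i => by
    rw [show (L.incident ∅ i).card = 0 from rfl, zero_add]
    exact Even.add_self _

theorem step (h : L.Trail S D e₀ j₀ e j) (hL : L.IsSimple) (heD : e ∉ D)
    (hf : L.incident S (L.oppositeNode e j) = {e, f}) :
    L.Trail S (insert e D) e₀ j₀ f (L.oppositeNode e j) where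
  sameCycle := fun g hg => (Finset.mem_insert.1 hg).elim (· ▸ h.sameCycle_next) (h.sameCycle g)
  sameCycle_next := .tail h.sameCycle_next (touch_of_incident_eq_pair hf)
  mem_ends := (mem_incident.1
    (hf.symm ▸ Finset.mem_insert_of_mem (Finset.mem_singleton_self f))).2
  closed := fun hfD => by
    rw [hf, Finset.insert_subset_iff, Finset.singleton_subset_iff]
    exact ⟨Finset.mem_insert_self _ _, hfD⟩
  even := fun i => by
    have heven := h.even i
    have hne := oppositeNode_ne hL h.mem_ends
    rw [Nat.even_iff] at heven ⊢
    rw [incident_insert, nodeEnds_eq h.mem_ends]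
    simp only [Sym2.mem_iff]
    have hcard := Finset.card_insert_of_notMem
      (fun h => heD (mem_incident.1 h).1 : e ∉ L.incident D i)
    rw [apply_ite Finset.card, hcard]
    split_ifs at heven ⊢ <;> omega

theorem even_card_incident (h : L.Trail S D e₀ j₀ e j) (hS : L.IsCore S) (heS : e ∈ S)
    (hDS : D ⊆ S) (heD : e ∈ D) (i : ℕ) : Even (L.incident D i).card := by
  obtain ⟨g, hge, hg⟩ := hS.exists_incident_eq_pair heS h.mem_ends
  have hD : L.incident D j = {e, g} := hg ▸ (incident_mono hDS).antisymm fun x hx =>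
    mem_incident.2 ⟨h.closed heD hx, (mem_incident.1 hx).2⟩
  have hcard : (L.incident D j).card = 2 := hD ▸ Finset.card_pair hge.symm
  have hjj₀ := h.even j
  rw [Nat.even_iff, hcard, if_pos rfl] at hjj₀
  have heven := h.even i
  rw [Nat.even_iff] at heven ⊢
  split_ifs at hjj₀ heven <;> omega

theorem mem_iff_sameCycle (h : L.Trail S D e₀ j₀ e j) (hS : L.IsCore S) (he₀ : e₀ ∈ S)
    (heD : e ∈ D) : f ∈ D ↔ L.SameCycle S e₀ f := by
  have hDS : D ⊆ S := fun f hf => (h.sameCycle f hf).mem he₀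
  refine ⟨h.sameCycle f, fun hf => ?_⟩
  have hef : L.SameCycle S e f := h.sameCycle_next.symm.trans hf
  clear hf
  induction hef with
  | refl => exact heD
  | @tail f g _ hfg ih =>
    obtain ⟨hf, hg, hpart, v, hvf, hvg⟩ := hfg
    have hfj : node v (L.part f) ∈ L.nodeEnds f := node_mem_nodeEnds.2 ⟨hvf, rfl⟩
    obtain ⟨x, hx, hpair⟩ := hS.exists_incident_eq_pair hf hfj
    obtain ⟨a, ha⟩ := h.even_card_incident hS (h.sameCycle_next.mem he₀) hDS heD
      (node v (L.part f))
    have hpos := Finset.card_pos.2 ⟨f, mem_incident.2 ⟨ih, hfj⟩⟩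
    have heq : L.incident D (node v (L.part f)) = L.incident S (node v (L.part f)) :=
      Finset.eq_of_subset_of_card_le (incident_mono hDS)
        (by rw [hpair, Finset.card_pair hx.symm]; omega)
    exact (mem_incident.1 (heq ▸ mem_incident.2
      ⟨hg, node_mem_nodeEnds.2 ⟨hvg, hpart.symm⟩⟩ : g ∈ L.incident D _)).1

end Trail

end EdgeList

/-! ### Finding the core

Throughout, register `2` holds the index of a loop. Array `3` holds the output, arrays `4` and `5`
hold the nodes of the source and of the target of each edge, arrays `6` and `7` the counts of the
edges left at each node, array `8` marks the edges that have been stripped, and array `9` marks the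
edges of the cycles that have been treated. -/

namespace EdgeList

open RAM

/-- Makes the arrays `12` and `13` the identity: every vertex is a path of its own. -/
def initEnds : Program :=
  .forLoop (.reg 0) (.seq (.put 12 (.reg 2) (.reg 2)) (.put 13 (.reg 2) (.reg 2)))

/-- Adds register `b` modulo `m` to the entry of array `7` with index in register `a`. -/
def addSum (a b : ℕ) : Program :=
  .seq (.put 7 (.reg a) (.add (.get 7 (.reg a)) (.reg b)))
    (.ite (.lt (.get 7 (.reg a)) (.reg 1)) .skip
      (.put 7 (.reg a) (.sub (.get 7 (.reg a)) (.reg 1))))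

/-- Computes the product of `n` and the part of the edge in register `2`. -/
def nodeOffset : Program := .block
  [.set 3 (.const 0),
   .ite (.eq (.get 2 (.reg 2)) (.const 1)) (.set 3 (.reg 0)) .skip,
   .ite (.eq (.get 2 (.reg 2)) (.const 2)) (.set 3 (.add (.reg 0) (.reg 0))) .skip]

/-- Copies the part of the edge in register `2` to the output, computes the nodes of the edge, and
counts the edge at both of them. -/
def buildBody : Program := .block
  [.put 3 (.reg 2) (.get 2 (.reg 2)),
   nodeOffset,
   .set 4 (.add (.get 0 (.reg 2)) (.reg 3)),
   .set 5 (.add (.get 1 (.reg 2)) (.reg 3)),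
   .put 4 (.reg 2) (.reg 4),
   .put 5 (.reg 2) (.reg 5),
   .put 6 (.reg 4) (.add (.get 6 (.reg 4)) (.const 1)),
   .put 6 (.reg 5) (.add (.get 6 (.reg 5)) (.const 1)),
   addSum 4 2,
   addSum 5 2]

/-- Treats every edge as in `buildBody`. -/
def build : Program := .forLoop (.reg 1) buildBody

variable {n m W : ℕ} {L : EdgeList n m 3} {s s' : State} {R A : List ℕ}

/-- The registers and arrays that hold the input. -/
structure HasInput (L : EdgeList n m 3) (s : State) : Prop where
  reg_zero : s.reg 0 = n
  reg_one : s.reg 1 = m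
  src : ∀ e : Fin m, s.arr 0 e = L.src e
  dst : ∀ e : Fin m, s.arr 1 e = L.dst e
  part : ∀ e : Fin m, s.arr 2 e = L.part e

/-- The arrays that hold the nodes of the edges. -/
structure HasNodes (L : EdgeList n m 3) (s : State) : Prop where
  src : ∀ e : Fin m, s.arr 4 e = L.nodeSrc e
  dst : ∀ e : Fin m, s.arr 5 e = L.nodeDst e

theorem HasInput.congr (h : HasInput L s) (hs : AgreeOff R A s s')
    (hR : 0 ∉ R ∧ 1 ∉ R) (hA : 0 ∉ A ∧ 1 ∉ A ∧ 2 ∉ A) : HasInput L s' where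
  reg_zero := (hs.reg 0 hR.1).trans h.reg_zero
  reg_one := (hs.reg 1 hR.2).trans h.reg_one
  src := by rw [hs.arr 0 hA.1]; exact h.src
  dst := by rw [hs.arr 1 hA.2.1]; exact h.dst
  part := by rw [hs.arr 2 hA.2.2]; exact h.part

theorem HasInput.setReg (h : HasInput L s) {x : ℕ} (hx : 0 ≠ x ∧ 1 ≠ x) (v : ℕ) :
    HasInput L (s.setReg x v) :=
  h.congr ((AgreeOff.refl s).setReg (List.mem_singleton_self x) v) (by simpa using hx) (A := [])
    (by decide)

theorem HasNodes.congr (h : HasNodes L s) (hs : AgreeOff R A s s') (hA : 4 ∉ A ∧ 5 ∉ A) :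
    HasNodes L s' where
  src := by rw [hs.arr 4 hA.1]; exact h.src
  dst := by rw [hs.arr 5 hA.2]; exact h.dst

theorem initEnds_halts (hW : n ≤ W) (hn : s.reg 0 = n) (φ : ℕ) :
    Halts W initEnds s (φ + (n + 1) * 15) fun ψ s' => ψ = φ ∧
      ∀ v : Fin n, s'.arr 12 v = v ∧ s'.arr 13 v = v := by
  refine (Halts.forLoop_of_pre (e := .reg 0)
    (fun i s => s.reg 0 = n ∧ ∀ v < i, s.arr 12 v = v ∧ s.arr 13 v = v) hW (by decide)
    (fun _ _ hs => hs.1) ?_ ⟨hn, fun v hv => absurd hv v.not_lt_zero⟩).mono le_rfl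
    fun _ _ ⟨hψ, _, hs⟩ => ⟨hψ, fun v => hs v v.isLt⟩
  intro i s hi h2 ⟨hn, hs⟩
  simp +decide only [Program.pre, Expr.eval, State.reg_setReg, State.arr_setReg, State.reg_setArr,
    State.arr_setArr, reduceIte, h2]
  refine ⟨by omega, by omega, by omega, by omega, hn, fun v hv => ?_⟩
  rcases Nat.lt_succ_iff_lt_or_eq.1 hv with hv | rfl
  · rw [Function.update_of_ne hv.ne, Function.update_of_ne hv.ne]
    exact hs v hv
  · exact ⟨Function.update_self .., Function.update_self ..⟩

theorem addSum_pre {a b : ℕ} {Q : State → Prop} (hm : s.reg 1 = m) (ha : s.reg a ≤ W)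
    (hlt : s.arr 7 (s.reg a) < m) (hb : s.reg b ≤ m) (hW : 2 * m ≤ W)
    (hQ : Q (s.setArr 7 (s.reg a) (addMod m (s.arr 7 (s.reg a)) (s.reg b)))) :
    (addSum a b).pre W Q s := by
  simp only [addSum, Program.pre, Expr.eval, Test.eval, State.reg_setArr, State.arr_setArr,
    if_true, Function.update_self, State.setArr_setArr, hm]
  unfold addMod at hQ
  refine ⟨ha, by omega, fun h => ?_, fun h => ⟨ha, by omega, ?_⟩⟩
  · rwa [if_pos h] at hQ
  · rwa [if_neg h] at hQ

theorem nodeOffset_pre {e : Fin m} {Q : State → Prop} (h2 : s.reg 2 = e)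
    (hp : s.arr 2 e = L.part e) (hn : s.reg 0 = n) (hW : 2 * n ≤ W)
    (hQ : Q (s.setReg 3 (n * L.part e))) : nodeOffset.pre W Q s := by
  simp +decide only [nodeOffset, Program.block, Program.pre, Expr.eval, Test.eval,
    State.reg_setReg, State.arr_setReg, State.setReg_setReg, h2, hp, hn, reduceIte]
  obtain hc | hc | hc := (by decide : ∀ c : Fin 3, c = 0 ∨ c = 1 ∨ c = 2) (L.part e) <;>
    rw [hc] at hQ ⊢
  · simpa using hQ
  · simp only [Fin.val_one, mul_one] at hQ
    simpa using ⟨by omega, hQ⟩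
  · simp only [Fin.val_two, mul_two] at hQ
    simpa using ⟨by omega, hQ⟩

theorem update_update_eq_ite (g φ : ℕ → ℕ) (x y : ℕ) :
    Function.update (Function.update g x (φ (g x))) y (φ (g y)) =
      fun j => if j ∈ s(x, y) then φ (g j) else g j := by
  funext j
  simp only [Function.update_apply, Sym2.mem_iff]
  split_ifs <;> grind

theorem forall_lt_succ_update {a : ℕ → ℕ} {g : Fin m → ℕ} {e : Fin m}
    (h : ∀ f : Fin m, f < (e : ℕ) → a f = g f) (f : Fin m) (hf : (f : ℕ) < e + 1) :
    Function.update a e (g e) f = g f := by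
  obtain hlt | heq := Nat.lt_succ_iff_lt_or_eq.1 hf
  · rw [Function.update_of_ne hlt.ne, h f hlt]
  · rw [Fin.ext heq, Function.update_self]

/-- The edges with index less than `i` have been treated by `build`. -/
structure IsBuilt (L : EdgeList n m 3) (i : ℕ) (s : State) : Prop where
  output : ∀ e : Fin m, e < i → s.arr 3 e = L.part e
  src : ∀ e : Fin m, e < i → s.arr 4 e = L.nodeSrc e
  dst : ∀ e : Fin m, e < i → s.arr 5 e = L.nodeDst e
  counts : L.Counts {e | e < i} (s.arr 6) (s.arr 7)

theorem buildBody_pre (hL : L.IsSimple) (hs : HasInput L s) {e : Fin m} (h : IsBuilt L e s)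
    (h2 : s.reg 2 = e) (hW : 3 * n + 2 * m ≤ W) : buildBody.pre W (IsBuilt L (e + 1)) s := by
  have hsrc : L.nodeSrc e < n * 3 := node_lt _ _
  have hdst : L.nodeDst e < n * 3 := node_lt _ _
  have hne := nodeSrc_ne_nodeDst hL e
  have hdegree (j : ℕ) : s.arr 6 j + 1 ≤ W :=
    (Nat.succ_le_succ (h.counts.degree_le j)).trans (by omega)
  have hsum (j : ℕ) : s.arr 7 j < m := h.counts.sum_lt e.pos j
  have hnodeSrc : (L.src e : ℕ) + n * L.part e = L.nodeSrc e := rfl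
  have hnodeDst : (L.dst e : ℕ) + n * L.part e = L.nodeDst e := rfl
  simp only [buildBody, Program.block, Program.pre, Expr.eval, h2, hs.part]
  refine ⟨by omega, by omega, nodeOffset_pre (L := L) h2 (hs.part e) hs.reg_zero (by omega) ?_⟩
  simp +decide only [State.reg_setReg, State.arr_setReg, State.reg_setArr, State.arr_setArr,
    h2, hs.src, hs.dst, reduceIte, hnodeSrc, hnodeDst, Function.update_of_ne hne.symm, hdegree,
    true_and]
  refine ⟨by omega, by omega, by omega, by omega, by omega, by omega, by omega, by omega,
    addSum_pre (m := m) ?_ ?_ ?_ ?_ (by omega) (addSum_pre (m := m) ?_ ?_ ?_ ?_ (by omega) ?_)⟩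
  all_goals simp +decide only [State.reg_setReg, State.arr_setReg, State.reg_setArr,
    State.arr_setArr, h2, hs.reg_one, hsum, reduceIte, Function.update_of_ne hne.symm]
  iterate 4 omega
  have hinsert : ({f | (f : ℕ) < e + 1} : Finset (Fin m)) =
      insert e ({f | (f : ℕ) < e} : Finset (Fin m)) := by
    ext f
    simp only [Finset.mem_filter, Finset.mem_univ, true_and, Finset.mem_insert, Fin.ext_iff]
    omega
  constructor
  all_goals simp +decide only [State.arr_setReg, State.arr_setArr, reduceIte]
  · exact forall_lt_succ_update h.output
  · exact forall_lt_succ_update h.src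
  · exact forall_lt_succ_update h.dst
  · rw [hinsert]
    convert h.counts.insert (e := e) (by simp) using 1
    · exact update_update_eq_ite _ (· + 1) _ _
    · exact update_update_eq_ite _ (addMod m · e) _ _

theorem build_halts (hL : L.IsSimple) (hs : HasInput L s) (h6 : s.arr 6 = fun _ => 0)
    (h7 : s.arr 7 = fun _ => 0) (hW : 3 * n + 2 * m ≤ W) (φ : ℕ) :
    Halts W build s (φ + (m + 1) * 100) fun ψ s' => ψ = φ ∧
      (∀ e : Fin m, s'.arr 3 e = L.part e) ∧ HasNodes L s' ∧
      L.Counts Finset.univ (s'.arr 6) (s'.arr 7) := by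
  refine (Halts.forLoop_of_pre (e := .reg 1) (fun i s => HasInput L s ∧ IsBuilt L i s)
    (by omega : m ≤ W) (by decide) (fun _ _ hs => hs.1.reg_one) (fun i s hi h2 hs => ?_)
    ⟨hs.setReg (by decide) 0, ?_⟩).mono ?_ fun _ _ ⟨hψ, _, hs⟩ => ⟨hψ, fun e => hs.output e e.isLt,
        ⟨fun e => hs.src e e.isLt, fun e => hs.dst e e.isLt⟩, ?_⟩
  · refine Program.pre.of_agreeOff ((buildBody_pre hL hs.1 (e := ⟨i, hi⟩) hs.2 h2 hW).mono
      fun s' hs' hagree => ⟨?_, ?_⟩)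
    · exact (hs.1.congr hagree (by decide) (by decide)).setReg (by decide) _
    · exact ⟨hs'.output, hs'.src, hs'.dst, hs'.counts⟩
  · refine ⟨fun _ h => absurd h (Nat.not_lt_zero _), fun _ h => absurd h (Nat.not_lt_zero _),
      fun _ h => absurd h (Nat.not_lt_zero _), ?_⟩
    simpa only [State.arr_setReg, h6, h7, Nat.not_lt_zero, Finset.filter_false] using Counts.empty L
  · simp only [Program.bound, buildBody, nodeOffset, addSum, Program.block, Expr.cost, Test.cost]
    omega
  · simpa only [Fin.is_lt, Finset.filter_true] using hs.counts

end EdgeList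

/-! ### Stripping leaves and marking cycles -/

namespace EdgeList

open RAM

/-- Strips the only edge at the node in register `3` and moves on to its other node. -/
def stripBody : Program := .block
  [.set 5 (.get 7 (.reg 3)),
   .put 8 (.reg 5) (.const 1),
   .set 4 (.sub (.add (.get 4 (.reg 5)) (.get 5 (.reg 5))) (.reg 3)),
   .set 6 (.sub (.reg 1) (.reg 5)),
   .put 6 (.reg 3) (.sub (.get 6 (.reg 3)) (.const 1)),
   .put 6 (.reg 4) (.sub (.get 6 (.reg 4)) (.const 1)),
   addSum 3 6,
   addSum 4 6,
   .set 3 (.reg 4)]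

/-- Strips the path that starts at the node in register `3`, as long as it starts at a leaf. -/
def stripPath : Program := .while (.eq (.get 6 (.reg 3)) (.const 1)) stripBody

/-- Strips all leaves. A node that becomes a leaf later is met by the path that made it one, so each
node has to be visited by the loop only once. -/
def strip : Program :=
  .forLoop (.add (.add (.reg 0) (.reg 0)) (.reg 0)) (.seq (.set 3 (.reg 2)) stripPath)

variable {n m W : ℕ} {L : EdgeList n m 3} {S : Finset (Fin m)} {s s' : State} {R A : List ℕ}

/-- The memory after the edges outside `S` have been stripped. -/
structure HasRemaining (L : EdgeList n m 3) (S : Finset (Fin m)) (s : State) : Prop where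
  input : HasInput L s
  nodes : HasNodes L s
  counts : L.Counts S (s.arr 6) (s.arr 7)
  removed : ∀ e : Fin m, s.arr 8 e = 0 ↔ e ∈ S

theorem HasRemaining.congr (h : HasRemaining L S s) (hs : AgreeOff R A s s') (hR : 0 ∉ R ∧ 1 ∉ R)
    (hA : (0 ∉ A ∧ 1 ∉ A ∧ 2 ∉ A) ∧ (4 ∉ A ∧ 5 ∉ A) ∧ 6 ∉ A ∧ 7 ∉ A ∧ 8 ∉ A) :
    HasRemaining L S s' where
  input := h.input.congr hs hR hA.1
  nodes := h.nodes.congr hs hA.2.1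
  counts := by rw [hs.arr 6 hA.2.2.1, hs.arr 7 hA.2.2.2.1]; exact h.counts
  removed := by rw [hs.arr 8 hA.2.2.2.2]; exact h.removed

theorem HasRemaining.setReg (h : HasRemaining L S s) {x : ℕ} (hx : 0 ≠ x ∧ 1 ≠ x) (v : ℕ) :
    HasRemaining L S (s.setReg x v) :=
  h.congr ((AgreeOff.refl s).setReg (List.mem_singleton_self x) v) (by simpa using hx) (A := [])
    (by decide)

theorem update_one_eq_zero_iff {a : ℕ → ℕ} {S : Set (Fin m)} (h : ∀ f : Fin m, a f = 0 ↔ f ∈ S)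
    (e f : Fin m) : Function.update a e 1 f = 0 ↔ f ∈ S \ {e} := by
  by_cases hf : f = e
  · rw [hf, Function.update_self]
    exact iff_of_false one_ne_zero fun h => h.2 rfl
  · rw [Function.update_of_ne (Fin.val_ne_of_ne hf), h, Set.mem_sdiff]
    exact (and_iff_left hf).symm

theorem stripBody_pre (hL : L.IsSimple) (h : HasRemaining L S s) {e : Fin m}
    (he : L.incident S (s.reg 3) = {e}) (hsum : s.arr 7 (s.reg 3) = e) (hW : 3 * n + 2 * m ≤ W) :
    stripBody.pre W
      (fun s' => HasRemaining L (S.erase e) s' ∧ s'.reg 3 = L.oppositeNode e (s.reg 3)) s := by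
  obtain ⟨heS, hj⟩ := mem_incident.1 (he.symm ▸ Finset.mem_singleton_self e)
  refine Program.pre.of_agreeOff (Program.pre.mono (Q := fun s' =>
    (∀ f : Fin m, s'.arr 8 f = 0 ↔ f ∈ S.erase e) ∧ L.Counts (S.erase e) (s'.arr 6) (s'.arr 7) ∧
      s'.reg 3 = L.oppositeNode e (s.reg 3)) ?_ fun s' ⟨hremoved, hcounts, hreg⟩ hagree =>
    ⟨⟨h.input.congr hagree (by decide) (by decide), h.nodes.congr hagree (by decide), hcounts,
      hremoved⟩, hreg⟩)
  set j := s.reg 3 with hjdef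
  have hne : L.oppositeNode e j ≠ j := oppositeNode_ne hL hj
  have hends := nodeEnds_eq hj
  have hlt := lt_of_mem_nodeEnds hj
  have hlt' := lt_of_mem_nodeEnds (hends ▸ Sym2.mem_mk_right j _ : L.oppositeNode e j ∈ _)
  have hdegree (i : ℕ) : s.arr 6 i - 1 ≤ W := by have := h.counts.degree_le i; omega
  have hsum_lt (i : ℕ) : s.arr 7 i < m := h.counts.sum_lt e.pos i
  have hopposite : L.nodeSrc e + L.nodeDst e - j = L.oppositeNode e j := rfl
  simp +decide only [stripBody, Program.block, Program.pre, Expr.eval, State.reg_setReg,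
    State.arr_setReg, State.reg_setArr, State.arr_setArr, reduceIte, ← hjdef, hsum, h.nodes.src,
    h.nodes.dst, h.input.reg_one, hopposite, Function.update_of_ne hne, hdegree, true_and]
  refine ⟨by omega, by omega, by omega, by omega, by omega, by omega, by omega,
    addSum_pre (m := m) ?_ ?_ ?_ ?_ (by omega) (addSum_pre (m := m) ?_ ?_ ?_ ?_ (by omega) ?_)⟩
  all_goals simp +decide only [State.reg_setReg, State.arr_setReg, State.reg_setArr,
    State.arr_setArr, h.input.reg_one, hsum_lt, reduceIte, Function.update_of_ne hne, ← hjdef,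
    and_true]
  iterate 4 omega
  refine ⟨by omega, fun f => ?_, ?_⟩
  · rw [update_one_eq_zero_iff h.removed, ← Finset.coe_erase, Finset.mem_coe]
  · convert h.counts.erase heS using 1 <;> rw [hends]
    · exact update_update_eq_ite _ (· - 1) _ _
    · exact update_update_eq_ite _ (addMod m · (m - e)) _ _

theorem stripPath_halts (hL : L.IsSimple) (h : HasRemaining L S s) (hS : L.ContainsLeafless S)
    {N : ℕ} (hleaf : ∀ j < N, j ≠ s.reg 3 → (L.incident S j).card ≠ 1) (hW : 3 * n + 2 * m ≤ W)
    (φ : ℕ) : Halts W stripPath s (φ + S.card * 100 + 5) fun ψ s' => ∃ S' : Finset (Fin m),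
      ψ = φ + S'.card * 100 ∧ HasRemaining L S' s' ∧ L.ContainsLeafless S' ∧
        ∀ j < N, (L.incident S' j).card ≠ 1 := by
  refine Halts.while_loop (fun ψ s => ∃ S : Finset (Fin m), ψ = φ + S.card * 100 + 5 ∧
    HasRemaining L S s ∧ L.ContainsLeafless S ∧
      ∀ j < N, j ≠ s.reg 3 → (L.incident S j).card ≠ 1) ?_ ?_ ⟨S, rfl, h, hS, hleaf⟩
  · clear! S s
    rintro _ s ⟨S, rfl, h, hS, hleaf⟩ hone
    obtain ⟨e, he, hsum⟩ := h.counts.exists_incident_eq_singleton (j := s.reg 3) hone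
    obtain ⟨heS, hj⟩ := mem_incident.1 (he.symm ▸ Finset.mem_singleton_self e)
    have hcard : S.card = (S.erase e).card + 1 := (Finset.card_erase_add_one heS).symm
    have hbound : stripBody.bound ≤ 90 := by decide
    refine ⟨φ + (S.erase e).card * 100 + 100, by simp only [Test.cost, Expr.cost]; omega,
      ((stripBody_pre hL h he hsum hW).halts (φ + (S.erase e).card * 100 + 5)).mono (by omega) ?_⟩
    rintro _ s' ⟨rfl, h', hreg⟩
    refine ⟨S.erase e, rfl, h', hS.erase he, fun j hjN hj' => ?_⟩
    rw [incident_erase]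
    obtain rfl | hjs := eq_or_ne j (s.reg 3)
    · rw [he, Finset.erase_singleton]
      exact zero_ne_one
    · rw [Finset.erase_eq_of_notMem fun hmem => ?_]
      · exact hleaf j hjN hjs
      · have := (mem_incident.1 hmem).2
        rw [nodeEnds_eq hj, Sym2.mem_iff, ← hreg] at this
        exact this.elim hjs hj'
  · clear! S s
    rintro _ s ⟨S, rfl, h, hS, hleaf⟩ hone
    refine ⟨φ + S.card * 100, rfl, S, rfl, h, hS, fun j hj => ?_⟩
    obtain rfl | hjs := eq_or_ne j (s.reg 3)
    · rwa [← h.counts.degree]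
    · exact hleaf j hj hjs

theorem strip_halts (hL : L.IsSimple) (h : HasRemaining L Finset.univ s)
    (hW : 3 * n + 2 * m ≤ W) (φ : ℕ) :
    Halts W strip s (φ + m * 100 + (3 * n + 1) * 20) fun ψ s' => ψ = φ ∧
      ∃ S : Finset (Fin m), HasRemaining L S s' ∧ L.ContainsLeafless S ∧
        ∀ j, (L.incident S j).card ≠ 1 := by
  refine ((Halts.forLoop (c := 7) (N := n * 3) (e := .add (.add (.reg 0) (.reg 0)) (.reg 0))
    (φ := φ + m * 100) (fun i ψ s => ∃ S : Finset (Fin m), ψ = φ + S.card * 100 ∧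
      HasRemaining L S s ∧ L.ContainsLeafless S ∧ ∀ j < i, (L.incident S j).card ≠ 1)
    (by omega) (by decide) ?_ ?_ ?_).mono ?_ fun _ _ hs => hs).relax ?_
  · rintro i _ s ⟨S, -, h, -⟩
    simp only [Expr.eval, h.input.reg_zero]
    omega
  · rintro i _ s hi h2 ⟨S, rfl, h, hS, hleaf⟩
    refine Halts.seq ((Halts.set (φ := φ + S.card * 100 + 5) ?_ ?_).mono le_rfl fun _ _ => id)
    · simp only [Expr.eval]
      omega
    · refine (stripPath_halts hL (h.setReg (by decide) _) hS (N := i + 1) (fun j hj hne => ?_)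
        hW φ).mono le_rfl fun _ _ ⟨S', hψ, h', hS', hleaf'⟩ =>
          ⟨S', hψ, h'.setReg (by decide) _, hS', hleaf'⟩
      simp only [State.reg_setReg, reduceIte, Expr.eval, h2] at hne
      exact hleaf j (by omega)
  · exact ⟨Finset.univ, by rw [Finset.card_univ, Fintype.card_fin], h.setReg (by decide) _,
      fun _ _ => Finset.subset_univ _, fun _ hj => absurd hj (Nat.not_lt_zero _)⟩
  · simp only [Expr.cost]
    omega
  · rintro _ s' ⟨S, rfl, h', hS, hleaf⟩
    refine ⟨φ, Nat.le_add_right .., rfl, S, h', hS, fun j hj => ?_⟩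
    obtain ⟨e, he⟩ := Finset.card_pos.1 (hj ▸ one_pos)
    exact hleaf j (lt_of_mem_nodeEnds (mem_incident.1 he).2) hj

/-- Replaces the edge in register `5` by the other edge of the core at the node in register `6`. -/
def nextEdge : Program :=
  .seq (.set 5 (.sub (.add (.get 7 (.reg 6)) (.reg 1)) (.reg 5)))
    (.ite (.lt (.reg 5) (.reg 1)) .skip (.set 5 (.sub (.reg 5) (.reg 1))))

/-- Marks the edge in register `5` and moves on along its cycle. -/
def markBody : Program := .block
  [.put 9 (.reg 5) (.const 1),
   .set 6 (.sub (.add (.get 4 (.reg 5)) (.get 5 (.reg 5))) (.reg 6)),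
   nextEdge]

/-- Marks the edges from the one in register `5` on, until it meets a marked one. -/
def markLoop : Program := .while (.eq (.get 9 (.reg 5)) (.const 0)) markBody

/-- Marks the cycle of the edge in register `2` as treated. -/
def mark : Program := .seq (.set 5 (.reg 2)) (.seq (.set 6 (.get 4 (.reg 2))) markLoop)

/-- The part of the memory that is fixed once all leaves have been stripped. -/
structure HasCore (L : EdgeList n m 3) (core : Finset (Fin m)) (s : State) : Prop
    extends HasRemaining L core s where
  isCore : L.IsCore core

variable {core : Finset (Fin m)} {done : Set (Fin m)}

theorem HasCore.congr (h : HasCore L core s) (hs : AgreeOff R A s s') (hR : 0 ∉ R ∧ 1 ∉ R)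
    (hA : (0 ∉ A ∧ 1 ∉ A ∧ 2 ∉ A) ∧ (4 ∉ A ∧ 5 ∉ A) ∧ 6 ∉ A ∧ 7 ∉ A ∧ 8 ∉ A) :
    HasCore L core s' :=
  ⟨h.toHasRemaining.congr hs hR hA, h.isCore⟩

theorem HasCore.setReg (h : HasCore L core s) {x : ℕ} (hx : 0 ≠ x ∧ 1 ≠ x) (v : ℕ) :
    HasCore L core (s.setReg x v) :=
  ⟨h.toHasRemaining.setReg hx v, h.isCore⟩

theorem HasCore.nextEdge_pre (h : HasCore L core s) (hW : 2 * m ≤ W) {e : Fin m} (he : e ∈ core)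
    (h5 : s.reg 5 = e) (h6 : s.reg 6 ∈ L.nodeEnds e) : nextEdge.pre W
      (fun s' => ∃ f : Fin m, L.incident core (s.reg 6) = {e, f} ∧ s' = s.setReg 5 f) s := by
  obtain ⟨f, hf, hpair⟩ := h.counts.exists_incident_eq_pair h.isCore he h6
  have hlt : s.arr 7 (s.reg 6) < m := h.counts.sum_lt e.pos _
  simp only [nextEdge, Program.pre, Expr.eval, Test.eval, State.reg_setReg, State.setReg_setReg,
    reduceIte, h.input.reg_one, h5]
  unfold addMod at hf
  simp +decide only [reduceIte]
  refine ⟨by omega, fun hlt' => ⟨f, hpair, ?_⟩, fun hle => ⟨by omega, f, hpair, ?_⟩⟩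
  · rw [← hf, if_pos (by omega), Nat.add_sub_assoc e.isLt.le]
  · rw [← hf, if_neg (by omega), Nat.add_sub_assoc e.isLt.le]

theorem HasCore.markBody_pre (h : HasCore L core s) (hW : 3 * n + 2 * m + 1 ≤ W)
    (hdone : ∀ f : Fin m, s.arr 9 f = 0 ↔ f ∉ done) {e : Fin m} (he : e ∈ core)
    (h5 : s.reg 5 = e) (h6 : s.reg 6 ∈ L.nodeEnds e) :
    markBody.pre W (fun s' => (∀ f : Fin m, s'.arr 9 f = 0 ↔ f ∉ insert e done) ∧
      s'.reg 6 = L.oppositeNode e (s.reg 6) ∧ ∃ f : Fin m, s'.reg 5 = f ∧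
        L.incident core (L.oppositeNode e (s.reg 6)) = {e, f}) s := by
  have hmem : L.oppositeNode e (s.reg 6) ∈ L.nodeEnds e :=
    nodeEnds_eq h6 ▸ Sym2.mem_mk_right (s.reg 6) _
  have hlt := lt_of_mem_nodeEnds hmem
  have hopposite : L.nodeSrc e + L.nodeDst e - s.reg 6 = L.oppositeNode e (s.reg 6) := rfl
  have hcore : HasCore L core ((s.setArr 9 e 1).setReg 6 (L.oppositeNode e (s.reg 6))) :=
    h.congr (((AgreeOff.refl s).setArr (List.mem_singleton_self 9) _ _).setReg
      (List.mem_singleton_self 6) _) (by decide) (by decide)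
  simp +decide only [markBody, Program.block, Program.pre, Expr.eval, State.reg_setArr,
    State.arr_setArr, reduceIte, h5, h.nodes.src, h.nodes.dst, hopposite]
  refine ⟨by omega, by omega, by omega, (hcore.nextEdge_pre (by omega) he ?_ ?_).mono ?_⟩
  · simp +decide only [State.reg_setReg, State.reg_setArr, reduceIte, h5]
  · simpa only [State.reg_setReg, reduceIte] using hmem
  · rintro _ ⟨f, hf, rfl⟩
    simp +decide only [State.reg_setReg, State.arr_setReg, State.arr_setArr, reduceIte] at hf ⊢
    refine ⟨fun g => (update_one_eq_zero_iff (S := doneᶜ) hdone e g).trans ?_, trivial, f, rfl, hf⟩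
    rw [Set.mem_sdiff, Set.mem_compl_iff, Set.mem_insert_iff, not_or, and_comm,
      Set.mem_singleton_iff]

theorem HasCore.markLoop_halts (h : HasCore L core s) (hW : 3 * n + 2 * m + 1 ≤ W)
    (hdone : ∀ f : Fin m, s.arr 9 f = 0 ↔ f ∉ done) {e : Fin m} (he : e ∈ core)
    (hed : ∀ f, L.SameCycle core e f → f ∉ done) (h5 : s.reg 5 = e) (h6 : s.reg 6 = L.nodeSrc e)
    (φ : ℕ) : Halts W markLoop s (φ + doneᶜ.ncard * 60 + 5) fun ψ s' =>
      ψ = φ + (done ∪ {f | L.SameCycle core e f})ᶜ.ncard * 60 ∧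
      ∀ f : Fin m, s'.arr 9 f = 0 ↔ f ∉ done ∪ {f | L.SameCycle core e f} := by
  have hbound : markBody.bound ≤ 51 := by decide
  refine Halts.while_loop (fun ψ s => HasCore L core s ∧ ∃ (D : Finset (Fin m)) (f : Fin m),
    ψ = φ + (done ∪ D)ᶜ.ncard * 60 + 5 ∧ (∀ f : Fin m, s.arr 9 f = 0 ↔ f ∉ done ∪ D) ∧
    s.reg 5 = f ∧ L.Trail core D e (L.nodeSrc e) f (s.reg 6)) ?_ ?_
    ⟨h, ∅, e, by simp, by simpa using hdone, h5,
      by rw [h6]; exact Trail.start core e⟩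
  · clear! s
    rintro _ s ⟨h, D, f, rfl, hmarks, h5, htrail⟩ hf
    simp only [Test.eval, Expr.eval, h5, hmarks] at hf
    have hinsert : done ∪ ↑(insert f D) = insert f (done ∪ (D : Set (Fin m))) := by
      rw [Finset.coe_insert, Set.union_insert]
    have hcard : (done ∪ ↑(insert f D))ᶜ.ncard + 1 = (done ∪ (D : Set (Fin m)))ᶜ.ncard := by
      rw [← Set.ncard_sdiff_singleton_add_one (Set.mem_compl hf), hinsert, Set.insert_eq,
        Set.compl_union, Set.inter_comm]
      rfl
    refine ⟨φ + (done ∪ ↑(insert f D))ᶜ.ncard * 60 + 60, by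
      simp only [Test.cost, Expr.cost]; omega, (((h.markBody_pre hW hmarks
        (htrail.sameCycle_next.mem he) h5 htrail.mem_ends).halts
          (φ + (done ∪ ↑(insert f D))ᶜ.ncard * 60 + 5)).agreeOff).mono (by omega) ?_⟩
    rintro _ s' ⟨⟨rfl, hmarks', h6, g, h5', hpair⟩, hagree⟩
    refine ⟨h.congr hagree (by decide) (by decide), insert f D, g, rfl, by rwa [hinsert], h5', ?_⟩
    rw [h6]
    exact htrail.step h.isCore.simple (fun hfD => hf (.inr hfD)) hpair
  · clear! s
    rintro _ s ⟨h, D, f, rfl, hmarks, h5, htrail⟩ hf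
    simp only [Test.eval, Expr.eval, h5, hmarks, not_not] at hf
    have hfD : f ∈ D := hf.resolve_left (hed f htrail.sameCycle_next)
    have hD : (D : Set (Fin m)) = {f | L.SameCycle core e f} :=
      Set.ext fun g => htrail.mem_iff_sameCycle h.isCore he hfD
    rw [hD] at hmarks ⊢
    exact ⟨_, rfl, rfl, hmarks⟩

theorem HasCore.mark_halts (h : HasCore L core s) (hW : 3 * n + 2 * m + 1 ≤ W)
    (hdone : ∀ f : Fin m, s.arr 9 f = 0 ↔ f ∉ done) {e : Fin m} (he : e ∈ core)
    (hed : ∀ f, L.SameCycle core e f → f ∉ done) (h2 : s.reg 2 = e) (φ : ℕ) :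
    Halts W mark s (φ + doneᶜ.ncard * 60 + 10) fun ψ s' =>
      ψ = φ + (done ∪ {f | L.SameCycle core e f})ᶜ.ncard * 60 ∧
      ∀ f : Fin m, s'.arr 9 f = 0 ↔ f ∉ done ∪ {f | L.SameCycle core e f} := by
  have hlt : L.nodeSrc e < n * 3 := node_lt _ _
  refine Halts.seq ((Halts.set (φ := φ + doneᶜ.ncard * 60 + 8) ?_ ?_).mono le_rfl fun _ _ => id)
  · simp only [Expr.eval, h2]
    omega
  refine Halts.seq ((Halts.set (φ := φ + doneᶜ.ncard * 60 + 5) ?_ ?_).mono le_rfl fun _ _ => id)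
  · simp +decide only [Expr.eval, State.reg_setReg, State.arr_setReg, reduceIte, h2, h.nodes.src]
    omega
  refine ((h.setReg (by decide) _).setReg (by decide) _).markLoop_halts hW hdone he hed ?_ ?_ φ
  · simp +decide only [State.reg_setReg, Expr.eval, reduceIte, h2]
  · simp +decide only [State.reg_setReg, State.arr_setReg, Expr.eval, reduceIte, h2, h.nodes.src]

end EdgeList

/-! ### Choosing an edge of a cycle

Arrays `10`, `11` and `14` hold for each vertex an edge at it, increased by `1`, among the chosen
edges of `A`, the chosen edges of `B` and the edges moved to the forest `B`. Arrays `12` and `13`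
hold the path ends of the fourth forest and of the forest `A`. -/

namespace EdgeList

variable {n m : ℕ} {L : EdgeList n m 3} {S : Set (Fin m)} {a : ℕ → ℕ}

theorem exists_opposite {f : Fin m} {v : Fin n} (hv : v ∈ L.ends f) :
    ∃ w : Fin n, (L.src f : ℕ) + L.dst f - v = w ∧ L.ends f = s(w, v) := by
  rcases mem_ends.1 hv with rfl | rfl
  · exact ⟨L.dst f, by omega, Sym2.eq_swap⟩
  · exact ⟨L.src f, by omega, rfl⟩

/-- `a` holds for each vertex that is covered by `S` the successor of an edge of `S` at it, and `0`
for every other vertex. -/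
def Covers (L : EdgeList n m 3) (S : Set (Fin m)) (a : ℕ → ℕ) : Prop :=
  ∀ v : Fin n, v ∉ L.cover S ∧ a v = 0 ∨ ∃ e ∈ S, v ∈ L.ends e ∧ a v = e + 1

namespace Covers

theorem insert (h : Covers L S a) {f : Fin m} {x y : Fin n} (hf : L.ends f = s(x, y)) :
    Covers L (insert f S) (Function.update (Function.update a y (f + 1)) x (f + 1)) := by
  intro v
  by_cases hv : v ∈ L.ends f
  · refine Or.inr ⟨f, Set.mem_insert f S, hv, ?_⟩
    obtain rfl | rfl := Sym2.mem_iff.1 (hf ▸ hv)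
    · exact Function.update_self ..
    · simp only [Function.update_apply, reduceIte, ite_self]
  · have hvxy : v ≠ x ∧ v ≠ y := by rwa [hf, Sym2.mem_iff, not_or] at hv
    rw [Function.update_of_ne (Fin.val_ne_of_ne hvxy.1),
      Function.update_of_ne (Fin.val_ne_of_ne hvxy.2)]
    refine (h v).imp (fun ⟨hvS, h0⟩ => ⟨?_, h0⟩) fun ⟨e, he, hve⟩ => ⟨e, Or.inr he, hve⟩
    rw [cover_insert]
    exact fun hv' => hv'.elim hv hvS

theorem eq_zero_iff (h : Covers L S a) {v : Fin n} : a v = 0 ↔ v ∉ L.cover S := by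
  rcases h v with ⟨hv, h0⟩ | ⟨e, he, hv, hsucc⟩
  · exact iff_of_true h0 hv
  · exact iff_of_false (by omega) fun hv' => hv' ⟨e, he, hv⟩

theorem exists_of_mem_cover (h : Covers L S a) {v : Fin n} (hv : v ∈ L.cover S) :
    ∃ e ∈ S, v ∈ L.ends e ∧ a v = e + 1 :=
  (h v).resolve_left fun h => h.1 hv

end Covers

end EdgeList

/-- The data of an edge distribution that are kept in memory. -/
structure DistributionTables (n m : ℕ) where
  chosenA : Set (Fin m)
  chosenB : Set (Fin m)
  toB : Set (Fin m)
  otherA : Fin n → Fin n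
  otherFour : Fin n → Fin n
  forest : Fin m → Fin 4

namespace EdgeDistribution

variable {n m : ℕ} {L : EdgeList n m 3} {core done : Set (Fin m)} {D : EdgeDistribution n m}

/-- The tables that belong to a distribution. -/
noncomputable def tables (L : EdgeList n m 3) (D : EdgeDistribution n m) :
    DistributionTables n m where
  chosenA := D.chosen ∩ L.partEdges 0
  chosenB := D.chosen ∩ L.partEdges 1
  toB := D.toB
  otherA := D.otherA
  otherFour := D.otherFour
  forest := D.forest L

namespace IsSound

variable (h : D.IsSound L core done) {f g : Fin m}
include h

theorem forest_choose (hf : f ∉ D.chosen) :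
    (D.choose f).forest L = Function.update (D.forest L) f 3 :=
  EdgeDistribution.forest_choose (fun hfA => hf (h.toA_subset hfA).1)
    (fun hfB => hf (h.toB_subset hfB).1) (fun hfs => hf (h.swapped_subset hfs).1)

theorem tables_choose_zero (hf : f ∉ D.chosen) (hp : L.part f = 0) :
    (D.choose f).tables L = { D.tables L with
      chosenA := insert f (D.tables L).chosenA
      forest := Function.update (D.forest L) f 3 } := by
  simp only [tables, h.forest_choose hf, DistributionTables.mk.injEq]
  refine ⟨Set.insert_inter_of_mem hp, Set.insert_inter_of_notMem ?_, rfl, rfl, rfl, trivial⟩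
  simp [EdgeList.partEdges, hp]

theorem tables_choose_one (hf : f ∉ D.chosen) (hp : L.part f = 1) :
    (D.choose f).tables L = { D.tables L with
      chosenB := insert f (D.tables L).chosenB
      forest := Function.update (D.forest L) f 3 } := by
  simp only [tables, h.forest_choose hf, DistributionTables.mk.injEq]
  refine ⟨Set.insert_inter_of_notMem ?_, Set.insert_inter_of_mem hp, rfl, rfl, rfl, trivial⟩
  simp [EdgeList.partEdges, hp]

variable (hf : f ∉ D.chosen) (hp : L.part f = 2)
include hf hp

theorem tables_choose_two :
    (D.choose f).tables L = { D.tables L with forest := Function.update (D.forest L) f 3 } := by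
  simp only [tables, h.forest_choose hf, choose_chosen_inter hp (by decide : (0 : Fin 3) ≠ 2),
    choose_chosen_inter hp (by decide : (1 : Fin 3) ≠ 2)]
  rfl

theorem tables_linkA :
    ((D.choose f).linkA f).tables L =
      { D.tables L with forest := Function.update (D.forest L) f 0 } := by
  have hforest : ((D.choose f).linkA f).forest L = Function.update (D.forest L) f 0 := by
    rw [forest_linkA (Set.mem_insert f _), h.forest_choose hf, Function.update_idem]
  change { (D.choose f).tables L with forest := ((D.choose f).linkA f).forest L } = _
  rw [hforest, h.tables_choose_two hf hp]

theorem tables_linkB :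
    ((D.choose f).linkB f).tables L = { D.tables L with
      toB := insert f (D.tables L).toB
      forest := Function.update (D.forest L) f 1 } := by
  have hforest : ((D.choose f).linkB f).forest L = Function.update (D.forest L) f 1 := by
    rw [forest_linkB (D := D.choose f) (Set.mem_insert f _) fun hfA => hf (h.toA_subset hfA).1,
      h.forest_choose hf, Function.update_idem]
  change { (D.choose f).tables L with
    toB := insert f D.toB, forest := ((D.choose f).linkB f).forest L } = _
  rw [hforest, h.tables_choose_two hf hp]
  rfl

theorem tables_swap (hg : g ∈ D.chosen ∩ L.partEdges 1) :
    ((D.choose f).swap g).tables L = { D.tables L with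
      forest := Function.update (Function.update (D.forest L) f 3) g 2 } := by
  have hg2 : g ∉ L.partEdges 2 := fun hg' => absurd (hg.2.symm.trans hg') (by decide)
  have hforest : ((D.choose f).swap g).forest L =
      Function.update (Function.update (D.forest L) f 3) g 2 := by
    rw [forest_swap (D := D.choose f) (Set.mem_insert_of_mem f hg.1)
      (fun hgA => hg2 (h.toA_subset hgA).2) fun hgB => hg2 (h.toB_subset hgB).2, h.forest_choose hf]
  change { (D.choose f).tables L with forest := ((D.choose f).swap g).forest L } = _
  rw [hforest, h.tables_choose_two hf hp]

end IsSound

end EdgeDistribution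

namespace EdgeList

open RAM

/-- Loads the edge in register `2`: its target, its source, the edge, and the node of the target. -/
def loadEdge : Program := .block
  [.set 3 (.get 1 (.reg 2)), .set 4 (.get 0 (.reg 2)), .set 5 (.reg 2), .set 6 (.get 5 (.reg 2))]

/-- Loads the edge in register `2` as `loadEdge` does, with source and target exchanged. -/
def loadEdgeRev : Program := .block
  [.set 3 (.get 0 (.reg 2)), .set 4 (.get 1 (.reg 2)), .set 5 (.reg 2), .set 6 (.get 4 (.reg 2))]

/-- If the ends of the loaded edge are the ends of a path in array `a`, loads instead the other edge
of the cycle at the vertex in register `3`. -/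
def swing (a : ℕ) : Program :=
  .ite (.eq (.get a (.reg 3)) (.reg 4))
    (.seq nextEdge (.set 4 (.sub (.add (.get 0 (.reg 5)) (.get 1 (.reg 5))) (.reg 3)))) .skip

/-- Joins the paths in array `a` that end in the ends of the loaded edge. -/
def merge (a : ℕ) : Program := .block
  [.set 7 (.get a (.reg 4)), .set 8 (.get a (.reg 3)), .put a (.reg 7) (.reg 8),
   .put a (.reg 8) (.reg 7)]

/-- Enters the loaded edge in array `a` at its ends. -/
def enter (a : ℕ) : Program := .block
  [.put a (.reg 3) (.add (.reg 5) (.const 1)), .put a (.reg 4) (.add (.reg 5) (.const 1))]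

/-- Assigns the edge in register `x` to the forest `i`. -/
def assign (x : ℕ) (i : Fin 4) : Program := .put 3 (.reg x) (.const i)

/-- Loads a chosen edge of `B` at the vertex in register `3`, and its other end. -/
def loadChosen : Program :=
  .seq (.set 7 (.sub (.get 11 (.reg 3)) (.const 1)))
    (.set 8 (.sub (.add (.get 0 (.reg 7)) (.get 1 (.reg 7))) (.reg 3)))

variable {n m W : ℕ} {L : EdgeList n m 3} {core : Finset (Fin m)} {T T' : DistributionTables n m}
  {e f : Fin m} {y w : Fin n} {R A : List ℕ} {s s' : State}

/-- The memory holds the tables `T`. -/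
structure HoldsTables (L : EdgeList n m 3) (T : DistributionTables n m) (s : State) : Prop where
  chosenA : Covers L T.chosenA (s.arr 10)
  chosenB : Covers L T.chosenB (s.arr 11)
  toB : Covers L T.toB (s.arr 14)
  otherFour : ∀ v : Fin n, s.arr 12 v = T.otherFour v
  otherA : ∀ v : Fin n, s.arr 13 v = T.otherA v
  forest : ∀ e : Fin m, s.arr 3 e = T.forest e

theorem HoldsTables.congr (h : HoldsTables L T s) (hs : AgreeOff R A s s')
    (hA : 10 ∉ A ∧ 11 ∉ A ∧ 14 ∉ A ∧ 12 ∉ A ∧ 13 ∉ A ∧ 3 ∉ A) : HoldsTables L T s' where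
  chosenA := by rw [hs.arr 10 hA.1]; exact h.chosenA
  chosenB := by rw [hs.arr 11 hA.2.1]; exact h.chosenB
  toB := by rw [hs.arr 14 hA.2.2.1]; exact h.toB
  otherFour := by rw [hs.arr 12 hA.2.2.2.1]; exact h.otherFour
  otherA := by rw [hs.arr 13 hA.2.2.2.2.1]; exact h.otherA
  forest := by rw [hs.arr 3 hA.2.2.2.2.2]; exact h.forest

/-- The registers hold the ends `y` and `w` of an edge `f` on the cycle of `e`, this edge, and the
node of `y`. -/
structure IsLoaded (L : EdgeList n m 3) (core : Finset (Fin m)) (T : DistributionTables n m)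
    (e : Fin m) (y w : Fin n) (f : Fin m) (s : State) : Prop
    extends HasCore L core s, HoldsTables L T s where
  reg_y : s.reg 3 = y
  reg_w : s.reg 4 = w
  reg_f : s.reg 5 = f
  reg_node : s.reg 6 = node y (L.part e)
  sameCycle : L.SameCycle core e f
  ends_eq : L.ends f = s(w, y)

theorem IsLoaded.congr (h : IsLoaded L core T e y w f s) (hs : AgreeOff R A s s')
    (hR : (0 ∉ R ∧ 1 ∉ R) ∧ 3 ∉ R ∧ 4 ∉ R ∧ 5 ∉ R ∧ 6 ∉ R)
    (hA : (0 ∉ A ∧ 1 ∉ A ∧ 2 ∉ A) ∧ (4 ∉ A ∧ 5 ∉ A) ∧ 6 ∉ A ∧ 7 ∉ A ∧ 8 ∉ A)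
    (hT : HoldsTables L T' s') : IsLoaded L core T' e y w f s' where
  __ := h.toHasCore.congr hs hR.1 hA
  __ := hT
  reg_y := (hs.reg 3 hR.2.1).trans h.reg_y
  reg_w := (hs.reg 4 hR.2.2.1).trans h.reg_w
  reg_f := (hs.reg 5 hR.2.2.2.1).trans h.reg_f
  reg_node := (hs.reg 6 hR.2.2.2.2).trans h.reg_node
  sameCycle := h.sameCycle
  ends_eq := h.ends_eq

section Load

variable (h : HasCore L core s) (hT : HoldsTables L T s) (hW : 3 * n + 2 * m + 1 ≤ W)
  (h2 : s.reg 2 = e)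
include h hT hW h2

theorem loadEdge_pre : loadEdge.pre W (IsLoaded L core T e (L.dst e) (L.src e) e) s := by
  have hnode : L.nodeDst e < n * 3 := node_lt _ _
  refine Program.pre.of_agreeOff (Program.pre.mono (Q := fun s' => s'.reg 3 = L.dst e ∧
    s'.reg 4 = L.src e ∧ s'.reg 5 = e ∧ s'.reg 6 = L.nodeDst e) ?_
    fun s' ⟨h3, h4, h5, h6⟩ hs => ⟨h.congr hs (by decide) (by decide), hT.congr hs (by decide),
      h3, h4, h5, h6, .refl e, rfl⟩)
  simp +decide only [loadEdge, Program.block, Program.pre, Expr.eval, State.reg_setReg,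
    State.arr_setReg, reduceIte, h2, h.input.src, h.input.dst, h.nodes.dst, and_true]
  omega

theorem loadEdgeRev_pre : loadEdgeRev.pre W (IsLoaded L core T e (L.src e) (L.dst e) e) s := by
  have hnode : L.nodeSrc e < n * 3 := node_lt _ _
  refine Program.pre.of_agreeOff (Program.pre.mono (Q := fun s' => s'.reg 3 = L.src e ∧
    s'.reg 4 = L.dst e ∧ s'.reg 5 = e ∧ s'.reg 6 = L.nodeSrc e) ?_
    fun s' ⟨h3, h4, h5, h6⟩ hs => ⟨h.congr hs (by decide) (by decide), hT.congr hs (by decide),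
      h3, h4, h5, h6, .refl e, Sym2.eq_swap⟩)
  simp +decide only [loadEdgeRev, Program.block, Program.pre, Expr.eval, State.reg_setReg,
    State.arr_setReg, reduceIte, h2, h.input.src, h.input.dst, h.nodes.src, and_true]
  omega

end Load

namespace IsLoaded

variable {a : ℕ}

theorem swing_pre (h : IsLoaded L core T e y w e s) (hW : 3 * n + 2 * m + 1 ≤ W) (he : e ∈ core)
    {o : Fin n → Fin n} (ho : ∀ v : Fin n, s.arr a v = o v) :
    (swing a).pre W (fun s' => ∃ w' f, IsLoaded L core T e y w' f s' ∧ o y ≠ w') s := by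
  have hy : s.reg 6 ∈ L.nodeEnds e := by
    rw [h.reg_node, node_mem_nodeEnds]
    exact ⟨h.ends_eq ▸ Sym2.mem_mk_right w y, rfl⟩
  simp only [swing, Program.pre, Expr.eval, Test.eval, h.reg_y, h.reg_w, ho]
  refine ⟨fun hyw => ?_, fun hyw => ⟨w, e, h, fun hyw' => hyw (congrArg Fin.val hyw')⟩⟩
  refine (h.toHasCore.nextEdge_pre (by omega) he h.reg_f hy).mono ?_
  rintro _ ⟨f, hpair, rfl⟩
  obtain ⟨g, hge, hg⟩ := h.isCore.exists_incident_eq_pair he hy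
  obtain rfl : f = g := by
    have hgef : g ∈ ({e, f} : Finset (Fin m)) := by simp [← hpair, hg]
    simpa [hge, eq_comm] using hgef
  have hfy : f ∈ L.incident core (s.reg 6) := by simp [hpair]
  rw [mem_incident, h.reg_node, node_mem_nodeEnds] at hfy
  obtain ⟨w', hw', hends⟩ := exists_opposite hfy.2.1
  have hsame : L.SameCycle core e f := .single (touch_of_incident_eq_pair hpair)
  have hww' : o y ≠ w' := fun hyw' => hge <| h.isCore.simple.inj <| by
    rw [hends, ← hyw', Fin.ext hyw, h.ends_eq]
  have hs : AgreeOff [5, 4] [] s ((s.setReg 5 f).setReg 4 w') :=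
    ((AgreeOff.refl s).setReg (by decide) _).setReg (by decide) _
  simp +decide only [State.reg_setReg, State.arr_setReg, reduceIte, h.reg_y, h.input.src,
    h.input.dst, hw']
  exact ⟨by omega, w', f, { h.toHasCore.congr hs (by decide) (by decide),
    h.toHoldsTables.congr hs (by decide) with
      reg_y := h.reg_y, reg_w := rfl, reg_f := rfl, reg_node := h.reg_node, sameCycle := hsame,
      ends_eq := hends }, hww'⟩

section Update

variable (h : IsLoaded L core T e y w f s) (hW : 3 * n + 2 * m + 3 ≤ W)
include h hW

theorem merge_pre {o : Fin n → Fin n} (ho : ∀ v : Fin n, s.arr a v = o v) :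
    (merge a).pre W (fun s' => ∀ v : Fin n, s'.arr a v = mergeEnds o w y v) s := by
  simp +decide only [merge, Program.block, Program.pre, Expr.eval, State.reg_setReg,
    State.arr_setReg, State.reg_setArr, State.arr_setArr, reduceIte, h.reg_y, h.reg_w, ho]
  refine ⟨by omega, by omega, by omega, by omega, by omega, by omega, fun v => ?_⟩
  simp only [mergeEnds, Function.update_apply, Fin.val_inj, ho]
  split_ifs <;> rfl

theorem merge_otherFour_pre : (merge 12).pre W
    (IsLoaded L core { T with otherFour := mergeEnds T.otherFour w y } e y w f) s :=
  Program.pre.of_agreeOff (Program.pre.mono (h.merge_pre hW h.otherFour) fun s' h12 hs =>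
    h.congr hs (by decide) (by decide)
      { chosenA := (hs.arr 10 (by decide)).symm ▸ h.chosenA
        chosenB := (hs.arr 11 (by decide)).symm ▸ h.chosenB
        toB := (hs.arr 14 (by decide)).symm ▸ h.toB
        otherFour := h12
        otherA := (hs.arr 13 (by decide)).symm ▸ h.otherA
        forest := (hs.arr 3 (by decide)).symm ▸ h.forest })

theorem merge_otherA_pre : (merge 13).pre W
    (IsLoaded L core { T with otherA := mergeEnds T.otherA w y } e y w f) s :=
  Program.pre.of_agreeOff (Program.pre.mono (h.merge_pre hW h.otherA) fun s' h13 hs =>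
    h.congr hs (by decide) (by decide)
      { chosenA := (hs.arr 10 (by decide)).symm ▸ h.chosenA
        chosenB := (hs.arr 11 (by decide)).symm ▸ h.chosenB
        toB := (hs.arr 14 (by decide)).symm ▸ h.toB
        otherFour := (hs.arr 12 (by decide)).symm ▸ h.otherFour
        otherA := h13
        forest := (hs.arr 3 (by decide)).symm ▸ h.forest })

theorem enter_pre {S : Set (Fin m)} (ha : Covers L S (s.arr a)) :
    (enter a).pre W (fun s' => Covers L (insert f S) (s'.arr a)) s := by
  simp only [enter, Program.block, Program.pre, Expr.eval, State.reg_setArr, State.arr_setArr,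
    reduceIte, h.reg_y, h.reg_w, h.reg_f]
  exact ⟨by omega, by omega, by omega, by omega, ha.insert h.ends_eq⟩

theorem enter_chosenA_pre : (enter 10).pre W
    (IsLoaded L core { T with chosenA := insert f T.chosenA } e y w f) s :=
  Program.pre.of_agreeOff (Program.pre.mono (h.enter_pre hW h.chosenA) fun s' h10 hs =>
    h.congr hs (by decide) (by decide)
      { chosenA := h10
        chosenB := (hs.arr 11 (by decide)).symm ▸ h.chosenB
        toB := (hs.arr 14 (by decide)).symm ▸ h.toB
        otherFour := (hs.arr 12 (by decide)).symm ▸ h.otherFour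
        otherA := (hs.arr 13 (by decide)).symm ▸ h.otherA
        forest := (hs.arr 3 (by decide)).symm ▸ h.forest })

theorem enter_chosenB_pre : (enter 11).pre W
    (IsLoaded L core { T with chosenB := insert f T.chosenB } e y w f) s :=
  Program.pre.of_agreeOff (Program.pre.mono (h.enter_pre hW h.chosenB) fun s' h11 hs =>
    h.congr hs (by decide) (by decide)
      { chosenA := (hs.arr 10 (by decide)).symm ▸ h.chosenA
        chosenB := h11
        toB := (hs.arr 14 (by decide)).symm ▸ h.toB
        otherFour := (hs.arr 12 (by decide)).symm ▸ h.otherFour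
        otherA := (hs.arr 13 (by decide)).symm ▸ h.otherA
        forest := (hs.arr 3 (by decide)).symm ▸ h.forest })

theorem enter_toB_pre : (enter 14).pre W
    (IsLoaded L core { T with toB := insert f T.toB } e y w f) s :=
  Program.pre.of_agreeOff (Program.pre.mono (h.enter_pre hW h.toB) fun s' h14 hs =>
    h.congr hs (by decide) (by decide)
      { chosenA := (hs.arr 10 (by decide)).symm ▸ h.chosenA
        chosenB := (hs.arr 11 (by decide)).symm ▸ h.chosenB
        toB := h14
        otherFour := (hs.arr 12 (by decide)).symm ▸ h.otherFour
        otherA := (hs.arr 13 (by decide)).symm ▸ h.otherA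
        forest := (hs.arr 3 (by decide)).symm ▸ h.forest })

theorem assign_pre {x : ℕ} {g : Fin m} (hx : s.reg x = g) (i : Fin 4) {Q : State → Prop}
    (hQ : IsLoaded L core { T with forest := Function.update T.forest g i } e y w f
      (s.setArr 3 g i) → Q (s.setArr 3 g i)) : (assign x i).pre W Q s := by
  have hs : AgreeOff [] [3] s (s.setArr 3 g i) :=
    (AgreeOff.refl s).setArr (List.mem_singleton_self 3) _ _
  simp only [assign, Program.pre, Expr.eval, hx]
  refine ⟨by omega, by omega, hQ (h.congr hs (by decide) (by decide)
    { chosenA := h.chosenA, chosenB := h.chosenB, toB := h.toB, otherFour := h.otherFour,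
      otherA := h.otherA, forest := fun g' => ?_ })⟩
  simp only [State.arr_setArr, reduceIte, Function.update_apply, Fin.val_inj, h.forest]
  split_ifs <;> rfl

theorem loadChosen_pre (hy : y ∈ L.cover T.chosenB) : loadChosen.pre W (fun s' =>
    IsLoaded L core T e y w f s' ∧ ∃ g ∈ T.chosenB, ∃ y' : Fin n, s'.reg 7 = g ∧ s'.reg 8 = y' ∧
      L.ends g = s(y', y)) s := by
  obtain ⟨g, hg, hyg, h11⟩ := h.chosenB.exists_of_mem_cover hy
  obtain ⟨y', hy', hgends⟩ := exists_opposite hyg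
  refine Program.pre.of_agreeOff (Program.pre.mono (Q := fun s' => s'.reg 7 = g ∧ s'.reg 8 = y') ?_
    fun s' ⟨h7, h8⟩ hs => ⟨h.congr hs (by decide) (by decide)
      (h.toHoldsTables.congr hs (by decide)), g, hg, y', h7, h8, hgends⟩)
  simp +decide only [loadChosen, Program.pre, Expr.eval, State.reg_setReg, State.arr_setReg,
    reduceIte, h.reg_y, h11, Nat.add_sub_cancel, h.input.src, h.input.dst, hy', and_true]
  omega

end Update

end IsLoaded

end EdgeList

/-! ### Treating an edge -/

namespace EdgeList

open RAM

/-- Chooses the loaded edge of `A` for the fourth forest. -/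
def chooseA : Program := .block [loadEdge, enter 10, assign 5 3, merge 12, merge 13]

/-- Chooses an edge of a cycle of `B` that closes no cycle in the fourth forest. -/
def chooseB : Program := .block [loadEdge, swing 12, enter 11, assign 5 3, merge 12]

/-- Chooses an edge of a cycle of `C` covered by the chosen edges of `A`, and moves it to `A`. -/
def chooseCovered : Program := .block [loadEdge, swing 13, assign 5 0, merge 13]

/-- Loads the edge in register `2` such that, if possible, the vertex in register `3` is not covered
by the chosen edges of `A`. -/
def loadUncovered : Program :=
  .seq loadEdge (.ite (.eq (.get 10 (.reg 3)) (.const 0)) .skip loadEdgeRev)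

/-- Moves the loaded edge to the forest `B` or, if this could close a cycle, to the fourth forest in
exchange for an edge of `B`. -/
def linkB : Program :=
  .seq loadChosen (.ite (.eq (.get 14 (.reg 8)) (.const 0))
    (.block [enter 14, assign 5 1]) (.block [assign 5 3, assign 7 2]))

/-- Chooses the loaded edge when the chosen edges of `B` cover the vertex in register `3` but the
chosen edges of `A` do not. -/
def recordOrLinkB : Program :=
  .ite (.eq (.get 11 (.reg 4)) (.const 0)) (.block [assign 5 3, merge 12]) linkB

/-- Chooses an edge of a cycle of `C` at a vertex in register `3` that is not covered by the chosen
edges of `A`. -/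
def chooseUncovered : Program :=
  .ite (.eq (.get 11 (.reg 3)) (.const 0)) (assign 5 3)
    (.seq (.ite (.eq (.get 11 (.reg 4)) (.const 0)) (swing 12) .skip) recordOrLinkB)

variable {n m W : ℕ} {L : EdgeList n m 3} {core : Finset (Fin m)} {done : Set (Fin m)}
  {D : EdgeDistribution n m} {e f : Fin m} {y w : Fin n} {s : State}

/-- An edge on the cycle of `e` has been chosen, and the memory holds the new distribution. -/
def Chosen (L : EdgeList n m 3) (core : Finset (Fin m)) (done : Set (Fin m))
    (D : EdgeDistribution n m) (e : Fin m) (s : State) : Prop :=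
  ∃ (f : Fin m) (D' : EdgeDistribution n m), L.SameCycle core e f ∧
    D'.chosen = insert f D.chosen ∧ D'.IsValid L core (done ∪ {g | L.SameCycle core e g}) ∧
    HoldsTables L (D'.tables L) s

section Choose

variable (hcore : HasCore L core s) (hT : HoldsTables L (D.tables L) s)
  (hD : D.IsValid L core done) (hW : 3 * n + 2 * m + 3 ≤ W) (he : e ∈ core) (hed : e ∉ done)
  (h2 : s.reg 2 = e)
include hcore hT hD hW he hed h2

theorem chooseA_pre (hp : L.part e = 0) (h1 : D.chosen ∩ L.partEdges 1 = ∅)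
    (hchosen2 : D.chosen ∩ L.partEdges 2 = ∅) : chooseA.pre W (Chosen L core done D e) s := by
  refine (loadEdge_pre hcore hT (by omega) h2).mono fun s h => ?_
  refine (h.enter_chosenA_pre hW).mono fun s h => h.assign_pre hW h.reg_f 3 fun h => ?_
  refine (h.merge_otherFour_pre hW).mono fun s h => (h.merge_otherA_pre hW).mono fun s h => ?_
  refine ⟨e, ((D.choose e).joinFour (L.src e) (L.dst e)).joinA (L.src e) (L.dst e), .refl e, rfl,
    hD.choose_zero hcore.isCore.simple he hed (.refl e) hp h1 hchosen2 rfl, ?_⟩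
  change HoldsTables L { (D.choose e).tables L with
    otherFour := mergeEnds D.otherFour (L.src e) (L.dst e)
    otherA := mergeEnds D.otherA (L.src e) (L.dst e) } s
  rw [hD.tables_choose_zero (hD.isTransversal.notMem hed (.refl e)) hp]
  exact h.toHoldsTables

theorem chooseB_pre (hp : L.part e = 1) (hchosen2 : D.chosen ∩ L.partEdges 2 = ∅) :
    chooseB.pre W (Chosen L core done D e) s := by
  refine (loadEdge_pre hcore hT (by omega) h2).mono fun s h => ?_
  refine (h.swing_pre (by omega) he h.otherFour).mono fun s ⟨w, f, h, ho⟩ => ?_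
  refine (h.enter_chosenB_pre hW).mono fun s h => h.assign_pre hW h.reg_f 3 fun h => ?_
  refine (h.merge_otherFour_pre hW).mono fun s h => ?_
  have hpf : L.part f = 1 := h.sameCycle.part_eq.trans hp
  refine ⟨f, (D.choose f).joinFour w (L.dst e), h.sameCycle, rfl,
    hD.choose_one hcore.isCore.simple he hed h.sameCycle hpf hchosen2 h.ends_eq ho, ?_⟩
  change HoldsTables L { (D.choose f).tables L with
    otherFour := mergeEnds D.otherFour w (L.dst e) } s
  rw [hD.tables_choose_one (hD.isTransversal.notMem hed h.sameCycle) hpf]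
  exact h.toHoldsTables

theorem chooseCovered_pre (hp : L.part e = 2) (hcov : ∀ g, L.SameCycle core e g →
    ∀ v ∈ L.ends g, v ∈ L.cover (D.chosen ∩ L.partEdges 0)) :
    chooseCovered.pre W (Chosen L core done D e) s := by
  refine (loadEdge_pre hcore hT (by omega) h2).mono fun s h => ?_
  refine (h.swing_pre (by omega) he h.otherA).mono fun s ⟨w, f, h, ho⟩ => ?_
  refine h.assign_pre hW h.reg_f 0 fun h => (h.merge_otherA_pre hW).mono fun s h => ?_
  have hpf : L.part f = 2 := h.sameCycle.part_eq.trans hp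
  refine ⟨f, ((D.choose f).linkA f).joinA w (L.dst e), h.sameCycle, rfl,
    hD.linkA hcore.isCore.simple he hed h.sameCycle hpf h.ends_eq
      (hcov f h.sameCycle w (h.ends_eq ▸ Sym2.mem_mk_left _ _))
      (hcov f h.sameCycle _ (h.ends_eq ▸ Sym2.mem_mk_right _ _)) ho, ?_⟩
  change HoldsTables L { ((D.choose f).linkA f).tables L with
    otherA := mergeEnds D.otherA w (L.dst e) } s
  rw [hD.tables_linkA (hD.isTransversal.notMem hed h.sameCycle) hpf]
  exact h.toHoldsTables

end Choose

theorem loadUncovered_pre (hcore : HasCore L core s) {T : DistributionTables n m}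
    (hT : HoldsTables L T s) (hW : 3 * n + 2 * m + 1 ≤ W) (h2 : s.reg 2 = e) :
    loadUncovered.pre W (fun s' => ∃ y w, IsLoaded L core T e y w e s' ∧
      (y ∈ L.cover T.chosenA → ∀ v ∈ L.ends e, v ∈ L.cover T.chosenA)) s := by
  refine Program.pre.of_agreeOff (p := loadEdge)
    (Program.pre.mono (loadEdge_pre hcore hT hW h2) fun s h hs => ?_)
  simp only [Program.pre, Expr.eval, Test.eval, h.reg_y, h.chosenA.eq_zero_iff]
  refine ⟨fun hdst => ⟨_, _, h, fun hdst' => absurd hdst' hdst⟩, fun hdst => ?_⟩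
  refine (loadEdgeRev_pre h.toHasCore h.toHoldsTables hW ((hs.reg 2 (by decide)).trans h2)).mono
    fun s h => ⟨_, _, h, fun hsrc v hv => ?_⟩
  rw [h.ends_eq, Sym2.mem_iff] at hv
  obtain rfl | rfl := hv
  exacts [not_not.1 hdst, hsrc]

section ChooseUncovered

variable (h : IsLoaded L core (D.tables L) e y w f s)
  (hD : D.IsValid L core done) (hW : 3 * n + 2 * m + 3 ≤ W) (he : e ∈ core) (hed : e ∉ done)
  (hp : L.part e = 2) (hy0 : y ∉ L.cover (D.chosen ∩ L.partEdges 0))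
include h hD hW he hed hp hy0

theorem linkB_pre (hy : y ∈ L.cover (D.chosen ∩ L.partEdges 1))
    (hw : w ∈ L.cover (D.chosen ∩ L.partEdges 1)) :
    linkB.pre W (Chosen L core done D e) s := by
  have hpf : L.part f = 2 := h.sameCycle.part_eq.trans hp
  have hf : f ∉ D.chosen := hD.isTransversal.notMem hed h.sameCycle
  refine (h.loadChosen_pre hW hy).mono fun s ⟨h, g, hg, y', h7, h8, hgends⟩ => ?_
  simp only [Program.pre, Expr.eval, Test.eval, h8]
  refine ⟨fun h14 => ?_, fun h14 => ?_⟩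
  · have hy' := h.toB.eq_zero_iff.1 h14
    refine (h.enter_toB_pre hW).mono fun s h => h.assign_pre hW h.reg_f 1 fun h => ?_
    refine ⟨f, (D.choose f).linkB f, h.sameCycle, rfl,
      hD.linkB h.isCore.simple he hed h.sameCycle hpf hg h.ends_eq hgends hy' hw, ?_⟩
    rw [hD.tables_linkB hf hpf]
    exact h.toHoldsTables
  · obtain ⟨k, hk, hy'k⟩ := not_not.1 fun hy' => h14 (h.toB.eq_zero_iff.2 hy')
    refine h.assign_pre hW h.reg_f 3 fun h => h.assign_pre hW (g := g) h7 2 fun h => ?_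
    refine ⟨f, (D.choose f).swap g, h.sameCycle, rfl, hD.swap h.isCore.simple he hed h.sameCycle hpf
      hg h.ends_eq hgends hy0 (hD.toB_subset hk) hy'k, ?_⟩
    rw [hD.tables_swap hf hpf hg]
    exact h.toHoldsTables

theorem recordOrLinkB_pre (hy : y ∈ L.cover (D.chosen ∩ L.partEdges 1))
    (ho : w ∉ L.cover (D.chosen ∩ L.partEdges 1) → D.otherFour y ≠ w) :
    recordOrLinkB.pre W (Chosen L core done D e) s := by
  simp only [recordOrLinkB, Program.pre, Expr.eval, Test.eval, h.reg_w]
  refine ⟨fun hw => ?_, fun hw => linkB_pre h hD hW he hed hp hy0 hy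
    (not_not.1 fun hw' => hw (h.chosenB.eq_zero_iff.2 hw'))⟩
  have hw' := h.chosenB.eq_zero_iff.1 hw
  refine h.assign_pre hW h.reg_f 3 fun h => (h.merge_otherFour_pre hW).mono fun s h => ?_
  have hpf : L.part f = 2 := h.sameCycle.part_eq.trans hp
  refine ⟨f, ((D.choose f).record f).joinFour w y, h.sameCycle, rfl,
    hD.record h.isCore.simple he hed h.sameCycle hpf h.ends_eq hw' hy0 (ho hw'), ?_⟩
  change HoldsTables L { (D.choose f).tables L with otherFour := mergeEnds D.otherFour w y } s
  rw [hD.tables_choose_two (hD.isTransversal.notMem hed h.sameCycle) hpf]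
  exact h.toHoldsTables

end ChooseUncovered

theorem chooseUncovered_pre (h : IsLoaded L core (D.tables L) e y w e s)
    (hD : D.IsValid L core done) (hW : 3 * n + 2 * m + 3 ≤ W) (he : e ∈ core) (hed : e ∉ done)
    (hp : L.part e = 2) (hy0 : y ∉ L.cover (D.chosen ∩ L.partEdges 0)) :
    chooseUncovered.pre W (Chosen L core done D e) s := by
  simp only [chooseUncovered, Program.pre, Expr.eval, Test.eval, h.reg_y, h.reg_w]
  refine ⟨fun hy => ?_, fun hy => ?_⟩
  · refine h.assign_pre hW h.reg_f 3 fun h => ⟨e, D.choose e, .refl e, rfl,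
      hD.choose_two h.isCore.simple he hed (.refl e) hp (h.ends_eq ▸ Sym2.mem_mk_right w y) hy0
        (h.chosenB.eq_zero_iff.1 hy), ?_⟩
    rw [hD.tables_choose_two (hD.isTransversal.notMem hed (.refl e)) hp]
    exact h.toHoldsTables
  have hy' : y ∈ L.cover (D.chosen ∩ L.partEdges 1) :=
    not_not.1 fun hy' => hy (h.chosenB.eq_zero_iff.2 hy')
  refine ⟨fun _ => ?_, fun hw => ?_⟩
  · exact (h.swing_pre (by omega) he h.otherFour).mono fun s ⟨w', f, h, ho⟩ =>
      recordOrLinkB_pre h hD hW he hed hp hy0 hy' fun _ => ho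
  · exact recordOrLinkB_pre h hD hW he hed hp hy0 hy' fun hw' =>
      absurd (h.chosenB.eq_zero_iff.2 hw') hw

end EdgeList

/-! ### Treating all edges of a part -/

namespace EdgeList

open RAM

/-- Runs `body` for every edge of part `c` that has not been stripped and whose cycle is not yet
marked. -/
def phase (c : ℕ) (body : Program) : Program :=
  .forLoop (.reg 1)
    (.ite (.and (.and (.eq (.get 8 (.reg 2)) (.const 0)) (.eq (.get 9 (.reg 2)) (.const 0)))
      (.eq (.get 2 (.reg 2)) (.const c))) body .skip)

/-- Chooses the edges of the cycles of `A`. -/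
def phaseA : Program := phase 0 (.seq chooseA mark)

/-- Chooses the edges of the cycles of `B`. -/
def phaseB : Program := phase 1 (.seq chooseB mark)

/-- Chooses the edges of the cycles of `C` that the chosen edges of `A` do not cover. -/
def phaseUncovered : Program := phase 2 (.seq loadUncovered
  (.ite (.eq (.get 10 (.reg 3)) (.const 0)) (.seq chooseUncovered mark) .skip))

/-- Chooses the edges of the other cycles of `C`. -/
def phaseCovered : Program := phase 2 (.seq chooseCovered mark)

variable {n m W φ b : ℕ} {L : EdgeList n m 3} {core : Finset (Fin m)} {c : Fin 3}
  {done : Set (Fin m)} {D : EdgeDistribution n m} {e : Fin m} {s : State}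

/-- The invariant of the phases that choose edges of the parts up to `c`. -/
structure PhaseInvariant (L : EdgeList n m 3) (core : Finset (Fin m)) (c : Fin 3)
    (done : Set (Fin m)) (D : EdgeDistribution n m) (s : State) : Prop
    extends HasCore L core s, HoldsTables L (D.tables L) s where
  marks : ∀ f : Fin m, s.arr 9 f = 0 ↔ f ∉ done
  isValid : D.IsValid L core done
  part_le : ∀ f ∈ D.chosen, L.part f ≤ c

namespace PhaseInvariant

variable (h : PhaseInvariant L core c done D s)
include h

theorem setReg_two (v : ℕ) : PhaseInvariant L core c done D (s.setReg 2 v) :=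
  ⟨h.toHasCore.setReg (by decide) v,
    h.toHoldsTables.congr (A := []) ((AgreeOff.refl s).setReg (List.mem_singleton_self 2) v)
      (by decide), h.marks, h.isValid, h.part_le⟩

theorem of_le {d : Fin 3} (hcd : c ≤ d) : PhaseInvariant L core d done D s :=
  ⟨h.toHasCore, h.toHoldsTables, h.marks, h.isValid, fun f hf => (h.part_le f hf).trans hcd⟩

theorem chosen_inter_eq_empty {d : Fin 3} (hcd : c < d) : D.chosen ∩ L.partEdges d = ∅ :=
  Set.eq_empty_of_forall_notMem fun f ⟨hf, hfd⟩ => (h.part_le f hf).not_gt (hcd.trans_eq hfd.symm)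

end PhaseInvariant

/-- The phase has advanced from `done` and `D`: the edges of `E` have been processed, in the sense
that they are done or belong to `R` of the chosen edges, and of the time that `done` leaves for
marking edges only the time for the newly marked ones has been spent. -/
def Progress (L : EdgeList n m 3) (core : Finset (Fin m)) (c : Fin 3)
    (R : Set (Fin m) → Set (Fin m)) (φ : ℕ) (done : Set (Fin m)) (D : EdgeDistribution n m)
    (E : Set (Fin m)) (ψ : ℕ) (s : State) : Prop :=
  ∃ (done' : Set (Fin m)) (D' : EdgeDistribution n m), ψ = φ + done'ᶜ.ncard * 60 ∧
    PhaseInvariant L core c done' D' s ∧ done ⊆ done' ∧ D.chosen ⊆ D'.chosen ∧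
    E ⊆ done' ∪ R D'.chosen

theorem phase_halts {R : Set (Fin m) → Set (Fin m)} (hR : Monotone R) {body : Program}
    (hreg : 2 ∉ body.regs) (hW : m ≤ W)
    (hbody : ∀ s done₁ D₁ (e : Fin m), done ⊆ done₁ → D.chosen ⊆ D₁.chosen →
      PhaseInvariant L core c done₁ D₁ s → s.reg 2 = e → e ∈ core → e ∉ done₁ → L.part e = c →
      Halts W body s (φ + done₁ᶜ.ncard * 60 + b) (Progress L core c R φ done₁ D₁ {e}))
    (h : PhaseInvariant L core c done D s) :
    Halts W (phase c body) s (φ + doneᶜ.ncard * 60 + (m + 1) * (b + 30))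
      (Progress L core c R φ done D {e | e ∈ core ∧ L.part e = c}) := by
  refine (Halts.forLoop (c := b + 16) (N := m) (e := .reg 1) (fun i =>
    Progress L core c R φ done D {e | (e ∈ core ∧ L.part e = c) ∧ e.val < i}) hW ?_ ?_ ?_ ?_).mono
    (Nat.add_le_add_left (Nat.mul_le_mul_left _ (by simp only [Expr.cost]; omega)) _) ?_
  · simpa only [Program.regs, List.append_nil] using hreg
  · rintro i ψ s ⟨done₁, D₁, -, h₁, -⟩
    exact h₁.input.reg_one
  · rintro i _ s hi h2 ⟨done₁, D₁, rfl, h₁, hdone, hchosen, hE⟩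
    obtain ⟨e, rfl⟩ : ∃ e : Fin m, e.val = i := ⟨⟨i, hi⟩, rfl⟩
    have htest : (Test.and (.and (.eq (.get 8 (.reg 2)) (.const 0))
        (.eq (.get 9 (.reg 2)) (.const 0))) (.eq (.get 2 (.reg 2)) (.const c))).eval s ↔
        (e ∈ core ∧ e ∉ done₁) ∧ L.part e = c := by
      simp only [Test.eval, Expr.eval, h2, h₁.removed, h₁.marks, h₁.input.part, Fin.val_inj]
    refine (Halts.ite (φ := φ + done₁ᶜ.ncard * 60 + (b + 1)) (fun he => ?_) fun he => ?_).mono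
      (by simp only [Test.cost, Expr.cost]; omega) fun _ _ => id
    · obtain ⟨⟨he, hed⟩, hp⟩ := htest.1 he
      refine (hbody s done₁ D₁ e hdone hchosen h₁ h2 he hed hp).mono (by omega) ?_
      rintro _ s ⟨done₂, D₂, rfl, h₂, hdone', hchosen', he'⟩
      refine ⟨done₂, D₂, rfl, h₂.setReg_two _, hdone.trans hdone', hchosen.trans hchosen', ?_⟩
      rintro f ⟨hf, hfe⟩
      obtain hfe | hfe := Nat.lt_succ_iff_lt_or_eq.1 hfe
      · exact (hE ⟨hf, hfe⟩).imp (@hdone' f) (@hR _ _ hchosen' f)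
      · exact he' (Fin.ext hfe)
    · refine (Halts.skip (φ := φ + done₁ᶜ.ncard * 60) ?_).mono (by omega) fun _ _ => id
      refine ⟨done₁, D₁, rfl, h₁.setReg_two _, hdone, hchosen, fun f ⟨hf, hfe⟩ => ?_⟩
      obtain hfe | hfe := Nat.lt_succ_iff_lt_or_eq.1 hfe
      · exact hE ⟨hf, hfe⟩
      · obtain rfl := Fin.ext hfe
        exact Or.inl (not_not.1 fun hfd => he (htest.2 ⟨⟨hf.1, hfd⟩, hf.2⟩))
  · exact ⟨done, D, rfl, h.setReg_two _, subset_rfl, subset_rfl,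
      fun f hf => (Nat.not_lt_zero _ hf.2).elim⟩
  · rintro ψ s ⟨done₁, D₁, hψ, h₁, hdone, hchosen, hE⟩
    exact ⟨done₁, D₁, hψ, h₁, hdone, hchosen, fun f hf => hE ⟨hf, f.isLt⟩⟩

theorem choose_mark_halts (h : PhaseInvariant L core c done D s) (hW : 3 * n + 2 * m + 3 ≤ W)
    (h2 : s.reg 2 = e) (he : e ∈ core) (hed : e ∉ done) (hp : L.part e = c) {choose : Program}
    (hregs : (0 ∉ choose.regs ∧ 1 ∉ choose.regs) ∧ 2 ∉ choose.regs)
    (harrs : ((0 ∉ choose.arrs ∧ 1 ∉ choose.arrs ∧ 2 ∉ choose.arrs) ∧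
      (4 ∉ choose.arrs ∧ 5 ∉ choose.arrs) ∧ 6 ∉ choose.arrs ∧ 7 ∉ choose.arrs ∧
      8 ∉ choose.arrs) ∧ 9 ∉ choose.arrs)
    (hpre : choose.pre W (Chosen L core done D e) s) {R : Set (Fin m) → Set (Fin m)} :
    Halts W (.seq choose mark) s (φ + doneᶜ.ncard * 60 + (choose.bound + 10))
      (Progress L core c R φ done D {e}) := by
  refine Halts.seq ((hpre.halts (φ + doneᶜ.ncard * 60 + 10)).agreeOff.mono (by omega) ?_)
  rintro _ s' ⟨⟨rfl, f, D', hef, hchosen, hD', hT⟩, hagree⟩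
  have hcore := h.toHasCore.congr hagree hregs.1 harrs.1
  refine (hcore.mark_halts (done := done) (by omega) (by rw [hagree.arr 9 harrs.2]; exact h.marks)
    he (fun f hf hfd => hed (h.isValid.isTransversal.mem_done_of_sameCycle hfd hf.symm))
    ((hagree.reg 2 hregs.2).trans h2) φ).agreeOff.mono le_rfl ?_
  rintro ψ s'' ⟨⟨hψ, hmarks⟩, hagree'⟩
  refine ⟨_, D', hψ, ⟨hcore.congr hagree' (by decide) (by decide), hT.congr hagree' (by decide),
    hmarks, hD', ?_⟩, Set.subset_union_left, hchosen ▸ Set.subset_insert _ _, ?_⟩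
  · rw [hchosen, Set.forall_mem_insert]
    exact ⟨(hef.part_eq.trans hp).le, h.part_le⟩
  · rintro _ rfl
    exact Or.inl (Or.inr (.refl _))

theorem phaseA_halts (h : PhaseInvariant L core 0 done D s) (hW : 3 * n + 2 * m + 3 ≤ W) :
    Halts W phaseA s (φ + doneᶜ.ncard * 60 + (m + 1) * 200)
      (Progress L core 0 (fun _ => ∅) φ done D {e | e ∈ core ∧ L.part e = 0}) := by
  refine phase_halts (b := 170) monotone_const (by decide) (by omega) ?_ h
  intro s done D e _ _ h h2 he hed hp
  have hbound : chooseA.bound + 10 ≤ 170 := by decide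
  exact (choose_mark_halts h hW h2 he hed hp (by decide) (by decide)
    (chooseA_pre h.toHasCore h.toHoldsTables h.isValid hW he hed h2 hp
      (h.chosen_inter_eq_empty (by decide)) (h.chosen_inter_eq_empty (by decide)))).mono
    (by omega) fun _ _ => id

theorem phaseB_halts (h : PhaseInvariant L core 1 done D s) (hW : 3 * n + 2 * m + 3 ≤ W) :
    Halts W phaseB s (φ + doneᶜ.ncard * 60 + (m + 1) * 200)
      (Progress L core 1 (fun _ => ∅) φ done D {e | e ∈ core ∧ L.part e = 1}) := by
  refine phase_halts (b := 170) monotone_const (by decide) (by omega) ?_ h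
  intro s done D e _ _ h h2 he hed hp
  have hbound : chooseB.bound + 10 ≤ 170 := by decide
  exact (choose_mark_halts h hW h2 he hed hp (by decide) (by decide)
    (chooseB_pre h.toHasCore h.toHoldsTables h.isValid hW he hed h2 hp
      (h.chosen_inter_eq_empty (by decide)))).mono (by omega) fun _ _ => id

/-- The edges both of whose ends are covered by the edges of `M` in `A`. -/
def coveredA (L : EdgeList n m 3) (M : Set (Fin m)) : Set (Fin m) :=
  {e | ∀ v ∈ L.ends e, v ∈ L.cover (M ∩ L.partEdges 0)}

theorem coveredA_mono (L : EdgeList n m 3) : Monotone L.coveredA :=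
  fun _ _ hM _ he v hv => cover_mono (Set.inter_subset_inter_left _ hM) (he v hv)

theorem phaseUncovered_halts (h : PhaseInvariant L core 2 done D s)
    (hW : 3 * n + 2 * m + 3 ≤ W) :
    Halts W phaseUncovered s (φ + doneᶜ.ncard * 60 + (m + 1) * 300)
      (Progress L core 2 L.coveredA φ done D {e | e ∈ core ∧ L.part e = 2}) := by
  refine phase_halts (b := 270) L.coveredA_mono (by decide) (by omega) ?_ h
  intro s done D e _ _ h h2 he hed hp
  have hload : loadUncovered.bound ≤ 40 := by decide
  have hchoose : chooseUncovered.bound + 10 ≤ 220 := by decide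
  refine Halts.seq (((loadUncovered_pre h.toHasCore h.toHoldsTables (by omega) h2).halts
    (φ + doneᶜ.ncard * 60 + 225)).agreeOff.mono (by omega) ?_)
  rintro _ s' ⟨⟨rfl, y, w, hloaded, hcovered⟩, hagree⟩
  have h' : PhaseInvariant L core 2 done D s' :=
    ⟨hloaded.toHasCore, hloaded.toHoldsTables, by rw [hagree.arr 9 (by decide)]; exact h.marks,
      h.isValid, h.part_le⟩
  refine (Halts.ite (φ := φ + doneᶜ.ncard * 60 + 220) (fun hy => ?_) fun hy => ?_).mono
    (by simp only [Test.cost, Expr.cost]; omega) fun _ _ => id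
  all_goals simp only [Test.eval, Expr.eval, hloaded.reg_y, hloaded.chosenA.eq_zero_iff] at hy
  · exact (choose_mark_halts h' hW ((hagree.reg 2 (by decide)).trans h2) he hed hp (by decide)
      (by decide) (chooseUncovered_pre hloaded h.isValid hW he hed hp hy)).mono (by omega)
      fun _ _ => id
  · refine (Halts.skip (φ := φ + doneᶜ.ncard * 60) ?_).mono (by omega) fun _ _ => id
    refine ⟨done, D, rfl, h', subset_rfl, subset_rfl, ?_⟩
    rintro _ rfl
    exact Or.inr (hcovered (not_not.1 hy))

theorem phaseCovered_halts (h : PhaseInvariant L core 2 done D s) (hW : 3 * n + 2 * m + 3 ≤ W)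
    (hcovered : {e | e ∈ core ∧ L.part e = 2} ⊆ done ∪ L.coveredA D.chosen) :
    Halts W phaseCovered s (φ + doneᶜ.ncard * 60 + (m + 1) * 200)
      (Progress L core 2 (fun _ => ∅) φ done D {e | e ∈ core ∧ L.part e = 2}) := by
  refine phase_halts (b := 170) monotone_const (by decide) (by omega) ?_ h
  intro s done₁ D₁ e hdone hchosen h h2 he hed hp
  have hbound : chooseCovered.bound + 10 ≤ 170 := by decide
  refine (choose_mark_halts h hW h2 he hed hp (by decide) (by decide)
    (chooseCovered_pre h.toHasCore h.toHoldsTables h.isValid hW he hed h2 hp fun g hg => ?_)).mono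
    (by omega) fun _ _ => id
  refine L.coveredA_mono hchosen ((hcovered ⟨hg.mem he, hg.part_eq.trans hp⟩).resolve_left ?_)
  exact fun hgd => hed (h.isValid.isTransversal.mem_done_of_sameCycle (hdone hgd) hg.symm)

end EdgeList

/-! ### The whole program -/

namespace EdgeList

open RAM

/-- Sets up the tables and strips the edges that lie on no cycle. -/
def prepare : Program := .seq initEnds (.seq build strip)

/-- Chooses an edge of every cycle and distributes the chosen edges. -/
def chooseAll : Program := .seq phaseA (.seq phaseB (.seq phaseUncovered phaseCovered))

/-- The program that converts three pseudoforests into four forests. -/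
def forestProgram : Program := .seq prepare chooseAll

variable {n m W : ℕ} {L : EdgeList n m 3} {core : Finset (Fin m)} {s : State}

theorem hasInput_inputState (L : EdgeList n m 3) : HasInput L (inputState L) where
  reg_zero := rfl
  reg_one := rfl
  src e := dif_pos e.isLt
  dst e := dif_pos e.isLt
  part e := dif_pos e.isLt

theorem PhaseInvariant.of_hasCore (h : HasCore L core s)
    (hzero : ∀ a ∈ [9, 10, 11, 14], s.arr a = fun _ => 0)
    (hends : ∀ v : Fin n, s.arr 12 v = v ∧ s.arr 13 v = v)
    (hforest : ∀ e : Fin m, s.arr 3 e = L.part e) :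
    PhaseInvariant L core 0 ∅ (.empty n m) s where
  toHasCore := h
  chosenA v := Or.inl ⟨fun ⟨_, he, _⟩ => he.1, congrFun (hzero 10 (by decide)) v⟩
  chosenB v := Or.inl ⟨fun ⟨_, he, _⟩ => he.1, congrFun (hzero 11 (by decide)) v⟩
  toB v := Or.inl ⟨fun ⟨_, he, _⟩ => he, congrFun (hzero 14 (by decide)) v⟩
  otherFour v := (hends v).1
  otherA v := (hends v).2
  forest e := by
    simp [hforest e, EdgeDistribution.tables, EdgeDistribution.forest, EdgeDistribution.empty]
  marks f := iff_of_true (congrFun (hzero 9 (by decide)) f) (Set.notMem_empty f)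
  isValid := .empty L core
  part_le _ hf := hf.elim

theorem prepare_halts (hL : L.IsSimple) (hP : ∀ c, IsPseudoforest (L.graph (L.partEdges c)))
    (hW : 3 * n + 2 * m ≤ W) (φ : ℕ) :
    Halts W prepare (inputState L) (φ + 300 * (n + m + 1)) fun ψ s => ψ = φ ∧
      ∃ core : Finset (Fin m), PhaseInvariant L core 0 ∅ (.empty n m) s := by
  refine Halts.seq ((initEnds_halts (by omega) (hasInput_inputState L).reg_zero
    (φ + m * 100 + (3 * n + 1) * 20 + (m + 1) * 100)).agreeOff.mono (by omega) ?_)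
  rintro _ s₁ ⟨⟨rfl, hends⟩, hagree₁⟩
  have hinput := (hasInput_inputState L).congr hagree₁ (by decide) (by decide)
  refine Halts.seq ((build_halts hL hinput (hagree₁.arr 6 (by decide)) (hagree₁.arr 7 (by decide))
    hW (φ + m * 100 + (3 * n + 1) * 20)).agreeOff.mono le_rfl ?_)
  rintro _ s₂ ⟨⟨rfl, hforest, hnodes, hcounts⟩, hagree₂⟩
  have hremaining : HasRemaining L Finset.univ s₂ :=
    ⟨hinput.congr hagree₂ (by decide) (by decide), hnodes, hcounts, fun e => iff_of_true
      (congrFun ((hagree₂.arr 8 (by decide)).trans (hagree₁.arr 8 (by decide))) e)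
      (Finset.mem_univ e)⟩
  refine (strip_halts hL hremaining hW φ).agreeOff.mono le_rfl ?_
  rintro _ s₃ ⟨⟨rfl, core, hcore, hleafless, hcard⟩, hagree₃⟩
  have hzero {a : ℕ} (h₁ : a ∉ initEnds.arrs) (h₂ : a ∉ build.arrs) (h₃ : a ∉ strip.arrs) :
      s₃.arr a = (inputState L).arr a :=
    (hagree₃.arr a h₃).trans ((hagree₂.arr a h₂).trans (hagree₁.arr a h₁))
  refine ⟨rfl, core, .of_hasCore ⟨hcore, hleafless.isCore hL hP hcard⟩ ?_ ?_ ?_⟩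
  · simp only [List.forall_mem_cons]
    exact ⟨hzero (by decide) (by decide) (by decide), hzero (by decide) (by decide) (by decide),
      hzero (by decide) (by decide) (by decide), hzero (by decide) (by decide) (by decide),
      List.forall_mem_nil _⟩
  · rwa [hagree₃.arr 12 (by decide), hagree₃.arr 13 (by decide), hagree₂.arr 12 (by decide),
      hagree₂.arr 13 (by decide)]
  · rwa [hagree₃.arr 3 (by decide)]

theorem chooseAll_halts (h : PhaseInvariant L core 0 ∅ (.empty n m) s)
    (hW : 3 * n + 2 * m + 3 ≤ W) :
    Halts W chooseAll s (1000 * (m + 1)) fun _ s => ∃ D, PhaseInvariant L core 2 core D s := by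
  have hempty : (∅ : Set (Fin m))ᶜ.ncard = m := by
    rw [Set.compl_empty, Set.ncard_univ, Nat.card_fin]
  refine Halts.seq ((phaseA_halts (φ := 700 * (m + 1)) h hW).mono (by omega) ?_)
  rintro _ s₁ ⟨done₁, D₁, rfl, h₁, -, -, hA⟩
  refine Halts.seq ((phaseB_halts (φ := 500 * (m + 1)) (h₁.of_le (Fin.zero_le 1)) hW).mono
    (by omega) ?_)
  rintro _ s₂ ⟨done₂, D₂, rfl, h₂, hdone₂, -, hB⟩
  refine Halts.seq ((phaseUncovered_halts (φ := 200 * (m + 1)) (h₂.of_le (by decide)) hW).mono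
    (by omega) ?_)
  rintro _ s₃ ⟨done₃, D₃, rfl, h₃, hdone₃, -, hcovered⟩
  refine (phaseCovered_halts (φ := 0) h₃ hW hcovered).mono (by omega) ?_
  rintro _ s₄ ⟨done₄, D₄, -, h₄, hdone₄, -, hC⟩
  have hdone : done₄ = core := by
    refine h₄.isValid.isTransversal.done_subset.antisymm fun e he => ?_
    have hcases : ∀ c : Fin 3, c = 0 ∨ c = 1 ∨ c = 2 := by decide
    obtain hp | hp | hp := hcases (L.part e)
    · exact hdone₄ (hdone₃ (hdone₂ ((hA ⟨he, hp⟩).resolve_right id)))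
    · exact hdone₄ (hdone₃ ((hB ⟨he, hp⟩).resolve_right id))
    · exact (hC ⟨he, hp⟩).resolve_right id
  exact ⟨D₄, hdone ▸ h₄⟩

theorem forestProgram_halts (hL : L.IsSimple)
    (hP : ∀ c, IsPseudoforest (L.graph (L.partEdges c))) (hW : 3 * n + 2 * m + 3 ≤ W) :
    ∃ t s, Exec W forestProgram (inputState L) t s ∧ t ≤ 2000 * (n + m + 1) ∧
      ∃ (core : Finset (Fin m)) (D : EdgeDistribution n m), L.IsCore core ∧
        D.IsValid L core core ∧ ∀ e : Fin m, s.arr 3 e = D.forest L e := by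
  obtain ⟨t, s, _, hexec, ht, core, D, h⟩ := Halts.seq
    ((prepare_halts hL hP (by omega) (1000 * (m + 1))).mono (by omega :
      _ ≤ 2000 * (n + m + 1)) fun _ _ ⟨hψ, core, h⟩ => hψ ▸ (chooseAll_halts h hW).mono le_rfl
        fun _ _ h => Exists.intro core h)
  exact ⟨t, s, hexec, by omega, core, D, h.isCore, h.isValid, h.forest⟩

end EdgeList

/-- There are one program and one constant `K` such that, for every finite simple graph `G` and
every pseudoforest partition `(P 0, P 1, P 2)` of it, given as an edge list, the program halts
within `K * (n + m + 1)` steps (with words of size `log₂ (n + m + 1) + O(1)` bits) and leaves in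
array `3` the part numbers of a forest partition `(F 0, F 1, F 2, F 3)` of `G` in which `F 3` has
maximum degree at most three. -/
theorem mainTheorem5 :
    ∃ (prog : RAM.Program) (K : ℕ),
      ∀ (n m : ℕ) (G : SimpleGraph (Fin n)) (P : Fin 3 → SimpleGraph (Fin n))
        (L : EdgeList n m 3),
        IsPseudoforestPartition G P → L.Represents P →
        ∃ (t : ℕ) (s : RAM.State),
          RAM.Exec (K * (n + m + 1)) prog (RAM.inputState L) t s ∧
          t ≤ K * (n + m + 1) ∧
          ∃ (F : Fin 4 → SimpleGraph (Fin n)) (out : Fin m → Fin 4),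
            (∀ i : Fin m, s.arr 3 i = out i) ∧
            EdgeList.Represents ⟨L.src, L.dst, out⟩ F ∧
            IsForestPartition G F ∧
            ∀ [DecidableRel (F 3).Adj], (F 3).maxDegree ≤ 3 := by
  refine ⟨EdgeList.forestProgram, 2000, fun n m G P L hG hL => ?_⟩
  obtain ⟨t, s, hexec, ht, core, D, hcore, hD, hs⟩ :=
    EdgeList.forestProgram_halts (W := 2000 * (n + m + 1)) hL.isSimple
      (fun c => hL.graph_partEdges c ▸ hG.2 c) (by omega)
  have hF : EdgeList.Represents ⟨L.src, L.dst, D.forest L⟩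
      fun i => L.graph {e | D.forest L e = i} :=
    EdgeList.IsSimple.represents (L := ⟨L.src, L.dst, D.forest L⟩)
      ⟨hL.isSimple.inj, hL.isSimple.ne⟩
  refine ⟨t, s, hexec, ht, _, D.forest L, hs, hF, ⟨hF.isEdgePartition ?_, ?_⟩, ?_⟩
  · exact hL.iUnion_edgeSet.symm.trans hG.1.union
  · exact hD.isAcyclic_graph_forest hcore
  · exact maxDegree_le_of_forall_degree_le _ _ (hD.degree_graph_forest_three_le hcore.simple)
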